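/- Let $d\ge 1$, let $\Omega\subset\mathbb R^d$ be a bounded open set and let $1<p<\infty$. For $\phi\in L^p(\Omega)$ and $A\subset\Omega$ open put $$\mathcal F(\phi;A)=\int_A|\nabla\phi|^p\,dx\ \text{ if }\phi\in W^{1,p}(A),\qquad \mathcal F(\phi;A)=+\infty\ \text{ otherwise.}$$ Let $X=\{\phi\in L^p(\Omega):\mathcal F(\phi;\Omega)<\infty\}=W^{1,p}(\Omega)$; for $\phi\in X$ write $\mathcal F^\phi=|\nabla\phi|^p\mathcal L^d$. Let $\mathcal M^+(\Omega)$ be the set of finite non-negative Radon measures on $\Omega$ with the weak* topology (tested against $C_0(\Omega)$). (a) $\mathcal F$ is an admissible energy with respect to $L^p$ convergence, that is: (Ad1) $\phi\mapsto\mathcal F(\phi;A)$ is lower semicontinuous on $L^p(\Omega)$ for every open $A\subset\Omega$; (Ad2) for every $\phi\in X$, $\mathcal F(\phi;\cdot)$ is the restriction to open sets of a finite Radon measure $\mathcal F^\phi$ on $\Omega$; (Ad3) if $\phi\in X$, $A\subset\Omega$ is open, $\mathcal F(\phi;A)=0$, $U$ is a non-empty open set with $U\subset\subset A$, and $\varepsilon>0$,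 then there is $\bar\phi\in X$ with $\bar\phi=\phi$ a.e. on $\Omega\setminus U$, $\|\bar\phi-\phi\|_{L^p}\le\varepsilon$, $\mathcal F^{\bar\phi}(\partial U)=0$ and $0<\mathcal F^{\bar\phi}(A)=\mathcal F^{\bar\phi}(U)<\varepsilon$; (Ad4) for every $\phi\in X$ and every $f\in L^1(\Omega,\mathcal F^\phi)$ with $f\ge1$ $\mathcal F^\phi$-a.e. there are $\phi_n\in X$ with $\phi_n\to\phi$ in $L^p(\Omega)$ and $\mathcal F^{\phi_n}\rightharpoonup^* f\mathcal F^\phi$. (b) Let $\psi:[0,\infty)\to(0,\infty)$ be a Borel function with $\inf\psi>0$ that is lower semicontinuous at $0$, i.e. $\psi(0)\le\liminf_{t\to0^+}\psi(t)$ (for instance $\psi$ non-decreasing, or continuous at $0$). Let $$\psi^{cs}(t)=\sup\{g(t): g:[0,\infty)\to\mathbb R\text{ convex and subadditive},\ g\le\psi\}.$$ Then the limit $\Theta^{cs}=\lim_{t\to\infty}\psi^{cs}(t)/t$ exists and is finite. Define $\mathcal G$ on $L^p(\Omega)\times\mathcal M^+(\Omega)$ by $$\mathcal G(\phi,\mu)=\int_\Omega\psi(u)|\nabla\phi|^p\,dx\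 \text{ if }\phi\in W^{1,p}(\Omega)\text{ and }\mu=u|\nabla\phi|^p\mathcal L^d,\qquad \mathcal G(\phi,\mu)=+\infty\text{ otherwise.}$$ Then the lower semicontinuous envelope of $\mathcal G$ in the $L^p\times w^*$ topology, i.e. the greatest lower semicontinuous functional below $\mathcal G$, is $$\overline{\mathcal G}(\phi,\mu)=\int_\Omega\psi^{cs}(u)|\nabla\phi|^p\,dx+\Theta^{cs}\mu^\perp(\Omega)\quad\text{if }\phi\in W^{1,p}(\Omega),\qquad \overline{\mathcal G}(\phi,\mu)=+\infty\text{ otherwise,}$$ where $\mu=u|\nabla\phi|^p\mathcal L^d+\mu^\perp$ is the Radon--Nikodym decomposition of $\mu$ with respect to $|\nabla\phi|^p\mathcal L^d$. Moreover $\overline{\mathcal G}$ is the sequential $\Gamma$-limit of the constant sequence $\mathcal G$: $\overline{\mathcal G}(\phi,\mu)\le\liminf_n\mathcal G(\phi_n,\mu_n)$ whenever $\phi_n\to\phi$ in $L^p(\Omega)$ and $\mu_n\rightharpoonup^*\mu$, and for every $(\phi,\mu)$ some such sequence satisfies $\limsup_n\mathcal G(\phi_n,\mu_n)\le\overline{\mathcal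 G}(\phi,\mu)$. -/

import Mathlib

open MeasureTheory Filter Topology Set
open scoped ENNReal ContDiff ZeroAtInfty

namespace DirichletRelaxation

noncomputable section

/-- An exponent `p > 1` is in particular a Banach exponent; this puts the norm on `L^p`. -/
instance fact_one_le_ofReal (p : ℝ) [hp : Fact (1 < p)] : Fact (1 ≤ ENNReal.ofReal p) :=
  ⟨by simpa using ENNReal.ofReal_le_ofReal hp.out.le⟩

/-- The Euclidean space `ℝ^d`. -/
abbrev Space (d : ℕ) : Type := EuclideanSpace ℝ (Fin d)

/-- The space `L^p(Ω)` of real functions, for Lebesgue measure on `Ω ⊆ ℝ^d`. -/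
abbrev LpSpace {d : ℕ} (Ω : Set (Space d)) (p : ℝ) : Type :=
  Lp ℝ (ENNReal.ofReal p) (volume.restrict Ω)

/-! ### Finite non-negative Radon measures on `Ω` and weak* convergence -/

/-- The finite non-negative Radon measures on `Ω`, as the finite Borel measures on `ℝ^d` that
are concentrated on `Ω`. -/
structure PosMeasure {d : ℕ} (Ω : Set (Space d)) where
  toMeasure : Measure (Space d)
  isFinite : IsFiniteMeasure toMeasure
  compl_null : toMeasure Ωᶜ = 0

/-- The space `C_0(Ω)`, each function being extended by zero outside `Ω`. -/
abbrev TestFun {d : ℕ} (Ω : Set (Space d)) : Type :=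
  {ζ : C₀(Space d, ℝ) // ∀ x, x ∉ Ω → ζ x = 0}

/-- The weak* topology: the coarsest one for which `μ ↦ ∫ ζ dμ` is continuous for every
`ζ ∈ C_0(Ω)`. -/
instance weakStarTopology {d : ℕ} (Ω : Set (Space d)) : TopologicalSpace (PosMeasure Ω) :=
  TopologicalSpace.induced
    (fun (μ : PosMeasure Ω) (ζ : TestFun Ω) => ∫ x, ζ.1 x ∂μ.toMeasure) Pi.topologicalSpace

/-- The measure `f ν`, for a (non-negative) density `f ∈ L^1(ν)`. -/
def PosMeasure.mulDensity {d : ℕ} {Ω : Set (Space d)} (ν : PosMeasure Ω) (f : Space d → ℝ)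
    (hf : Integrable f ν.toMeasure) : PosMeasure Ω where
  toMeasure := ν.toMeasure.withDensity (fun x => ENNReal.ofReal (f x))
  isFinite := isFiniteMeasure_withDensity_ofReal hf.2
  compl_null := withDensity_absolutelyContinuous _ _ ν.compl_null

/-! ### Weak gradients and the `p`-Dirichlet energy -/

/-- `V` is a weak gradient of `φ` on the open set `A`. -/
def IsWeakGradient {d : ℕ} (A : Set (Space d)) (φ : Space d → ℝ) (V : Space d → Space d) : Prop :=
  ∀ η : Space d → ℝ, ContDiff ℝ ∞ η → HasCompactSupport η → tsupport η ⊆ A →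
    ∀ w : Space d,
      ∫ x in A, φ x * fderiv ℝ η x w = - ∫ x in A, η x * inner ℝ (V x) w

/-- `φ` has a weak gradient in `L^p(A; ℝ^d)`. For `φ ∈ L^p(A)` this is `φ ∈ W^{1,p}(A)`. -/
def MemSobolev {d : ℕ} (p : ℝ) (A : Set (Space d)) (φ : Space d → ℝ) : Prop :=
  ∃ V : Space d → Space d,
    MemLp V (ENNReal.ofReal p) (volume.restrict A) ∧ IsWeakGradient A φ V

open Classical in
/-- The weak gradient on `A` (unique up to null sets) of a function in `W^{1,p}(A)`. -/
def weakGradient {d : ℕ} (p : ℝ) (A : Set (Space d)) (φ : Space d → ℝ) : Space d → Space d :=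
  if h : MemSobolev p A φ then h.choose else 0

open Classical in
/-- The `p`-Dirichlet energy `F(φ; A) = ∫_A |∇φ|^p dx` if `φ ∈ W^{1,p}(A)`, and `+∞` otherwise. -/
def dirichletEnergy {d : ℕ} (Ω : Set (Space d)) (p : ℝ) (φ : LpSpace Ω p) (A : Set (Space d)) :
    ℝ≥0∞ :=
  if MemSobolev p A φ then ∫⁻ x in A, ‖weakGradient p A φ x‖ₑ ^ p else ⊤

/-- The measure `F^φ = |∇φ|^p dx` on `Ω`, for `φ ∈ W^{1,p}(Ω)`. -/
def dirichletMeasure {d : ℕ} (Ω : Set (Space d)) (p : ℝ) (φ : LpSpace Ω p) :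
    Measure (Space d) :=
  (volume.restrict Ω).withDensity (fun x => ‖weakGradient p Ω φ x‖ₑ ^ p)

/-! ### Admissible energies -/

/-- `F(φ; ·)` is the restriction to the open subsets of `Ω` of the measure `ν`. -/
def Represents {d : ℕ} {Ω : Set (Space d)} {p : ℝ} (F : LpSpace Ω p → Set (Space d) → ℝ≥0∞)
    (φ : LpSpace Ω p) (ν : PosMeasure Ω) : Prop :=
  ∀ A : Set (Space d), IsOpen A → A ⊆ Ω → F φ A = ν.toMeasure A

/-- Admissible energies on `L^p(Ω)`. The finiteness domain `X` is `{φ | F φ Ω < ⊤}`. -/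
structure IsAdmissible {d : ℕ} (Ω : Set (Space d)) (p : ℝ) [Fact (1 < p)]
    (F : LpSpace Ω p → Set (Space d) → ℝ≥0∞) : Prop where
  /-- Lower semicontinuity on every open subset. -/
  lsc : ∀ A : Set (Space d), IsOpen A → A ⊆ Ω → LowerSemicontinuous (fun φ => F φ A)
  /-- `F^φ` is a Radon measure. -/
  measure : ∀ φ : LpSpace Ω p, F φ Ω < ⊤ → ∃ ν : PosMeasure Ω, Represents F φ ν
  /-- Non-degeneracy. -/
  nondegenerate : ∀ φ : LpSpace Ω p, F φ Ω < ⊤ →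
    ∀ A : Set (Space d), IsOpen A → A ⊆ Ω → F φ A = 0 →
    ∀ U : Set (Space d), IsOpen U → U.Nonempty → IsCompact (closure U) → closure U ⊆ A →
    ∀ ε : ℝ, 0 < ε →
      ∃ (φ' : LpSpace Ω p) (ν : PosMeasure Ω), F φ' Ω < ⊤ ∧ Represents F φ' ν ∧
        (∀ᵐ x ∂(volume.restrict (Ω \ U)), φ' x = φ x) ∧
        ‖φ' - φ‖ ≤ ε ∧
        ν.toMeasure (frontier U) = 0 ∧
        0 < ν.toMeasure A ∧ ν.toMeasure A = ν.toMeasure U ∧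
        ν.toMeasure U < ENNReal.ofReal ε
  /-- `F` is purely lower semicontinuous. -/
  purelyLsc : ∀ φ : LpSpace Ω p, F φ Ω < ⊤ →
    ∀ ν : PosMeasure Ω, Represents F φ ν →
    ∀ (f : Space d → ℝ) (hf : Integrable f ν.toMeasure), (∀ᵐ x ∂ν.toMeasure, 1 ≤ f x) →
      ∃ (φs : ℕ → LpSpace Ω p) (νs : ℕ → PosMeasure Ω),
        (∀ n, F (φs n) Ω < ⊤ ∧ Represents F (φs n) (νs n)) ∧
        Tendsto φs atTop (𝓝 φ) ∧
        Tendsto νs atTop (𝓝 (ν.mulDensity f hf))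

/-! ### The convex subadditive envelope -/

/-- The convex subadditive envelope `ψ^{cs}` of `ψ : [0, ∞) → ℝ`, at `t ≥ 0`. Only the values of
`ψ` on `[0, ∞)` matter. -/
def csEnvelope (ψ : ℝ → ℝ) (t : ℝ) : ℝ :=
  sSup {y : ℝ | ∃ g : ℝ → ℝ, ConvexOn ℝ (Ici 0) g ∧
    (∀ r, 0 ≤ r → ∀ s, 0 ≤ s → g (r + s) ≤ g r + g s) ∧
    (∀ s, 0 ≤ s → g s ≤ ψ s) ∧ y = g t}

/-- `Θ^{cs} = lim_{t → ∞} ψ^{cs}(t) / t`. -/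
def csSlope (ψ : ℝ → ℝ) : ℝ := limUnder atTop (fun t : ℝ => csEnvelope ψ t / t)

/-! ### The relative energy and the candidate for its envelope -/

open Classical in
/-- The relative energy: `∫_Ω ψ(u) |∇φ|^p dx` if `φ ∈ W^{1,p}(Ω)` and `μ = u |∇φ|^p dx`, and `+∞`
otherwise. -/
def relativeEnergy {d : ℕ} (Ω : Set (Space d)) (p : ℝ) (ψ : ℝ → ℝ)
    (x : LpSpace Ω p × PosMeasure Ω) : ℝ≥0∞ :=
  if MemSobolev p Ω x.1 ∧ x.2.toMeasure ≪ dirichletMeasure Ω p x.1 then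
    ∫⁻ y, ENNReal.ofReal (ψ ((x.2.toMeasure.rnDeriv (dirichletMeasure Ω p x.1) y).toReal))
      ∂(dirichletMeasure Ω p x.1)
  else ⊤

open Classical in
/-- `∫_Ω ψ^{cs}(u) |∇φ|^p dx + Θ^{cs} μ^⊥(Ω)` if `φ ∈ W^{1,p}(Ω)`, where `μ = u |∇φ|^p dx + μ^⊥` is
the Radon-Nikodym decomposition, and `+∞` otherwise. -/
def relaxedEnergy {d : ℕ} (Ω : Set (Space d)) (p : ℝ) (ψ : ℝ → ℝ)
    (x : LpSpace Ω p × PosMeasure Ω) : ℝ≥0∞ :=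
  if MemSobolev p Ω x.1 then
    (∫⁻ y, ENNReal.ofReal
        (csEnvelope ψ ((x.2.toMeasure.rnDeriv (dirichletMeasure Ω p x.1) y).toReal))
      ∂(dirichletMeasure Ω p x.1))
    + ENNReal.ofReal (csSlope ψ) *
        (x.2.toMeasure.singularPart (dirichletMeasure Ω p x.1)) Ω
  else ⊤

/-! ### Lower semicontinuous envelopes and sequential `Γ`-convergence -/

/-- `H` is the lower semicontinuous envelope of `G`: the greatest lower semicontinuous function
below `G`. -/
def IsLscEnvelope {Y : Type*} [TopologicalSpace Y] (G H : Y → ℝ≥0∞) : Prop :=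
  IsGreatest {K : Y → ℝ≥0∞ | LowerSemicontinuous K ∧ K ≤ G} H

/-- Sequential `Γ`-convergence of `G n` to `H`. -/
def GammaConverges {Y : Type*} [TopologicalSpace Y] (G : ℕ → Y → ℝ≥0∞) (H : Y → ℝ≥0∞) : Prop :=
  (∀ (x : Y) (xs : ℕ → Y), Tendsto xs atTop (𝓝 x) →
    H x ≤ liminf (fun n => G n (xs n)) atTop) ∧
  (∀ x : Y, ∃ xs : ℕ → Y, Tendsto xs atTop (𝓝 x) ∧
    limsup (fun n => G n (xs n)) atTop ≤ H x)

end

end DirichletRelaxation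

open MeasureTheory Filter Topology Set
open scoped ENNReal ContDiff ZeroAtInfty

namespace DirichletRelaxation

noncomputable section

/-! ### The convex subadditive envelope -/

/-! Everything rests on one description of the envelope: `csEnvelope ψ` is the supremum of the lines
`a + b t` below `ψ` on `[0, ∞)` with `a ≥ 0`. Convexity provides supporting lines at `t > 0`, and
subadditivity is what makes their intercepts non-negative. At `t = 0` the description needs lower
semicontinuity of `ψ` there. The limit slope `Θ` is the supremum of the slopes `b`, and `Θ t` is
itself such a line.

Lower bound. By monotone convergence the relaxed energy is approximated from below by finite sums `∑
(aᵢ ν(Bᵢ) + bᵢ μ(Bᵢ))` over disjoint Borel sets, where `ν = |∇φ|^p dx` and the line `Θ t` serves the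
singular part (`exists_partition_lt`). Replace `ν(Bᵢ)` by `ν(Aᵢ)` with `Aᵢ` open, and `μ(Bᵢ)` by `∫
ξᵢ dμ` with `ξᵢ` a cutoff equal to `1` on `Aᵢ` (`exists_separating_testFun`). The new sum still
bounds the relaxed energy from below at every pair with Sobolev first component
(`ofReal_sum_le_relaxedEnergy`). It is lower semicontinuous, because `aᵢ ≥ 0` multiplies the lower
semicontinuous energy on `Aᵢ` while `bᵢ`, of any sign, multiplies a weak* continuous quantity.

Upper bound. The energy on a cell can be raised to any larger value by a smooth perturbation that is
small in `L^p`, since a concentrated bump has a gradient much larger than itself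
(`exists_smooth_energy_eq`). Dually, `csEnvelope ψ t` is the least cost of mixtures `∑ λᵢ ψ(tᵢ)`
with `∑ λᵢ tᵢ = t` and `∑ λᵢ ≥ 1`, up to an arbitrarily small error; the freedom `∑ λᵢ > 1` is
exactly the freedom to add Dirichlet energy. On each cell of a fine partition one takes a nearly
optimal mixture, raises the energy to its total mass, and distributes the values `tᵢ` over subsets
of the right masses. Equal masses on finer and finer partitions force weak* convergence, so the
singular part needs no separate treatment.

Admissibility uses the same perturbations for (Ad3) and (Ad4). For (Ad1), uniform convexity of `L^p`
shows that the weak gradients of near minimisers converge strongly, and the graph of the weak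
gradient is closed. -/

/-- The affine minorants `s ↦ q.1 + q.2 * s` of `ψ` on `[0, ∞)` with non-negative value at `0`. -/
def affineMinorants (ψ : ℝ → ℝ) : Set (ℝ × ℝ) :=
  {q | 0 ≤ q.1 ∧ ∀ s, 0 ≤ s → q.1 + q.2 * s ≤ ψ s}

/-- The admissible functions in the definition of the convex subadditive envelope. -/
def IsConvexSubadditiveMinorant (ψ g : ℝ → ℝ) : Prop :=
  ConvexOn ℝ (Ici 0) g ∧ (∀ r, 0 ≤ r → ∀ s, 0 ≤ s → g (r + s) ≤ g r + g s) ∧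
    (∀ s, 0 ≤ s → g s ≤ ψ s)

theorem le_csEnvelope {ψ g : ℝ → ℝ} (hg : IsConvexSubadditiveMinorant ψ g) {t : ℝ} (ht : 0 ≤ t) :
    g t ≤ csEnvelope ψ t := by
  refine le_csSup ⟨ψ t, ?_⟩ ⟨g, hg.1, hg.2.1, hg.2.2, rfl⟩
  rintro y ⟨g, -, -, h, rfl⟩
  exact h t ht

theorem isConvexSubadditiveMinorant_affine {ψ : ℝ → ℝ} {q : ℝ × ℝ} (hq : q ∈ affineMinorants ψ) :
    IsConvexSubadditiveMinorant ψ (fun s => q.1 + q.2 * s) := by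
  refine ⟨⟨convex_Ici 0, ?_⟩, ?_, hq.2⟩
  · intro x _ y _ a b _ _ hab
    simp only [smul_eq_mul]
    have : q.1 = (a + b) * q.1 := by rw [hab, one_mul]
    nlinarith
  · intro r _ s _
    have := hq.1
    simp only
    nlinarith

theorem affine_le_csEnvelope {ψ : ℝ → ℝ} {q : ℝ × ℝ} (hq : q ∈ affineMinorants ψ) {t : ℝ}
    (ht : 0 ≤ t) : q.1 + q.2 * t ≤ csEnvelope ψ t :=
  le_csEnvelope (isConvexSubadditiveMinorant_affine hq) ht

theorem csEnvelope_le {ψ : ℝ → ℝ} (hψ : (affineMinorants ψ).Nonempty) {t y : ℝ}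
    (h : ∀ g, IsConvexSubadditiveMinorant ψ g → g t ≤ y) : csEnvelope ψ t ≤ y := by
  obtain ⟨q, hq⟩ := hψ
  obtain ⟨h1, h2, h3⟩ := isConvexSubadditiveMinorant_affine hq
  refine csSup_le ⟨_, _, h1, h2, h3, rfl⟩ ?_
  rintro y ⟨g, h1, h2, h3, rfl⟩
  exact h g ⟨h1, h2, h3⟩

/-- A convex subadditive function has at each `t > 0` a supporting line with non-negative value
at `0`. -/
theorem IsConvexSubadditiveMinorant.exists_support {ψ g : ℝ → ℝ}
    (hg : IsConvexSubadditiveMinorant ψ g) {t : ℝ} (ht : 0 < t) :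
    ∃ q ∈ affineMinorants ψ, q.1 + q.2 * t = g t := by
  obtain ⟨hc, hs, hle⟩ := hg
  have key : ∀ x, 0 ≤ x → x < t → ∀ z, t < z →
      (g t - g x) / (t - x) ≤ (g z - g t) / (z - t) := fun x hx hxt z hz =>
    hc.slope_mono_adjacent (mem_Ici.2 hx) (mem_Ici.2 (ht.le.trans hz.le)) hxt hz
  -- The supporting slope `b` is the left derivative at `t`, the supremum of the slopes of chords
  -- ending at `t`; every chord starting at `t` bounds it from above.
  set S : Set ℝ := (fun x => (g t - g x) / (t - x)) '' Ico 0 t with hS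
  have hne : S.Nonempty := ⟨_, 0, ⟨le_rfl, ht⟩, rfl⟩
  have hb : ∀ z, t < z → ∀ y ∈ S, y ≤ (g z - g t) / (z - t) := by
    rintro z hz y ⟨x, hx, rfl⟩
    exact key x hx.1 hx.2 z hz
  have hbdd : BddAbove S := ⟨_, hb (t + 1) (by linarith)⟩
  set b := sSup S
  have hright : ∀ z, t < z → g t + b * (z - t) ≤ g z := by
    intro z hz
    have h1 : b ≤ (g z - g t) / (z - t) := csSup_le hne (hb z hz)
    rw [le_div_iff₀ (by linarith)] at h1
    linarith
  have hleft : ∀ x, 0 ≤ x → x < t → g t + b * (x - t) ≤ g x := by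
    intro x hx hxt
    have h1 : (g t - g x) / (t - x) ≤ b := le_csSup hbdd ⟨x, ⟨hx, hxt⟩, rfl⟩
    rw [div_le_iff₀ (by linarith)] at h1
    linarith
  refine ⟨(g t - b * t, b), ⟨?_, ?_⟩, by simp⟩
  -- At `2t` the supporting line gives `g t + b t ≤ g (2t) ≤ 2 g t`, so the intercept `g t - b t` is
  -- non-negative.
  · have h1 := hright (t + t) (by linarith)
    have h2 := hs t ht.le t ht.le
    simp only
    linarith
  · intro s hs
    refine le_trans ?_ (hle s hs)
    simp only
    rcases lt_trichotomy s t with h | h | h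
    · linarith [hleft s hs h]
    · subst h; linarith
    · linarith [hright s h]

/-- The standing assumptions on `ψ`: a positive lower bound and lower semicontinuity at `0`. -/
structure IsRelaxable (ψ : ℝ → ℝ) : Prop where
  bound : ∃ c : ℝ, 0 < c ∧ ∀ t : ℝ, 0 ≤ t → c ≤ ψ t
  lsc : LowerSemicontinuousWithinAt ψ (Ici 0) 0

namespace IsRelaxable

theorem exists_const_mem {ψ : ℝ → ℝ} (hψ : IsRelaxable ψ)
    : ∃ c : ℝ, 0 < c ∧ (c, (0 : ℝ)) ∈ affineMinorants ψ := by
  obtain ⟨c, hc, h⟩ := hψ.bound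
  exact ⟨c, hc, hc.le, by simpa using h⟩

theorem nonempty_affineMinorants {ψ : ℝ → ℝ} (hψ : IsRelaxable ψ)
    : (affineMinorants ψ).Nonempty := by
  obtain ⟨c, -, h⟩ := hψ.exists_const_mem
  exact ⟨_, h⟩

/-- A convex function on `[0, ∞)` may jump at the endpoint and have no supporting line there, so `t
= 0` needs this separate argument. Lower semicontinuity keeps `ψ` above `z` on some `[0, δ)`; the
line from height `z` at `0` down to `0` at `δ` stays below `ψ` there, and it is non-positive
afterwards. -/
theorem exists_lt_affine_zero {ψ : ℝ → ℝ} (hψ : IsRelaxable ψ) {y : ℝ} (hy : y < ψ 0) :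
    ∃ q ∈ affineMinorants ψ, y ≤ q.1 := by
  obtain ⟨c, hc, h⟩ := hψ.bound
  set z := max y 0 with hz
  have hz0 : z < ψ 0 := max_lt hy (hc.trans_le (h 0 le_rfl))
  have h1 := hψ.lsc z hz0
  rw [eventually_nhdsWithin_iff, Metric.eventually_nhds_iff] at h1
  obtain ⟨δ, hδ, h1⟩ := h1
  refine ⟨(z, -(z / δ)), ⟨le_max_right _ _, ?_⟩, le_max_left _ _⟩
  intro s hs
  simp only
  have hzn : 0 ≤ z := le_max_right _ _
  rcases lt_or_ge s δ with hsδ | hsδ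
  · have h2 := h1 (y := s) (by simpa [abs_of_nonneg hs] using hsδ) hs
    have : 0 ≤ z / δ * s := by positivity
    linarith
  · have h2 := h s hs
    have : z ≤ z / δ * s := by
      rw [div_mul_eq_mul_div, le_div_iff₀ hδ]
      exact mul_le_mul_of_nonneg_left hsδ hzn
    linarith

/-- The envelope is the supremum of the affine minorants. -/
theorem exists_affine_gt {ψ : ℝ → ℝ} (hψ : IsRelaxable ψ)
    {t : ℝ} (ht : 0 ≤ t) {y : ℝ} (hy : y < csEnvelope ψ t) :
    ∃ q ∈ affineMinorants ψ, y < q.1 + q.2 * t := by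
  by_contra! hcon
  refine absurd hy (not_lt.2 (csEnvelope_le hψ.nonempty_affineMinorants fun g hg => ?_))
  rcases ht.eq_or_lt with rfl | ht
  · refine (hg.2.2 0 le_rfl).trans (le_of_forall_lt fun z hz => ?_)
    obtain ⟨w, hw1, hw2⟩ := exists_between hz
    obtain ⟨q, hq, hq2⟩ := hψ.exists_lt_affine_zero hw2
    have := hcon q hq
    linarith
  · obtain ⟨q, hq, h⟩ := hg.exists_support ht
    exact h ▸ hcon q hq

theorem isLUB_csEnvelope {ψ : ℝ → ℝ} (hψ : IsRelaxable ψ) {t : ℝ} (ht : 0 ≤ t) :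
    IsLUB ((fun q : ℝ × ℝ => q.1 + q.2 * t) '' affineMinorants ψ) (csEnvelope ψ t) := by
  constructor
  · rintro _ ⟨q, hq, rfl⟩
    exact affine_le_csEnvelope hq ht
  · intro y hy
    by_contra! h
    obtain ⟨q, hq, h2⟩ := hψ.exists_affine_gt ht h
    exact absurd (hy ⟨q, hq, rfl⟩) (not_le.2 h2)

theorem csEnvelope_pos {ψ : ℝ → ℝ} (hψ : IsRelaxable ψ)
    {t : ℝ} (ht : 0 ≤ t) : 0 < csEnvelope ψ t := by
  obtain ⟨c, hc, h⟩ := hψ.exists_const_mem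
  have := affine_le_csEnvelope h ht
  simp only [zero_mul, add_zero] at this
  linarith

theorem csEnvelope_le_self {ψ : ℝ → ℝ} (hψ : IsRelaxable ψ)
    {t : ℝ} (ht : 0 ≤ t) : csEnvelope ψ t ≤ ψ t :=
  csEnvelope_le hψ.nonempty_affineMinorants fun _ hg => hg.2.2 t ht

theorem bddAbove_slopes (ψ : ℝ → ℝ) : BddAbove (Prod.snd '' affineMinorants ψ) := by
  refine ⟨ψ 1, ?_⟩
  rintro _ ⟨q, hq, rfl⟩
  have h1 := hq.1
  have h2 := hq.2 1 zero_le_one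
  linarith

theorem exists_slope {ψ : ℝ → ℝ} (hψ : IsRelaxable ψ)
    : ∃ Θ : ℝ, IsLUB (Prod.snd '' affineMinorants ψ) Θ :=
  ⟨_, isLUB_csSup (hψ.nonempty_affineMinorants.image _) (bddAbove_slopes ψ)⟩

/-- Affine minorants have intercepts in `[0, ψ 0]` and slopes at most `Θ`, which squeezes the
quotient between `Θ` and `ψ 0 / t + Θ`. -/
theorem tendsto_csEnvelope_div_aux {ψ : ℝ → ℝ} (hψ : IsRelaxable ψ)
    {Θ : ℝ} (hΘ : IsLUB (Prod.snd '' affineMinorants ψ) Θ) :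
    Tendsto (fun t : ℝ => csEnvelope ψ t / t) atTop (𝓝 Θ) := by
  have h1 : Tendsto (fun t : ℝ => ψ 0 / t + Θ) atTop (𝓝 Θ) := by
    simpa using (tendsto_const_nhds.div_atTop tendsto_id).add_const Θ
  refine tendsto_of_tendsto_of_tendsto_of_le_of_le' tendsto_const_nhds h1 ?_ ?_
  · filter_upwards [eventually_gt_atTop 0] with t ht
    refine hΘ.2 ?_
    rintro _ ⟨q, hq, rfl⟩
    rw [le_div_iff₀ ht]
    have := affine_le_csEnvelope hq ht.le
    linarith [hq.1]
  · filter_upwards [eventually_gt_atTop 0] with t ht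
    rw [div_add' _ _ _ ht.ne']
    refine div_le_div_of_nonneg_right ((hψ.isLUB_csEnvelope ht.le).2 ?_) ht.le
    rintro _ ⟨q, hq, rfl⟩
    have h2 := hq.2 0 le_rfl
    have h3 : q.2 ≤ Θ := hΘ.1 ⟨q, hq, rfl⟩
    have := mul_le_mul_of_nonneg_right h3 ht.le
    simp only
    linarith

theorem isLUB_csSlope {ψ : ℝ → ℝ} (hψ : IsRelaxable ψ)
    : IsLUB (Prod.snd '' affineMinorants ψ) (csSlope ψ) := by
  obtain ⟨Θ, hΘ⟩ := hψ.exists_slope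
  have := (hψ.tendsto_csEnvelope_div_aux hΘ).limUnder_eq
  rw [csSlope, this]
  exact hΘ

theorem tendsto_csEnvelope_div {ψ : ℝ → ℝ} (hψ : IsRelaxable ψ) :
    Tendsto (fun t : ℝ => csEnvelope ψ t / t) atTop (𝓝 (csSlope ψ)) :=
  hψ.tendsto_csEnvelope_div_aux hψ.isLUB_csSlope

theorem slope_le {ψ : ℝ → ℝ} (hψ : IsRelaxable ψ)
    {q : ℝ × ℝ} (hq : q ∈ affineMinorants ψ) : q.2 ≤ csSlope ψ :=
  hψ.isLUB_csSlope.1 ⟨q, hq, rfl⟩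

theorem csSlope_nonneg {ψ : ℝ → ℝ} (hψ : IsRelaxable ψ) : 0 ≤ csSlope ψ := by
  obtain ⟨c, -, h⟩ := hψ.exists_const_mem
  exact hψ.slope_le h

theorem csSlope_mul_le {ψ : ℝ → ℝ} (hψ : IsRelaxable ψ)
    {t : ℝ} (ht : 0 ≤ t) : csSlope ψ * t ≤ csEnvelope ψ t := by
  rcases ht.eq_or_lt with rfl | ht
  · simpa using (hψ.csEnvelope_pos le_rfl).le
  · rw [← le_div_iff₀ ht]
    refine hψ.isLUB_csSlope.2 ?_
    rintro _ ⟨q, hq, rfl⟩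
    rw [le_div_iff₀ ht]
    have := affine_le_csEnvelope hq ht.le
    linarith [hq.1]

theorem zero_csSlope_mem {ψ : ℝ → ℝ} (hψ : IsRelaxable ψ)
    : ((0 : ℝ), csSlope ψ) ∈ affineMinorants ψ :=
  ⟨le_rfl, fun s hs => by
    have := hψ.csSlope_mul_le hs
    have := hψ.csEnvelope_le_self hs
    simp only; linarith⟩

/-- Countably many affine minorants suffice. -/
theorem exists_seq_affine {ψ : ℝ → ℝ} (hψ : IsRelaxable ψ) : ∃ q : ℕ → ℝ × ℝ, q 0 = (0, csSlope ψ) ∧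
    (∀ n, q n ∈ affineMinorants ψ) ∧
    ∀ t, 0 ≤ t → IsLUB (range fun n => (q n).1 + (q n).2 * t) (csEnvelope ψ t) := by
  have hI : ∀ q : ℝ × ℝ, Continuous fun t : Ici (0 : ℝ) => q.1 + q.2 * t := fun q => by fun_prop
  -- A supremum of lower semicontinuous functions on a second countable space is already the
  -- supremum of a countable subfamily. Countability gives the measurable approximation needed for
  -- monotone convergence.
  obtain ⟨F, hF, hFc, hFl⟩ := exists_countable_lowerSemicontinuous_isLUB
    (X := Ici (0 : ℝ)) (E := ℝ) (s := fun t => csEnvelope ψ t)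
    (𝓕 := (fun (q : ℝ × ℝ) (t : Ici (0 : ℝ)) => q.1 + q.2 * t) '' affineMinorants ψ)
    (by rintro _ ⟨q, -, rfl⟩; exact (hI q).lowerSemicontinuous)
    (by
      rw [isLUB_pi]
      intro t
      have := hψ.isLUB_csEnvelope t.2
      rwa [← image_comp])
  have hFne : F.Nonempty := by
    by_contra h
    rw [not_nonempty_iff_eq_empty] at h
    subst h
    have := hFl.2 (show (fun _ => (0 : ℝ)) ∈ upperBounds ∅ by simp) ⟨0, self_mem_Ici⟩
    exact absurd this (not_le.2 (hψ.csEnvelope_pos le_rfl))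
  obtain ⟨f, rfl⟩ := hFc.exists_eq_range hFne
  have hf : ∀ n, ∃ q ∈ affineMinorants ψ, (fun (t : Ici (0 : ℝ)) => q.1 + q.2 * t) = f n :=
    fun n => hF ⟨n, rfl⟩
  choose q hq hqf using hf
  -- Index `0` is reserved for the line `Θ t`; it will be the label used on the set carrying the
  -- singular part.
  refine ⟨fun n => Nat.casesOn n (0, csSlope ψ) q, rfl, ?_, ?_⟩
  · rintro (_ | n)
    · exact hψ.zero_csSlope_mem
    · exact hq n
  · intro t ht
    constructor
    · rintro _ ⟨_ | n, rfl⟩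
      · exact affine_le_csEnvelope hψ.zero_csSlope_mem ht
      · exact affine_le_csEnvelope (hq n) ht
    · intro y hy
      have h1 := (isLUB_pi.1 hFl ⟨t, ht⟩).2
      refine h1 ?_
      rintro _ ⟨_, ⟨n, rfl⟩, rfl⟩
      have := congrFun (hqf n) ⟨t, ht⟩
      simp only [Function.eval] at this ⊢
      rw [← this]
      exact hy ⟨n + 1, rfl⟩

end IsRelaxable

/-! ### Mixtures -/

/-- The cone of triples `(∑ λᵢ, ∑ λᵢ tᵢ, ∑ λᵢ ψ(tᵢ))` with `λᵢ, tᵢ ≥ 0`. -/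
def mixtures (ψ : ℝ → ℝ) : AddSubmonoid (ℝ × ℝ × ℝ) :=
  AddSubmonoid.closure {v | ∃ l t : ℝ, 0 ≤ l ∧ 0 ≤ t ∧ v = (l, l * t, l * ψ t)}

theorem mem_mixtures_single {ψ : ℝ → ℝ} {l t : ℝ} (hl : 0 ≤ l) (ht : 0 ≤ t) :
    (l, l * t, l * ψ t) ∈ mixtures ψ :=
  AddSubmonoid.subset_closure ⟨l, t, hl, ht, rfl⟩

theorem smul_mem_mixtures {ψ : ℝ → ℝ} {c : ℝ} (hc : 0 ≤ c) {v : ℝ × ℝ × ℝ}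
    (hv : v ∈ mixtures ψ) : c • v ∈ mixtures ψ := by
  induction hv using AddSubmonoid.closure_induction with
  | mem x hx =>
    obtain ⟨l, t, hl, ht, rfl⟩ := hx
    have := mem_mixtures_single (ψ := ψ) (mul_nonneg hc hl) ht
    simpa [mul_assoc] using this
  | zero => simp
  | add x y _ _ hx hy => simpa using add_mem hx hy

theorem mixtures_nonneg {ψ : ℝ → ℝ} (hψ : ∀ t, 0 ≤ t → 0 ≤ ψ t) {v : ℝ × ℝ × ℝ}
    (hv : v ∈ mixtures ψ) : 0 ≤ v.1 ∧ 0 ≤ v.2.1 ∧ 0 ≤ v.2.2 := by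
  induction hv using AddSubmonoid.closure_induction with
  | mem x hx =>
    obtain ⟨l, t, hl, ht, rfl⟩ := hx
    exact ⟨hl, mul_nonneg hl ht, mul_nonneg hl (hψ t ht)⟩
  | zero => simp
  | add x y _ _ hx hy =>
    exact ⟨add_nonneg hx.1 hy.1, add_nonneg hx.2.1 hy.2.1, add_nonneg hx.2.2 hy.2.2⟩

/-- The least cost of mixtures with mean `t` competes in the definition of the envelope, hence lies
below it. Mixtures form a convex cone, which gives convexity. Requiring total mass `≥ 1` instead of
`= 1` gives subadditivity, since the sum of two competitors is again a competitor. -/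
theorem isConvexSubadditiveMinorant_mixtures {ψ : ℝ → ℝ} (hψ : ∀ t, 0 ≤ t → 0 ≤ ψ t) :
    IsConvexSubadditiveMinorant ψ
      (fun t => sInf {e | ∃ L : ℝ, 1 ≤ L ∧ (L, t, e) ∈ mixtures ψ}) := by
  set S : ℝ → Set ℝ := fun t => {e | ∃ L : ℝ, 1 ≤ L ∧ (L, t, e) ∈ mixtures ψ} with hS
  have hne : ∀ t, 0 ≤ t → ψ t ∈ S t := fun t ht =>
    ⟨1, le_rfl, by simpa using mem_mixtures_single (ψ := ψ) zero_le_one ht⟩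
  have hb : ∀ t, BddBelow (S t) := fun t => ⟨0, by
    rintro e ⟨L, -, h⟩
    exact (mixtures_nonneg hψ h).2.2⟩
  have hlt : ∀ t, 0 ≤ t → ∀ ε : ℝ, 0 < ε → ∃ e ∈ S t, e < sInf (S t) + ε := fun t ht ε hε =>
    exists_lt_of_csInf_lt ⟨_, hne t ht⟩ (by linarith)
  refine ⟨⟨convex_Ici 0, ?_⟩, ?_, fun s hs => csInf_le (hb s) (hne s hs)⟩
  · intro x hx y hy a b ha hb' hab
    refine le_of_forall_pos_le_add fun ε hε => ?_
    obtain ⟨e, ⟨L, hL, h1⟩, he⟩ := hlt x hx ε hε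
    obtain ⟨e', ⟨L', hL', h1'⟩, he'⟩ := hlt y hy ε hε
    have hmem := add_mem (smul_mem_mixtures ha h1) (smul_mem_mixtures hb' h1')
    have h3 : a • e + b • e' ∈ S (a • x + b • y) := by
      refine ⟨a * L + b * L', ?_, by simpa using hmem⟩
      nlinarith
    refine (csInf_le (hb _) h3).trans ?_
    simp only [smul_eq_mul] at *
    have i1 := mul_le_mul_of_nonneg_left he.le ha
    have i2 := mul_le_mul_of_nonneg_left he'.le hb'
    have : ε = (a + b) * ε := by rw [hab, one_mul]
    nlinarith
  · intro r hr s hs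
    refine le_of_forall_pos_le_add fun ε hε => ?_
    obtain ⟨e, ⟨L, hL, h1⟩, he⟩ := hlt r hr (ε / 2) (by linarith)
    obtain ⟨e', ⟨L', hL', h1'⟩, he'⟩ := hlt s hs (ε / 2) (by linarith)
    have h3 : e + e' ∈ S (r + s) := ⟨L + L', by linarith, by simpa using add_mem h1 h1'⟩
    refine (csInf_le (hb _) h3).trans ?_
    linarith

/-- Mixtures of mass at least `s` and mean `m` nearly attain the perspective `s ψ^{cs}(m / s)`;
this is compared with a functional `C` that dominates the affine minorants at `(F, m)`. -/
theorem IsRelaxable.exists_mixture {ψ : ℝ → ℝ} (hψ : IsRelaxable ψ) {F m C η : ℝ} (hF : 0 ≤ F)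
    (hm : 0 ≤ m) (hη : 0 < η) (hC : ∀ q ∈ affineMinorants ψ, q.1 * F + q.2 * m ≤ C) :
    ∃ L e : ℝ, F < L ∧ e ≤ C + η ∧ (L, m, e) ∈ mixtures ψ := by
  obtain ⟨c, hc, hcψ⟩ := hψ.bound
  have h0 : ∀ t, 0 ≤ t → 0 ≤ ψ t := fun t ht => hc.le.trans (hcψ t ht)
  have hψ0 : 0 < ψ 0 := hc.trans_le (hcψ 0 le_rfl)
  -- `κ` keeps `s = F + κ` positive even when `F = 0` and makes the final mass exceed `F` strictly.
  -- Intercepts are at most `ψ 0`, so this costs at most `η / 2`; `δ` below, used twice after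
  -- scaling by `s`, costs the other half.
  set κ := η / (2 * ψ 0) with hκ
  have hκ0 : 0 < κ := by positivity
  set s := F + κ with hs
  have hs0 : 0 < s := by positivity
  have ht : 0 ≤ m / s := by positivity
  set δ := η / (4 * s) with hδ
  have hδ0 : 0 < δ := by positivity
  have hle := le_csEnvelope (isConvexSubadditiveMinorant_mixtures h0) ht
  obtain ⟨e, ⟨L, hL, hmem⟩, he⟩ := exists_lt_of_csInf_lt (b := csEnvelope ψ (m / s) + δ)
    (s := {e | ∃ L : ℝ, 1 ≤ L ∧ (L, m / s, e) ∈ mixtures ψ})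
    ⟨ψ (m / s), 1, le_rfl, by simpa using mem_mixtures_single (ψ := ψ) zero_le_one ht⟩
    (by linarith)
  obtain ⟨q, hq, hq2⟩ := hψ.exists_affine_gt ht (y := csEnvelope ψ (m / s) - δ) (by linarith)
  refine ⟨s * L, s * e, by nlinarith, ?_, ?_⟩
  · have h1 : s * e ≤ s * (q.1 + q.2 * (m / s) + 2 * δ) :=
      mul_le_mul_of_nonneg_left (by linarith) hs0.le
    have h2 : s * (q.1 + q.2 * (m / s) + 2 * δ) = q.1 * F + q.2 * m + q.1 * κ + η / 2 := by
      rw [hδ]; field_simp; rw [hs]; ring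
    have h3 := hC q hq
    have h4 := hq.2 0 le_rfl
    have h5 : q.1 * κ ≤ η / 2 := by
      calc q.1 * κ ≤ ψ 0 * κ := mul_le_mul_of_nonneg_right (by linarith) hκ0.le
        _ = η / 2 := by rw [hκ]; field_simp
    linarith
  · have := smul_mem_mixtures hs0.le hmem
    simpa [mul_div_cancel₀ _ hs0.ne'] using this

/-! ### Weak gradients -/

section WeakGradient

variable {d : ℕ} {A B Ω : Set (Space d)} {p : ℝ}

theorem IsWeakGradient.mono {φ : Space d → ℝ} {V : Space d → Space d} (h : IsWeakGradient B φ V)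
    (hAB : A ⊆ B) : IsWeakGradient A φ V := by
  intro η hη hc hs w
  have h0 : ∀ x, x ∉ tsupport η → η x = 0 := fun x hx => image_eq_zero_of_notMem_tsupport hx
  have h1 : ∀ x, x ∉ tsupport η → fderiv ℝ η x w = 0 := fun x hx => by
    rw [image_eq_zero_of_notMem_tsupport (fun h => hx (tsupport_fderiv_subset ℝ h))]
    rfl
  have := h η hη hc (hs.trans hAB) w
  have e1 : ∀ C, tsupport η ⊆ C →
      ∫ x in C, φ x * fderiv ℝ η x w = ∫ x, φ x * fderiv ℝ η x w := fun C hC =>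
    setIntegral_eq_integral_of_forall_compl_eq_zero fun x hx => by
      rw [h1 x (fun h => hx (hC h)), mul_zero]
  have e2 : ∀ C, tsupport η ⊆ C →
      ∫ x in C, η x * inner ℝ (V x) w = ∫ x, η x * inner ℝ (V x) w := fun C hC =>
    setIntegral_eq_integral_of_forall_compl_eq_zero fun x hx => by
      rw [h0 x (fun h => hx (hC h)), zero_mul]
  rw [e1 _ hs, e2 _ hs]
  rwa [e1 _ (hs.trans hAB), e2 _ (hs.trans hAB)] at this

theorem IsWeakGradient.congr_left {φ φ' : Space d → ℝ} {V : Space d → Space d}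
    (h : IsWeakGradient A φ V) (hφ : φ =ᵐ[volume.restrict A] φ') : IsWeakGradient A φ' V := by
  intro η hη hc hs w
  rw [← h η hη hc hs w]
  exact integral_congr_ae (hφ.mono fun x hx => by simp only [hx])

theorem IsWeakGradient.congr_right {φ : Space d → ℝ} {V V' : Space d → Space d}
    (h : IsWeakGradient A φ V) (hV : V =ᵐ[volume.restrict A] V') : IsWeakGradient A φ V' := by
  intro η hη hc hs w
  rw [h η hη hc hs w]
  congr 1
  exact integral_congr_ae (hV.mono fun x hx => by simp only [hx])

theorem integrable_mul_inner {η : Space d → ℝ} (hη : Continuous η) (hc : HasCompactSupport η)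
    {V : Space d → Space d} (hV : Integrable V (volume.restrict A)) (w : Space d) :
    Integrable (fun x => η x * inner ℝ (V x) w) (volume.restrict A) := by
  obtain ⟨C, hC⟩ := hη.bounded_above_of_compact_support hc
  exact (hV.inner_const w).bdd_mul (c := C) hη.aestronglyMeasurable (ae_of_all _ hC)

theorem integrable_mul_fderiv {η : Space d → ℝ} (hη : ContDiff ℝ ∞ η) (hc : HasCompactSupport η)
    {φ : Space d → ℝ} (hφ : Integrable φ (volume.restrict A)) (w : Space d) :
    Integrable (fun x => φ x * fderiv ℝ η x w) (volume.restrict A) := by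
  have hcont : Continuous fun x => fderiv ℝ η x w :=
    (hη.continuous_fderiv (by simp)).clm_apply continuous_const
  obtain ⟨C, hC⟩ := hcont.bounded_above_of_compact_support (hc.fderiv_apply (𝕜 := ℝ) w)
  exact hφ.mul_bdd (c := C) hcont.aestronglyMeasurable (ae_of_all _ hC)

/-- The fundamental lemma of the calculus of variations for `V - V'`, read off coordinate by
coordinate through the inner product with a fixed vector. -/
theorem IsWeakGradient.ae_eq (hA : IsOpen A) {φ : Space d → ℝ} {V V' : Space d → Space d}
    (hV : Integrable V (volume.restrict A)) (hV' : Integrable V' (volume.restrict A))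
    (h : IsWeakGradient A φ V) (h' : IsWeakGradient A φ V') :
    V =ᵐ[volume.restrict A] V' := by
  have key : ∀ᵐ x ∂(volume : Measure (Space d)), x ∈ A → (V - V') x = 0 := by
    refine IsOpen.ae_eq_zero_of_integral_contDiff_smul_eq_zero hA
      (f := V - V') (IntegrableOn.locallyIntegrableOn (hV.sub hV')) ?_
    · intro g hg hc hs
      have e : ∫ x, g x • (V - V') x = ∫ x in A, g x • (V - V') x :=
        (setIntegral_eq_integral_of_forall_compl_eq_zero fun x hx => by
          rw [image_eq_zero_of_notMem_tsupport (fun h => hx (hs h)), zero_smul]).symm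
      rw [e]
      refine ext_inner_left ℝ fun w => ?_
      obtain ⟨C, hC⟩ := hg.continuous.bounded_above_of_compact_support hc
      have hint : Integrable (fun x => g x • (V - V') x) (volume.restrict A) :=
        (hV.sub hV').bdd_smul C hg.continuous.aestronglyMeasurable (ae_of_all _ hC)
      rw [← integral_inner hint, inner_zero_right]
      have h1 := integrable_mul_inner hg.continuous hc hV w
      have h2 := integrable_mul_inner hg.continuous hc hV' w
      have h3 : ∀ x, inner ℝ w (g x • (V - V') x) =
          g x * inner ℝ (V x) w - g x * inner ℝ (V' x) w := fun x => by
        rw [real_inner_comm, inner_smul_left, Pi.sub_apply, inner_sub_left]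
        simp [mul_sub]
      simp_rw [h3]
      rw [integral_sub h1 h2]
      have := h g hg hc hs w
      have := h' g hg hc hs w
      linarith
  rw [Filter.EventuallyEq, ae_restrict_iff' hA.measurableSet]
  filter_upwards [key] with x hx hxA
  exact sub_eq_zero.1 (hx hxA)

theorem continuous_gradient {w : Space d → ℝ} (hw : ContDiff ℝ ∞ w) :
    Continuous (gradient w) :=
  (InnerProductSpace.toDual ℝ (Space d)).symm.continuous.comp (hw.continuous_fderiv (by simp))

theorem tsupport_gradient_subset (w : Space d → ℝ) : tsupport (gradient w) ⊆ tsupport w := by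
  refine closure_minimal (fun x hx => ?_) (isClosed_tsupport w)
  by_contra h
  refine hx ?_
  have : fderiv ℝ w x = 0 :=
    image_eq_zero_of_notMem_tsupport fun h2 => h (tsupport_fderiv_subset ℝ h2)
  simp [gradient, this]

theorem gradient_eq_zero_of_notMem {w : Space d → ℝ} {x : Space d} (hx : x ∉ tsupport w) :
    gradient w x = 0 :=
  image_eq_zero_of_notMem_tsupport fun h => hx (tsupport_gradient_subset w h)

theorem hasCompactSupport_gradient {w : Space d → ℝ} (hw : HasCompactSupport w) :
    HasCompactSupport (gradient w) :=
  hw.of_isClosed_subset (isClosed_tsupport _) (tsupport_gradient_subset w)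

theorem memLp_smooth {w : Space d → ℝ} (hw : ContDiff ℝ ∞ w) (hc : HasCompactSupport w)
    (q : ℝ≥0∞) (μ : Measure (Space d)) [IsFiniteMeasureOnCompacts μ] : MemLp w q μ :=
  hw.continuous.memLp_of_hasCompactSupport hc

theorem memLp_gradient {w : Space d → ℝ} (hw : ContDiff ℝ ∞ w) (hc : HasCompactSupport w)
    (q : ℝ≥0∞) (μ : Measure (Space d)) [IsFiniteMeasureOnCompacts μ] : MemLp (gradient w) q μ :=
  (continuous_gradient hw).memLp_of_hasCompactSupport (hasCompactSupport_gradient hc)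

theorem IsWeakGradient.of_smooth {w : Space d → ℝ} (hw : ContDiff ℝ ∞ w)
    (hwc : HasCompactSupport w) : IsWeakGradient A w (gradient w) := by
  have h : IsWeakGradient univ w (gradient w) := by
    intro η hη hc _ v
    simp only [Measure.restrict_univ]
    have hwd : Differentiable ℝ w := hw.differentiable (by simp)
    have hηd : Differentiable ℝ η := hη.differentiable (by simp)
    have hwi : Integrable w := hw.continuous.integrable_of_hasCompactSupport hwc
    have hηi : Integrable η := hη.continuous.integrable_of_hasCompactSupport hc
    have i1 := integrable_mul_fderiv (A := univ) hη hc (by simpa using hwi) v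
    have i2 := integrable_mul_fderiv (A := univ) hw hwc (by simpa using hηi) v
    have i3 : Integrable fun x => w x * η x :=
      (hw.continuous.mul hη.continuous).integrable_of_hasCompactSupport hwc.mul_right
    simp only [Measure.restrict_univ] at i1 i2
    rw [integral_mul_fderiv_eq_neg_fderiv_mul_of_integrable
      (i2.congr (ae_of_all _ fun x => mul_comm _ _)) i1 i3
      (fun x _ => hwd x) (fun x _ => hηd x)]
    congr 1
    refine integral_congr_ae (ae_of_all _ fun x => ?_)
    simp only
    rw [inner_gradient_left, mul_comm]
  exact h.mono (subset_univ _)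

theorem IsWeakGradient.add {φ φ' : Space d → ℝ} {V V' : Space d → Space d}
    (hφ : Integrable φ (volume.restrict A)) (hφ' : Integrable φ' (volume.restrict A))
    (hV : Integrable V (volume.restrict A)) (hV' : Integrable V' (volume.restrict A))
    (h : IsWeakGradient A φ V) (h' : IsWeakGradient A φ' V') :
    IsWeakGradient A (φ + φ') (V + V') := by
  intro η hη hc hs w
  simp only [Pi.add_apply, add_mul, inner_add_left, mul_add]
  rw [integral_add (integrable_mul_fderiv hη hc hφ w) (integrable_mul_fderiv hη hc hφ' w),
    integral_add (integrable_mul_inner hη.continuous hc hV w)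
      (integrable_mul_inner hη.continuous hc hV' w), h η hη hc hs w, h' η hη hc hs w]
  ring

theorem IsWeakGradient.const_smul {φ : Space d → ℝ} {V : Space d → Space d} (c : ℝ)
    (h : IsWeakGradient A φ V) : IsWeakGradient A (c • φ) (c • V) := by
  intro η hη hc hs w
  simp only [Pi.smul_apply, smul_eq_mul, mul_assoc, inner_smul_left, mul_left_comm (η _)]
  rw [integral_const_mul, integral_const_mul, h η hη hc hs w]
  simp

end WeakGradient

/-! ### The energy and its measure computed from any weak gradient -/

section Energy

variable {d : ℕ} {A Ω : Set (Space d)} {p : ℝ}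

theorem isFiniteMeasure_restrict_of_isBounded (hΩ : Bornology.IsBounded Ω) :
    IsFiniteMeasure (volume.restrict Ω) :=
  ⟨by simpa using hΩ.measure_lt_top⟩

theorem lintegral_enorm_rpow_eq [hp : Fact (1 < p)] {E : Type*} [NormedAddCommGroup E]
    (V : Space d → E) (μ : Measure (Space d)) :
    ∫⁻ x, ‖V x‖ₑ ^ p ∂μ = eLpNorm V (ENNReal.ofReal p) μ ^ p := by
  have h0 : 0 < p := zero_lt_one.trans hp.out
  rw [eLpNorm_eq_lintegral_rpow_enorm_toReal (by simpa using h0) (by simp),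
    ENNReal.toReal_ofReal h0.le, ← ENNReal.rpow_mul, one_div, inv_mul_cancel₀ h0.ne',
    ENNReal.rpow_one]

theorem lintegral_enorm_rpow_lt_top [hp : Fact (1 < p)] {E : Type*} [NormedAddCommGroup E]
    {V : Space d → E} {μ : Measure (Space d)} (hV : MemLp V (ENNReal.ofReal p) μ) :
    ∫⁻ x, ‖V x‖ₑ ^ p ∂μ < ⊤ := by
  rw [lintegral_enorm_rpow_eq]
  exact ENNReal.rpow_lt_top_of_nonneg (zero_lt_one.trans hp.out).le hV.2.ne

theorem weakGradient_spec {φ : Space d → ℝ} (h : MemSobolev p A φ) :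
    MemLp (weakGradient p A φ) (ENNReal.ofReal p) (volume.restrict A) ∧
      IsWeakGradient A φ (weakGradient p A φ) := by
  rw [weakGradient, dif_pos h]
  exact h.choose_spec

theorem weakGradient_ae_eq [hp : Fact (1 < p)] (hA : IsOpen A) (hAb : Bornology.IsBounded A)
    {φ : Space d → ℝ} {V : Space d → Space d}
    (hV : MemLp V (ENNReal.ofReal p) (volume.restrict A)) (h : IsWeakGradient A φ V) :
    weakGradient p A φ =ᵐ[volume.restrict A] V := by
  have := isFiniteMeasure_restrict_of_isBounded hAb
  have h1 := weakGradient_spec (p := p) ⟨V, hV, h⟩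
  exact IsWeakGradient.ae_eq hA (h1.1.integrable Fact.out) (hV.integrable Fact.out) h1.2 h

theorem dirichletEnergy_eq [hp : Fact (1 < p)] (hA : IsOpen A) (hAb : Bornology.IsBounded A)
    {φ : LpSpace Ω p} {V : Space d → Space d}
    (hV : MemLp V (ENNReal.ofReal p) (volume.restrict A)) (h : IsWeakGradient A φ V) :
    dirichletEnergy Ω p φ A = ∫⁻ x in A, ‖V x‖ₑ ^ p := by
  rw [dirichletEnergy, if_pos ⟨V, hV, h⟩]
  exact lintegral_congr_ae ((weakGradient_ae_eq hA hAb hV h).mono fun x hx => by simp only [hx])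

theorem dirichletMeasure_eq [hp : Fact (1 < p)] (hΩ : IsOpen Ω) (hΩb : Bornology.IsBounded Ω)
    {φ : LpSpace Ω p} {V : Space d → Space d}
    (hV : MemLp V (ENNReal.ofReal p) (volume.restrict Ω)) (h : IsWeakGradient Ω φ V) :
    dirichletMeasure Ω p φ = (volume.restrict Ω).withDensity (fun x => ‖V x‖ₑ ^ p) :=
  withDensity_congr_ae ((weakGradient_ae_eq hΩ hΩb hV h).mono fun x hx => by simp only [hx])

theorem dirichletEnergy_lt_top_iff [hp : Fact (1 < p)] {φ : LpSpace Ω p} :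
    dirichletEnergy Ω p φ A < ⊤ ↔ MemSobolev p A φ := by
  rw [dirichletEnergy]
  split_ifs with h
  · simp only [h, iff_true]
    exact lintegral_enorm_rpow_lt_top (weakGradient_spec h).1
  · simp [h]

instance isFiniteMeasure_dirichletMeasure [hp : Fact (1 < p)] (φ : LpSpace Ω p) :
    IsFiniteMeasure (dirichletMeasure Ω p φ) := by
  refine isFiniteMeasure_withDensity (ne_of_lt ?_)
  by_cases h : MemSobolev p Ω φ
  · exact lintegral_enorm_rpow_lt_top (weakGradient_spec h).1
  -- Outside `W^{1,p}` the default gradient is `0`, and `0 ^ p = 0` because `p > 0`, so the measure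
  -- vanishes.
  · have h0 : 0 < p := zero_lt_one.trans hp.out
    simp [weakGradient, h, h0]

theorem dirichletMeasure_absolutelyContinuous (φ : LpSpace Ω p) :
    dirichletMeasure Ω p φ ≪ volume.restrict Ω :=
  withDensity_absolutelyContinuous _ _

/-- The Dirichlet measure as a finite Radon measure on `Ω`. -/
def dirichletPosMeasure [hp : Fact (1 < p)] (hΩ : IsOpen Ω) (φ : LpSpace Ω p) :
    PosMeasure Ω where
  toMeasure := dirichletMeasure Ω p φ
  isFinite := inferInstance
  compl_null := dirichletMeasure_absolutelyContinuous φ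
    (by rw [Measure.restrict_apply hΩ.measurableSet.compl]; simp)

theorem dirichletEnergy_eq_dirichletMeasure [hp : Fact (1 < p)] (hΩb : Bornology.IsBounded Ω)
    {φ : LpSpace Ω p} (h : MemSobolev p Ω φ) (hA : IsOpen A) (hAΩ : A ⊆ Ω) :
    dirichletEnergy Ω p φ A = dirichletMeasure Ω p φ A := by
  obtain ⟨h1, h2⟩ := weakGradient_spec h
  rw [dirichletEnergy_eq hA (hΩb.subset hAΩ) (h1.mono_measure (Measure.restrict_mono hAΩ le_rfl))
    (h2.mono hAΩ), dirichletMeasure, withDensity_apply _ hA.measurableSet,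
    Measure.restrict_restrict hA.measurableSet, inter_eq_self_of_subset_left hAΩ]

theorem represents_dirichletPosMeasure [hp : Fact (1 < p)] (hΩ : IsOpen Ω)
    (hΩb : Bornology.IsBounded Ω) {φ : LpSpace Ω p} (h : MemSobolev p Ω φ) :
    Represents (dirichletEnergy Ω p) φ (dirichletPosMeasure hΩ φ) :=
  fun _ hA hAΩ => dirichletEnergy_eq_dirichletMeasure hΩb h hA hAΩ

theorem PosMeasure.ext' {μ ν : PosMeasure Ω} (h : μ.toMeasure = ν.toMeasure) : μ = ν := by
  cases μ; cases ν; congr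

/-- Open sets form a π-system generating the Borel sets, and both measures are carried by `Ω`. This
reduces the arbitrary representing measure in (Ad4) to `dirichletPosMeasure`. -/
theorem Represents.unique (hΩ : IsOpen Ω) {F : LpSpace Ω p → Set (Space d) → ℝ≥0∞}
    {φ : LpSpace Ω p} {μ ν : PosMeasure Ω} (hμ : Represents F φ μ) (hν : Represents F φ ν) :
    μ = ν := by
  have := μ.isFinite
  have key : ∀ (μ : PosMeasure Ω) (s : Set (Space d)),
      μ.toMeasure s = μ.toMeasure (s ∩ Ω) := fun μ s => by
    exact (measure_inter_conull μ.compl_null).symm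
  have h1 : ∀ s, IsOpen s → μ.toMeasure s = ν.toMeasure s := fun s hs => by
    rw [key μ, key ν, ← hμ _ (hs.inter hΩ) inter_subset_right,
      hν _ (hs.inter hΩ) inter_subset_right]
  refine PosMeasure.ext' (ext_of_generate_finite {s | IsOpen s} ?_ isPiSystem_isOpen h1
    (h1 _ isOpen_univ))
  exact BorelSpace.measurable_eq

/-- The perturbation of `φ` by a smooth function. -/
theorem exists_add_smooth [hp : Fact (1 < p)] (hΩ : IsOpen Ω) (hΩb : Bornology.IsBounded Ω)
    (φ : LpSpace Ω p) (h : MemSobolev p Ω φ) {w : Space d → ℝ} (hw : ContDiff ℝ ∞ w)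
    (hwc : HasCompactSupport w) :
    ∃ φ' : LpSpace Ω p, (φ' =ᵐ[volume.restrict Ω] ⇑φ + w) ∧ MemSobolev p Ω φ' ∧
      ‖φ' - φ‖ = (eLpNorm w (ENNReal.ofReal p) (volume.restrict Ω)).toReal ∧
      dirichletMeasure Ω p φ' =
        (volume.restrict Ω).withDensity (fun x => ‖weakGradient p Ω φ x + gradient w x‖ₑ ^ p) := by
  have := isFiniteMeasure_restrict_of_isBounded hΩb
  obtain ⟨h1, h2⟩ := weakGradient_spec h
  have hwp := memLp_smooth hw hwc (ENNReal.ofReal p) (volume.restrict Ω)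
  have hgp := memLp_gradient hw hwc (ENNReal.ofReal p) (volume.restrict Ω)
  have hae : ⇑(φ + hwp.toLp w) =ᵐ[volume.restrict Ω] ⇑φ + w := by
    filter_upwards [Lp.coeFn_add φ (hwp.toLp w), hwp.coeFn_toLp] with x h1 h2
    rw [h1, Pi.add_apply, Pi.add_apply, h2]
  have hgrad : IsWeakGradient Ω ⇑(φ + hwp.toLp w) (weakGradient p Ω φ + gradient w) :=
    (IsWeakGradient.add ((Lp.memLp φ).integrable Fact.out) (hwp.integrable Fact.out)
      (h1.integrable Fact.out) (hgp.integrable Fact.out) h2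
      (IsWeakGradient.of_smooth hw hwc)).congr_left hae.symm
  refine ⟨φ + hwp.toLp w, hae, ⟨_, h1.add hgp, hgrad⟩, ?_, ?_⟩
  · rw [add_sub_cancel_left, Lp.norm_toLp]
  · exact dirichletMeasure_eq hΩ hΩb (h1.add hgp) hgrad

end Energy

/-! ### Lower semicontinuity of the Dirichlet energy -/

section UniformConvexity

variable {E : Type*} [NormedAddCommGroup E] [InnerProductSpace ℝ E]

/-- If the norms agree, strictness comes from the strict convexity of the Euclidean norm; if they
differ, from that of `t ^ p`. -/
theorem norm_midpoint_rpow_lt {p : ℝ} (hp : 1 < p) {a b : E} (hab : a ≠ b) :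
    ‖(2⁻¹ : ℝ) • (a + b)‖ ^ p < 2⁻¹ * (‖a‖ ^ p + ‖b‖ ^ p) := by
  have h0 : 0 < p := zero_lt_one.trans hp
  have hn : ‖(2⁻¹ : ℝ) • (a + b)‖ ≤ 2⁻¹ * ‖a‖ + 2⁻¹ * ‖b‖ := by
    rw [norm_smul, ← mul_add]
    simpa using norm_add_le a b
  rcases eq_or_ne ‖a‖ ‖b‖ with h | h
  · have h1 : ‖(2⁻¹ : ℝ) • (a + b)‖ < ‖a‖ := by
      have := norm_combo_lt_of_ne (x := a) (y := b) (r := ‖a‖) le_rfl h.ge hab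
        (show (0 : ℝ) < 2⁻¹ by norm_num) (show (0 : ℝ) < 2⁻¹ by norm_num) (by norm_num)
      rwa [smul_add]
    rw [← h]
    have := Real.rpow_lt_rpow (norm_nonneg _) h1 h0
    linarith
  · have h1 := (strictConvexOn_rpow hp).2 (norm_nonneg a) (norm_nonneg b) h
      (show (0 : ℝ) < 2⁻¹ by norm_num) (show (0 : ℝ) < 2⁻¹ by norm_num) (by norm_num)
    simp only [smul_eq_mul] at h1
    have := Real.rpow_le_rpow (norm_nonneg _) hn h0.le
    linarith

/-- A quantitative form of the strict convexity of `‖·‖ ^ p`, by compactness. -/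
theorem exists_norm_sub_rpow_le [FiniteDimensional ℝ E] {p : ℝ} (hp : 1 < p) {ε : ℝ}
    (hε : 0 < ε) :
    ∃ C : ℝ, 0 ≤ C ∧ ∀ a b : E, ‖a - b‖ ^ p + C * ‖(2⁻¹ : ℝ) • (a + b)‖ ^ p ≤
      (ε + C / 2) * (‖a‖ ^ p + ‖b‖ ^ p) := by
  have h0 : 0 < p := zero_lt_one.trans hp
  -- On the compact set `K` of normalised pairs at distance bounded below, the midpoint gap has a
  -- positive minimum `c`; homogeneity carries this to all pairs.
  have hcn : ∀ f : E × E → E, Continuous f → Continuous fun x => ‖f x‖ ^ p := fun f hf =>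
    hf.norm.rpow_const fun _ => Or.inr h0.le
  set K : Set (E × E) := {x | ‖x.1‖ ^ p + ‖x.2‖ ^ p = 1 ∧ ε ≤ ‖x.1 - x.2‖ ^ p} with hK
  have hKc : IsCompact K := by
    have hcl : IsClosed K := by
      refine (isClosed_eq ((hcn _ continuous_fst).add (hcn _ continuous_snd))
        continuous_const).inter (isClosed_le continuous_const
          (hcn _ (continuous_fst.sub continuous_snd)))
    refine (isCompact_closedBall (0 : E × E) 1).of_isClosed_subset hcl ?_
    rintro ⟨a, b⟩ ⟨h1, -⟩
    have ha := Real.rpow_nonneg (norm_nonneg a) p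
    have hb := Real.rpow_nonneg (norm_nonneg b) p
    simp only at h1
    have h2 : ∀ t : ℝ, 0 ≤ t → t ^ p ≤ 1 → t ≤ 1 := fun t ht h => by
      by_contra! hlt
      exact absurd (Real.one_lt_rpow hlt h0) (not_lt.2 h)
    rw [mem_closedBall_zero_iff, Prod.norm_def]
    exact max_le (h2 _ (norm_nonneg _) (by linarith)) (h2 _ (norm_nonneg _) (by linarith))
  have hcont : Continuous fun x : E × E =>
      (2⁻¹ * (‖x.1‖ ^ p + ‖x.2‖ ^ p) - ‖(2⁻¹ : ℝ) • (x.1 + x.2)‖ ^ p) :=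
    (continuous_const.mul ((hcn _ continuous_fst).add (hcn _ continuous_snd))).sub
      (hcn _ ((continuous_fst.add continuous_snd).const_smul _))
  obtain ⟨c, hc, hcK⟩ : ∃ c : ℝ, 0 < c ∧ ∀ x ∈ K,
      c ≤ 2⁻¹ * (‖x.1‖ ^ p + ‖x.2‖ ^ p) - ‖(2⁻¹ : ℝ) • (x.1 + x.2)‖ ^ p := by
    rcases K.eq_empty_or_nonempty with h | h
    · exact ⟨1, one_pos, by simp [h]⟩
    · obtain ⟨x, hx, hmin⟩ := hKc.exists_isMinOn h hcont.continuousOn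
      refine ⟨_, sub_pos.2 (norm_midpoint_rpow_lt hp fun heq => ?_), fun y hy => hmin hy⟩
      have := hx.2
      rw [heq, sub_self, norm_zero, Real.zero_rpow h0.ne'] at this
      linarith
  -- When `‖a - b‖ ^ p ≥ ε S`, the gap is at least `c S`, so this `C` makes `C` times the gap
  -- dominate `2 ^ p S ≥ ‖a - b‖ ^ p`. Otherwise the term `ε S` suffices.
  refine ⟨2 ^ p / c, by positivity, fun a b => ?_⟩
  set S := ‖a‖ ^ p + ‖b‖ ^ p with hS
  have ha := Real.rpow_nonneg (norm_nonneg a) p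
  have hb := Real.rpow_nonneg (norm_nonneg b) p
  have hS0 : 0 ≤ S := add_nonneg ha hb
  have hgap : 0 ≤ 2⁻¹ * S - ‖(2⁻¹ : ℝ) • (a + b)‖ ^ p := by
    rcases eq_or_ne a b with rfl | hab
    · rw [hS, ← two_smul ℝ a, smul_smul]; norm_num; linarith
    · exact sub_nonneg.2 (norm_midpoint_rpow_lt hp hab).le
  have hsum : ‖a - b‖ ^ p ≤ 2 ^ p * S := by
    have h1 : ‖a - b‖ ≤ 2 * max ‖a‖ ‖b‖ := by
      have := norm_sub_le a b
      have := le_max_left ‖a‖ ‖b‖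
      have := le_max_right ‖a‖ ‖b‖
      linarith
    refine (Real.rpow_le_rpow (norm_nonneg _) h1 h0.le).trans ?_
    rw [Real.mul_rpow (by norm_num) (by positivity)]
    refine mul_le_mul_of_nonneg_left ?_ (by positivity)
    rcases max_cases ‖a‖ ‖b‖ with h | h <;> rw [h.1] <;> linarith
  have hC : 0 ≤ 2 ^ p / c := by positivity
  rcases lt_or_ge (‖a - b‖ ^ p) (ε * S) with h | h
  · nlinarith [mul_nonneg hC hgap]
  rcases hS0.eq_or_lt with hSz | hSpos
  · rw [← hSz] at hsum hgap ⊢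
    nlinarith
  · set l : ℝ := S ^ (-p⁻¹) with hl
    have hl0 : 0 < l := by positivity
    have hlp : l ^ p = S⁻¹ := by
      rw [hl, ← Real.rpow_mul hS0, neg_mul, inv_mul_cancel₀ h0.ne', Real.rpow_neg_one]
    have hsc : ∀ x : E, ‖l • x‖ ^ p = S⁻¹ * ‖x‖ ^ p := fun x => by
      rw [norm_smul, Real.mul_rpow (norm_nonneg _) (norm_nonneg _), Real.norm_of_nonneg hl0.le,
        hlp]
    have h1 := hcK (l • a, l • b) ⟨by
      simp only [hsc]; rw [← mul_add, ← hS, inv_mul_cancel₀ hSpos.ne'], by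
      simp only [← smul_sub, hsc]
      rw [inv_mul_eq_div, le_div_iff₀ hSpos]; exact h⟩
    simp only [← smul_add, smul_comm _ l, hsc] at h1
    rw [← mul_add, ← hS] at h1
    have h2 : c * S ≤ 2⁻¹ * S - ‖(2⁻¹ : ℝ) • (a + b)‖ ^ p := by
      have h3 := mul_le_mul_of_nonneg_right h1 hS0
      have h4 : (2⁻¹ * (S⁻¹ * S) - S⁻¹ * ‖(2⁻¹ : ℝ) • (a + b)‖ ^ p) * S
          = 2⁻¹ * S - ‖(2⁻¹ : ℝ) • (a + b)‖ ^ p := by field_simp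
      rwa [h4] at h3
    have h3 := mul_le_mul_of_nonneg_left h2 hC
    have h4 : 2 ^ p / c * (c * S) = 2 ^ p * S := by field_simp
    rw [h4] at h3
    have : 0 ≤ ε * S := by positivity
    linarith

theorem norm_rpow_eq_toReal_lintegral {d : ℕ} {p : ℝ} [hp : Fact (1 < p)]
    {E : Type*} [NormedAddCommGroup E] {μ : Measure (Space d)} (V : Lp E (ENNReal.ofReal p) μ) :
    ENNReal.ofReal (‖V‖ ^ p) = ∫⁻ x, ‖V x‖ₑ ^ p ∂μ := by
  rw [lintegral_enorm_rpow_eq, Lp.norm_def, ENNReal.toReal_rpow, ENNReal.ofReal_toReal]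
  exact ENNReal.rpow_ne_top_of_nonneg (zero_lt_one.trans hp.out).le (Lp.eLpNorm_ne_top V)

/-- The pointwise inequality is linear in the `p`-th powers, so it integrates with the same
constants. This is the uniform convexity of `L^p` in the form used below. -/
theorem exists_Lp_norm_sub_rpow_le {d : ℕ} [FiniteDimensional ℝ E] {p : ℝ} [hp : Fact (1 < p)]
    (μ : Measure (Space d)) {ε : ℝ} (hε : 0 < ε) :
    ∃ C : ℝ, 0 ≤ C ∧ ∀ V W : Lp E (ENNReal.ofReal p) μ,
      ‖V - W‖ ^ p + C * ‖(2⁻¹ : ℝ) • (V + W)‖ ^ p ≤ (ε + C / 2) * (‖V‖ ^ p + ‖W‖ ^ p) := by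
  obtain ⟨C, hC, h⟩ := exists_norm_sub_rpow_le (E := E) hp.out hε
  have h0 : 0 < p := zero_lt_one.trans hp.out
  refine ⟨C, hC, fun V W => ?_⟩
  have hm : ∀ V : Lp E (ENNReal.ofReal p) μ, AEMeasurable (fun x => ‖V x‖ₑ ^ p) μ := fun V =>
    (Lp.aestronglyMeasurable V).enorm.pow_const p
  rw [← ENNReal.ofReal_le_ofReal_iff (by positivity), ENNReal.ofReal_add (by positivity)
    (by positivity), ENNReal.ofReal_mul hC, ENNReal.ofReal_mul (by positivity),
    ENNReal.ofReal_add (p := ‖V‖ ^ p) (by positivity) (by positivity), norm_rpow_eq_toReal_lintegral,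
    norm_rpow_eq_toReal_lintegral, norm_rpow_eq_toReal_lintegral, norm_rpow_eq_toReal_lintegral,
    ← lintegral_add_left' (hm V), ← lintegral_const_mul'' _ (hm _),
    ← lintegral_const_mul'' _ (show AEMeasurable (fun x => ‖V x‖ₑ ^ p + ‖W x‖ₑ ^ p) μ from
      (hm V).add (hm W)), ← lintegral_add_left' (hm _)]
  refine lintegral_mono_ae ?_
  filter_upwards [Lp.coeFn_sub V W, Lp.coeFn_add V W, Lp.coeFn_smul (2⁻¹ : ℝ) (V + W)]
    with x h1 h2 h3
  rw [h1, h3, Pi.smul_apply, h2, Pi.sub_apply, Pi.add_apply]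
  have he : ∀ y : E, ‖y‖ₑ ^ p = ENNReal.ofReal (‖y‖ ^ p) := fun y => by
    rw [← ofReal_norm, ENNReal.ofReal_rpow_of_nonneg (norm_nonneg _) h0.le]
  simp only [he]
  rw [← ENNReal.ofReal_mul hC, ← ENNReal.ofReal_add (by positivity) (by positivity),
    ← ENNReal.ofReal_add (by positivity) (by positivity), ← ENNReal.ofReal_mul (by positivity)]
  exact ENNReal.ofReal_le_ofReal (h _ _)

/-- In a uniformly convex space, sublevel sets of the minimal norm over the fibres of a closed
convex graph are closed. -/
theorem isClosed_setOf_exists_norm_le {X Y : Type*} [NormedAddCommGroup X] [NormedSpace ℝ X]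
    [NormedAddCommGroup Y] [NormedSpace ℝ Y] [CompleteSpace Y] {p : ℝ} (hp : 0 < p)
    (hY : ∀ ε : ℝ, 0 < ε → ∃ C : ℝ, 0 ≤ C ∧ ∀ V W : Y,
      ‖V - W‖ ^ p + C * ‖(2⁻¹ : ℝ) • (V + W)‖ ^ p ≤ (ε + C / 2) * (‖V‖ ^ p + ‖W‖ ^ p))
    {Γ : Set (X × Y)} (hΓ : IsClosed Γ)
    (hmid : ∀ a ∈ Γ, ∀ b ∈ Γ, (2⁻¹ : ℝ) • (a + b) ∈ Γ) (R : ℝ) :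
    IsClosed {x | ∃ y, (x, y) ∈ Γ ∧ ‖y‖ ≤ R} := by
  refine isClosed_of_closure_subset fun x hx => ?_
  rw [Metric.mem_closure_iff] at hx
  have hr : ∀ n : ℕ, (0 : ℝ) < 1 / ((n : ℝ) + 1) := fun n => Nat.one_div_pos_of_nat
  -- `D n` collects the `p`-th powers of the norms over fibres at distance less than `1 / (n + 1)`
  -- from `x`. Its infimum increases to some `δ ≤ R ^ p`, and near minimisers will form a Cauchy
  -- sequence.
  set D : ℕ → Set ℝ := fun n =>
    {e | ∃ x' y, dist x x' < 1 / ((n : ℝ) + 1) ∧ (x', y) ∈ Γ ∧ e = ‖y‖ ^ p} with hD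
  have hmem : ∀ n, ∃ e ∈ D n, e ≤ R ^ p := fun n => by
    obtain ⟨x', ⟨y, hy, hyR⟩, hd⟩ := hx _ (hr n)
    exact ⟨_, ⟨x', y, hd, hy, rfl⟩, Real.rpow_le_rpow (norm_nonneg _) hyR hp.le⟩
  have hbdd : ∀ n, BddBelow (D n) := fun n => ⟨0, by
    rintro _ ⟨x', y, -, -, rfl⟩; positivity⟩
  have hne : ∀ n, (D n).Nonempty := fun n => let ⟨e, h, _⟩ := hmem n; ⟨e, h⟩
  have hle : ∀ n, sInf (D n) ≤ R ^ p := fun n =>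
    let ⟨_, h, h'⟩ := hmem n; (csInf_le (hbdd n) h).trans h'
  have hnn : ∀ n, 0 ≤ sInf (D n) := fun n => le_csInf (hne n) (by
    rintro _ ⟨x', y, -, -, rfl⟩; positivity)
  have hanti : ∀ m n : ℕ, m ≤ n → D n ⊆ D m := by
    rintro m n hmn _ ⟨x', y, hd, hy, rfl⟩
    exact ⟨x', y, hd.trans_le (Nat.one_div_le_one_div hmn), hy, rfl⟩
  have hmono : Monotone fun n => sInf (D n) := fun m n hmn =>
    csInf_le_csInf (hbdd m) (hne n) (hanti m n hmn)
  obtain ⟨δ, hδ⟩ : ∃ δ, Tendsto (fun n => sInf (D n)) atTop (𝓝 δ) :=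
    ⟨_, tendsto_atTop_ciSup hmono ⟨R ^ p, by rintro _ ⟨n, rfl⟩; exact hle n⟩⟩
  have hleδ : ∀ n, sInf (D n) ≤ δ := fun n => hmono.ge_of_tendsto hδ n
  have hδR : δ ≤ R ^ p := le_of_tendsto' hδ hle
  have hch : ∀ n : ℕ, ∃ q : X × Y, dist x q.1 < 1 / ((n : ℝ) + 1) ∧ q ∈ Γ ∧
      ‖q.2‖ ^ p < sInf (D n) + 1 / ((n : ℝ) + 1) := fun n => by
    obtain ⟨_, ⟨x', y, hd, hy, rfl⟩, h⟩ := exists_lt_of_csInf_lt (hne n)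
      (lt_add_of_pos_right (sInf (D n)) (hr n))
    exact ⟨(x', y), hd, hy, h⟩
  choose q hqd hqΓ hqn using hch
  have hxq : Tendsto (fun n => (q n).1) atTop (𝓝 x) := by
    rw [tendsto_iff_dist_tendsto_zero]
    refine squeeze_zero (fun _ => dist_nonneg) (fun n => ?_)
      tendsto_one_div_add_atTop_nhds_zero_nat
    rw [dist_comm]; exact (hqd n).le
  have hcauchy : CauchySeq fun n => (q n).2 := by
    rw [Metric.cauchySeq_iff']
    intro ρ hρ
    set M := R ^ p + 1 with hM
    have hM0 : 0 < M := by linarith [hnn 0, hle 0]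
    -- The two `p`-th powers add up to at most `2 M`, so this tolerance contributes at most `ρ ^ p /
    -- 2`.
    obtain ⟨C, hC, hYC⟩ := hY (ρ ^ p / (4 * M)) (by positivity)
    have hlim : Tendsto (fun n : ℕ => C * (δ - sInf (D n) + 1 / ((n : ℝ) + 1))) atTop (𝓝 0) := by
      have := ((tendsto_const_nhds (x := δ)).sub hδ).add
        (tendsto_one_div_add_atTop_nhds_zero_nat (𝕜 := ℝ))
      simpa using this.const_mul C
    obtain ⟨N, hN⟩ := (hlim.eventually (gt_mem_nhds
      (show (0 : ℝ) < ρ ^ p / 2 by positivity))).exists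
    refine ⟨N, fun n hn => ?_⟩
    have h1 := hYC (q n).2 (q N).2
    have hrn : 1 / ((n : ℝ) + 1) ≤ 1 / ((N : ℝ) + 1) := Nat.one_div_le_one_div hn
    have hr1 : 1 / ((N : ℝ) + 1) ≤ 1 := by
      rw [div_le_one (by positivity)]; linarith [(Nat.cast_nonneg N : (0 : ℝ) ≤ N)]
    -- The midpoint lies in `Γ` over a point of the same ball, so its norm cannot beat the infimum.
    -- Uniform convexity then forces the two near minimisers together.
    have h2 : sInf (D N) ≤ ‖(2⁻¹ : ℝ) • ((q n).2 + (q N).2)‖ ^ p := by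
      refine csInf_le (hbdd N) ⟨(2⁻¹ : ℝ) • ((q n).1 + (q N).1), _, ?_,
        hmid _ (hqΓ n) _ (hqΓ N), rfl⟩
      have e : x - (2⁻¹ : ℝ) • ((q n).1 + (q N).1) =
          (2⁻¹ : ℝ) • ((x - (q n).1) + (x - (q N).1)) := by module
      rw [dist_eq_norm, e, norm_smul]
      have i1 := hqd n
      have i2 := hqd N
      rw [dist_eq_norm] at i1 i2
      have := norm_add_le (x - (q n).1) (x - (q N).1)
      rw [Real.norm_of_nonneg (by norm_num)]
      linarith
    have h3 := hqn n
    have h4 := hqn N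
    have h5 := hleδ n
    have h6 := hleδ N
    have h7 : ‖(q n).2‖ ^ p + ‖(q N).2‖ ^ p ≤ 2 * δ + 2 * (1 / ((N : ℝ) + 1)) := by linarith
    have h8 : ‖(q n).2‖ ^ p + ‖(q N).2‖ ^ p ≤ 2 * M := by linarith
    have h9 : ρ ^ p / (4 * M) * (‖(q n).2‖ ^ p + ‖(q N).2‖ ^ p) ≤ ρ ^ p / 2 := by
      refine (mul_le_mul_of_nonneg_left h8 (by positivity)).trans_eq ?_
      field_simp; norm_num
    have h10 := mul_le_mul_of_nonneg_left h7 (by positivity : 0 ≤ C / 2)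
    have h11 := mul_le_mul_of_nonneg_left h2 hC
    have h12 : ‖(q n).2 - (q N).2‖ ^ p < ρ ^ p := by
      have : (ρ ^ p / (4 * M) + C / 2) * (‖(q n).2‖ ^ p + ‖(q N).2‖ ^ p) =
        ρ ^ p / (4 * M) * (‖(q n).2‖ ^ p + ‖(q N).2‖ ^ p) +
          C / 2 * (‖(q n).2‖ ^ p + ‖(q N).2‖ ^ p) := by ring
      nlinarith
    rw [dist_eq_norm]
    exact lt_of_not_ge fun h => absurd (Real.rpow_le_rpow hρ.le h hp.le) (not_le.2 h12)
  obtain ⟨y, hy⟩ := cauchySeq_tendsto_of_complete hcauchy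
  refine ⟨y, hΓ.mem_of_tendsto (hxq.prodMk_nhds hy) (Eventually.of_forall hqΓ), ?_⟩
  have hR : 0 ≤ R := by
    obtain ⟨x', ⟨y, -, hyR⟩, -⟩ := hx _ one_pos
    exact (norm_nonneg _).trans hyR
  have h1 : Tendsto (fun n => ‖(q n).2‖ ^ p) atTop (𝓝 (‖y‖ ^ p)) :=
    hy.norm.rpow_const (Or.inr hp.le)
  have h2 : Tendsto (fun n : ℕ => R ^ p + 1 / ((n : ℝ) + 1)) atTop (𝓝 (R ^ p)) := by
    simpa using (tendsto_one_div_add_atTop_nhds_zero_nat (𝕜 := ℝ)).const_add (R ^ p)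
  have h3 : ‖y‖ ^ p ≤ R ^ p :=
    le_of_tendsto_of_tendsto' h1 h2 fun n => by linarith [hqn n, hle n]
  exact (Real.rpow_le_rpow_iff (norm_nonneg _) hR hp).1 h3

end UniformConvexity

/-- The graph of the weak gradient on `A`, in `L^p(Ω) × L^p(A; ℝ^d)`. -/
def weakGradientGraph {d : ℕ} (A Ω : Set (Space d)) (p : ℝ) :
    Set (LpSpace Ω p × Lp (Space d) (ENNReal.ofReal p) (volume.restrict A)) :=
  {x | IsWeakGradient A x.1 x.2}

/-- For fixed test function and direction, both sides of the defining identity are pairings with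
functions in the conjugate space, hence continuous. The graph is an intersection of their equality
sets. -/
theorem isClosed_weakGradientGraph {d : ℕ} {A Ω : Set (Space d)} {p : ℝ} [hp : Fact (1 < p)]
    (hAΩ : A ⊆ Ω) : IsClosed (weakGradientGraph A Ω p) := by
  have hconj := ENNReal.HolderConjugate.conjExponent (fact_one_le_ofReal p).out
  have : Fact (1 ≤ (ENNReal.ofReal p).conjExponent) := ⟨hconj.symm.one_le _ _⟩
  have hset : weakGradientGraph A Ω p = ⋂ (η : {η : Space d → ℝ // ContDiff ℝ ∞ η ∧
        HasCompactSupport η ∧ tsupport η ⊆ A}) (w : Space d),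
      {x | ∫ y in A, x.1 y * fderiv ℝ η.1 y w = - ∫ y in A, η.1 y * inner ℝ (x.2 y) w} := by
    ext x
    simp only [weakGradientGraph, IsWeakGradient, mem_ofPred_eq, mem_iInter, Subtype.forall, and_imp]
  rw [hset]
  refine isClosed_iInter fun ⟨η, hη, hc, hs⟩ => isClosed_iInter fun w => isClosed_eq ?_ ?_
  · have hcont : Continuous fun x => fderiv ℝ η x w :=
      (hη.continuous_fderiv (by simp)).clm_apply continuous_const
    have hm : MemLp (fun x => fderiv ℝ η x w) (ENNReal.ofReal p).conjExponent
        (volume.restrict Ω) :=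
      hcont.memLp_of_hasCompactSupport (hc.fderiv_apply (𝕜 := ℝ) w)
    have key : ∀ φ : LpSpace Ω p, ∫ y in A, φ y * fderiv ℝ η y w =
        (ContinuousLinearMap.mul ℝ ℝ).lpPairing (volume.restrict Ω) _ _ φ (hm.toLp _) := by
      intro φ
      rw [ContinuousLinearMap.lpPairing_eq_integral]
      have h1 : ∀ x, x ∉ A → φ x * fderiv ℝ η x w = 0 := fun x hx => by
        rw [image_eq_zero_of_notMem_tsupport (fun h => hx (hs (tsupport_fderiv_subset ℝ h)))]
        simp
      rw [setIntegral_eq_integral_of_forall_compl_eq_zero h1,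
        ← setIntegral_eq_integral_of_forall_compl_eq_zero fun x hx => h1 x fun h => hx (hAΩ h)]
      refine integral_congr_ae (hm.coeFn_toLp.mono fun x hx => ?_)
      simp only [hx, ContinuousLinearMap.mul_apply']
    simp only [key]
    fun_prop
  · have hm : MemLp (fun x => η x • w) (ENNReal.ofReal p).conjExponent (volume.restrict A) :=
      (hη.continuous.smul continuous_const).memLp_of_hasCompactSupport hc.smul_right
    have key : ∀ V : Lp (Space d) (ENNReal.ofReal p) (volume.restrict A),
        ∫ y in A, η y * inner ℝ (V y) w =
        (innerSL ℝ (E := Space d)).lpPairing (volume.restrict A) _ _ V (hm.toLp _) := by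
      intro V
      rw [ContinuousLinearMap.lpPairing_eq_integral]
      refine integral_congr_ae (hm.coeFn_toLp.mono fun x hx => ?_)
      beta_reduce
      rw [hx]
      exact (inner_smul_right (V x) w (η x)).symm
    simp only [key]
    fun_prop

theorem midpoint_mem_weakGradientGraph {d : ℕ} {A Ω : Set (Space d)} {p : ℝ}
    [hp : Fact (1 < p)] (hΩb : Bornology.IsBounded Ω) (hAΩ : A ⊆ Ω)
    {a b : LpSpace Ω p × Lp (Space d) (ENNReal.ofReal p) (volume.restrict A)}
    (h1 : a ∈ weakGradientGraph A Ω p) (h2 : b ∈ weakGradientGraph A Ω p) :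
    (2⁻¹ : ℝ) • (a + b) ∈ weakGradientGraph A Ω p := by
  have hAb := hΩb.subset hAΩ
  have := isFiniteMeasure_restrict_of_isBounded hAb
  have := isFiniteMeasure_restrict_of_isBounded hΩb
  obtain ⟨φ, V⟩ := a
  obtain ⟨φ', V'⟩ := b
  have hφ : ∀ φ : LpSpace Ω p, Integrable φ (volume.restrict A) := fun φ =>
    ((Lp.memLp φ).integrable Fact.out).mono_measure (Measure.restrict_mono hAΩ le_rfl)
  have hV : ∀ V : Lp (Space d) (ENNReal.ofReal p) (volume.restrict A),
      Integrable V (volume.restrict A) := fun V => (Lp.memLp V).integrable Fact.out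
  have h3 := (IsWeakGradient.add (hφ φ) (hφ φ') (hV V) (hV V') h1 h2).const_smul (2⁻¹ : ℝ)
  refine (h3.congr_left ?_).congr_right ?_
  · refine ae_mono (Measure.restrict_mono hAΩ le_rfl) ?_
    filter_upwards [Lp.coeFn_smul (2⁻¹ : ℝ) (φ + φ'), Lp.coeFn_add φ φ'] with x h1 h2
    exact (by rw [h1, Pi.smul_apply, Pi.smul_apply, h2] :
      ((2⁻¹ : ℝ) • (⇑φ + ⇑φ')) x = ((2⁻¹ : ℝ) • (φ + φ') : LpSpace Ω p) x)
  · filter_upwards [Lp.coeFn_smul (2⁻¹ : ℝ) (V + V'), Lp.coeFn_add V V'] with x h1 h2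
    exact (by rw [h1, Pi.smul_apply, Pi.smul_apply, h2] : ((2⁻¹ : ℝ) • (⇑V + ⇑V')) x =
      ((2⁻¹ : ℝ) • (V + V') : Lp (Space d) (ENNReal.ofReal p) (volume.restrict A)) x)

/-- A finite sublevel set is the projection of the part of the closed gradient graph with norm at
most `M ^ (1/p)`. Such a projection is closed by uniform convexity. -/
theorem lowerSemicontinuous_dirichletEnergy {d : ℕ} {A Ω : Set (Space d)} {p : ℝ}
    [hp : Fact (1 < p)] (hΩb : Bornology.IsBounded Ω) (hA : IsOpen A) (hAΩ : A ⊆ Ω) :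
    LowerSemicontinuous fun φ : LpSpace Ω p => dirichletEnergy Ω p φ A := by
  have h0 : 0 < p := zero_lt_one.trans hp.out
  have hAb := hΩb.subset hAΩ
  have := isFiniteMeasure_restrict_of_isBounded hAb
  rw [lowerSemicontinuous_iff_isClosed_preimage]
  intro M
  rcases eq_or_ne M ⊤ with rfl | hM
  · simp
  have hset : (fun φ : LpSpace Ω p => dirichletEnergy Ω p φ A) ⁻¹' Iic M =
      {φ | ∃ V : Lp (Space d) (ENNReal.ofReal p) (volume.restrict A),
        (φ, V) ∈ weakGradientGraph A Ω p ∧ ‖V‖ ≤ M.toReal ^ p⁻¹} := by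
    have hnorm : ∀ V : Lp (Space d) (ENNReal.ofReal p) (volume.restrict A),
        ‖V‖ ≤ M.toReal ^ p⁻¹ ↔ ∫⁻ x in A, ‖V x‖ₑ ^ p ≤ M := fun V => by
      rw [Real.le_rpow_inv_iff_of_pos (norm_nonneg _) (by positivity) h0,
        ← norm_rpow_eq_toReal_lintegral, ENNReal.ofReal_le_iff_le_toReal hM]
    ext φ
    simp only [mem_preimage, mem_Iic, mem_ofPred_eq, hnorm, weakGradientGraph]
    constructor
    · intro h
      obtain ⟨h1, h2⟩ := weakGradient_spec (dirichletEnergy_lt_top_iff.1 (h.trans_lt hM.lt_top))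
      have h3 := h2.congr_right h1.coeFn_toLp.symm
      exact ⟨h1.toLp _, h3, by rwa [← dirichletEnergy_eq hA hAb (Lp.memLp _) h3]⟩
    · rintro ⟨V, hV, hVM⟩
      rwa [dirichletEnergy_eq hA hAb (Lp.memLp V) hV]
  rw [hset]
  have hY : ∀ ε : ℝ, 0 < ε → ∃ C : ℝ, 0 ≤ C ∧
      ∀ V W : Lp (Space d) (ENNReal.ofReal p) (volume.restrict A),
        ‖V - W‖ ^ p + C * ‖(2⁻¹ : ℝ) • (V + W)‖ ^ p ≤ (ε + C / 2) * (‖V‖ ^ p + ‖W‖ ^ p) :=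
    fun ε hε => exists_Lp_norm_sub_rpow_le (volume.restrict A) hε
  exact isClosed_setOf_exists_norm_le h0 hY (isClosed_weakGradientGraph hAΩ)
    (fun a ha b hb => midpoint_mem_weakGradientGraph hΩb hAΩ ha hb) _

/-! ### Fine partitions and weak* convergence -/

/-- A finite measurable partition of `Ω` into sets of diameter less than `δ` with non-empty
interior. -/
structure IsFinePartition {d : ℕ} {ι : Type*} (Ω : Set (Space d)) (δ : ℝ)
    (Q : ι → Set (Space d)) : Prop where
  measurable : ∀ i, MeasurableSet (Q i)
  disjoint : Pairwise (Function.onFun Disjoint Q)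
  iUnion : ⋃ i, Q i = Ω
  dist_lt : ∀ i, ∀ x ∈ Q i, ∀ y ∈ Q i, dist x y < δ
  interior : ∀ i, (interior (Q i)).Nonempty

section Partition

variable {d : ℕ} {Ω : Set (Space d)}

/-- The half-open cube of side `h` with index `k`. -/
def gridCell (h : ℝ) (k : Fin d → ℤ) : Set (Space d) := {x | ∀ i, ⌊x i / h⌋ = k i}

theorem measurableSet_gridCell (h : ℝ) (k : Fin d → ℤ) : MeasurableSet (gridCell h k) := by
  have : gridCell h k = ⋂ i, (fun x : Space d => ⌊x i / h⌋) ⁻¹' {k i} := by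
    ext x; simp [gridCell]
  rw [this]
  refine MeasurableSet.iInter fun i => ?_
  have hm : Measurable fun x : Space d => ⌊x i / h⌋ :=
    Int.measurable_floor.comp (by fun_prop)
  exact hm (measurableSet_singleton _)

theorem dist_le_of_mem_gridCell {h : ℝ} (hh : 0 < h) {k : Fin d → ℤ} {x y : Space d}
    (hx : x ∈ gridCell h k) (hy : y ∈ gridCell h k) : dist x y ≤ √d * h := by
  rw [EuclideanSpace.dist_eq]
  have h1 : ∀ i, dist (x i) (y i) ^ 2 ≤ h ^ 2 := fun i => by
    refine pow_le_pow_left₀ dist_nonneg ?_ 2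
    have e : ⌊x i / h⌋ = ⌊y i / h⌋ := (hx i).trans (hy i).symm
    have := Int.abs_sub_lt_one_of_floor_eq_floor e
    rw [← sub_div, abs_div, abs_of_pos hh, div_lt_one hh] at this
    exact this.le
  calc √(∑ i, dist (x i) (y i) ^ 2) ≤ √(∑ _i : Fin d, h ^ 2) :=
        Real.sqrt_le_sqrt (Finset.sum_le_sum fun i _ => h1 i)
    _ = √d * h := by
        rw [Finset.sum_const, Finset.card_univ, Fintype.card_fin, nsmul_eq_mul,
          Real.sqrt_mul (by positivity), Real.sqrt_sq hh.le]

/-- Cells contain their lower faces, so moving slightly from any point in the direction `(1, …, 1)`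
enters the open cube without leaving the open set `Ω`. The interior is where perturbations of the
energy are supported. -/
theorem interior_gridCell_inter_nonempty {h : ℝ} (hh : 0 < h) (hΩ : IsOpen Ω) {k : Fin d → ℤ}
    (hne : (gridCell h k ∩ Ω).Nonempty) : (interior (gridCell h k ∩ Ω)).Nonempty := by
  obtain ⟨x, hx, hxΩ⟩ := hne
  set v : Space d := WithLp.toLp 2 fun _ => 1
  have hcont : ∀ᶠ t : ℝ in 𝓝[>] 0, x + t • v ∈ Ω := by
    refine nhdsWithin_le_nhds ?_
    have hc : Continuous fun t : ℝ => x + t • v := by fun_prop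
    exact hc.continuousAt.eventually_mem (hΩ.mem_nhds (by simpa using hxΩ))
  have hcell : ∀ i, ∀ᶠ t : ℝ in 𝓝[>] 0, t < h * (k i + 1) - x i := fun i => by
    refine nhdsWithin_le_nhds (gt_mem_nhds ?_)
    have := Int.lt_floor_add_one (x i / h)
    rw [hx i, div_lt_iff₀ hh] at this
    linarith
  obtain ⟨t, ⟨ht1, ht2⟩, ht0⟩ :=
    ((hcont.and (eventually_all.2 hcell)).and self_mem_nhdsWithin).exists
  have ht0 : 0 < t := ht0
  refine ⟨x + t • v, mem_interior.2
    ⟨(⋂ i, {y : Space d | h * k i < y i ∧ y i < h * (k i + 1)}) ∩ Ω, ?_, ?_, ?_, ht1⟩⟩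
  · rintro y ⟨hy, hyΩ⟩
    refine ⟨fun i => ?_, hyΩ⟩
    have := mem_iInter.1 hy i
    rw [Int.floor_eq_iff, le_div_iff₀ hh, div_lt_iff₀ hh]
    constructor <;> linarith [this.1, this.2]
  · refine IsOpen.inter (isOpen_iInter_of_finite fun i => ?_) hΩ
    have hc : Continuous fun y : Space d => y i := by fun_prop
    exact (isOpen_lt continuous_const hc).inter (isOpen_lt hc continuous_const)
  · refine mem_iInter.2 fun i => ?_
    have h1 : (x + t • v) i = x i + t := by simp [v]
    have h2 := Int.floor_le (x i / h)
    rw [hx i, le_div_iff₀ hh] at h2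
    have h3 := ht2 i
    simp only [mem_ofPred_eq, h1]
    constructor <;> linarith

theorem exists_isFinePartition (hΩ : IsOpen Ω) (hΩb : Bornology.IsBounded Ω) {δ : ℝ}
    (hδ : 0 < δ) : ∃ (ι : Type) (_ : Fintype ι) (Q : ι → Set (Space d)),
      IsFinePartition Ω δ Q := by
  set h := δ / (√d + 1) with hh
  have hpos : 0 < h := by positivity
  obtain ⟨R, hR⟩ := hΩb.exists_norm_le
  have hfin : {k : Fin d → ℤ | (gridCell h k ∩ Ω).Nonempty}.Finite := by
    refine (finite_Icc (fun _ : Fin d => ⌊-R / h⌋) (fun _ => ⌊R / h⌋)).subset ?_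
    rintro k ⟨x, hx, hxΩ⟩
    have hb : ∀ i, |x i| ≤ R := fun i => (PiLp.norm_apply_le x i).trans (hR x hxΩ)
    exact ⟨fun i => hx i ▸ Int.floor_mono
        (div_le_div_of_nonneg_right (neg_le_of_abs_le (hb i)) hpos.le),
      fun i => hx i ▸ Int.floor_mono
        (div_le_div_of_nonneg_right (le_of_abs_le (hb i)) hpos.le)⟩
  refine ⟨{k : Fin d → ℤ | (gridCell h k ∩ Ω).Nonempty}, hfin.fintype,
    fun k => gridCell h k.1 ∩ Ω, fun k => (measurableSet_gridCell h _).inter hΩ.measurableSet,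
    ?_, ?_, ?_, fun k => interior_gridCell_inter_nonempty hpos hΩ k.2⟩
  · rintro ⟨k, hk⟩ ⟨l, hl⟩ hkl
    refine disjoint_left.2 ?_
    rintro x ⟨h1, -⟩ ⟨h2, -⟩
    exact hkl (Subtype.ext (funext fun i => (h1 i).symm.trans (h2 i)))
  · refine Subset.antisymm (iUnion_subset fun k => inter_subset_right) fun x hx => ?_
    have hx' : x ∈ gridCell h (fun i => ⌊x i / h⌋) ∩ Ω := ⟨fun i => rfl, hx⟩
    exact mem_iUnion.2 ⟨⟨_, ⟨x, hx'⟩⟩, hx'⟩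
  · rintro k x ⟨hx, -⟩ y ⟨hy, -⟩
    refine (dist_le_of_mem_gridCell hpos hx hy).trans_lt ?_
    rw [hh, mul_div_assoc', div_lt_iff₀ (by positivity)]
    nlinarith

theorem IsFinePartition.restrict_eq {ι : Type*} [Countable ι] {δ : ℝ} {Q : ι → Set (Space d)}
    (hQ : IsFinePartition Ω δ Q) (μ : PosMeasure Ω) :
    Measure.sum (fun i => μ.toMeasure.restrict (Q i)) = μ.toMeasure := by
  rw [← Measure.restrict_iUnion hQ.disjoint hQ.measurable, hQ.iUnion,
    Measure.restrict_eq_self_of_ae_mem]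
  exact mem_ae_iff.2 μ.compl_null

theorem IsFinePartition.integral_eq_sum {ι : Type*} [Fintype ι] {δ : ℝ} {Q : ι → Set (Space d)}
    (hQ : IsFinePartition Ω δ Q) (μ : PosMeasure Ω) {f : Space d → ℝ}
    (hf : Integrable f μ.toMeasure) :
    ∫ x, f x ∂μ.toMeasure = ∑ i, ∫ x in Q i, f x ∂μ.toMeasure := by
  conv_lhs => rw [← hQ.restrict_eq μ]
  rw [integral_sum_measure (by rwa [hQ.restrict_eq μ]), tsum_fintype]

theorem TestFun.integrable (ζ : TestFun Ω) (μ : PosMeasure Ω) :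
    Integrable (fun x => ζ.1 x) μ.toMeasure := by
  have := μ.isFinite
  exact (ζ.1.toBCF.integrable μ.toMeasure :)

/-- On each cell both integrals are compared with the value of `ζ` at one point times the common
mass; the factor `2` counts the two comparisons. -/
theorem IsFinePartition.abs_integral_sub_le {ι : Type*} [Fintype ι] {δ ε : ℝ}
    {Q : ι → Set (Space d)} (hQ : IsFinePartition Ω δ Q) (μ ν : PosMeasure Ω)
    (h : ∀ i, μ.toMeasure (Q i) = ν.toMeasure (Q i)) (ζ : TestFun Ω)
    (hζ : ∀ x y, dist x y < δ → dist (ζ.1 x) (ζ.1 y) ≤ ε) :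
    |∫ x, ζ.1 x ∂μ.toMeasure - ∫ x, ζ.1 x ∂ν.toMeasure| ≤ 2 * ε * ν.toMeasure.real univ := by
  have := μ.isFinite
  have := ν.isFinite
  have hx : ∀ i, ∃ x, x ∈ Q i := fun i => (hQ.interior i).mono interior_subset
  choose c hc using hx
  have key : ∀ (μ : PosMeasure Ω) i, |∫ x in Q i, ζ.1 x ∂μ.toMeasure -
      ζ.1 (c i) * μ.toMeasure.real (Q i)| ≤ ε * μ.toMeasure.real (Q i) := fun μ i => by
    have := μ.isFinite
    have h1 : ∫ x in Q i, (ζ.1 x - ζ.1 (c i)) ∂μ.toMeasure =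
        ∫ x in Q i, ζ.1 x ∂μ.toMeasure - ζ.1 (c i) * μ.toMeasure.real (Q i) := by
      rw [integral_sub (ζ.integrable μ).integrableOn (integrable_const (μ := μ.toMeasure.restrict (Q i)) _)]
      simp [mul_comm]
    rw [← h1]
    rw [← Real.norm_eq_abs]
    refine norm_setIntegral_le_of_norm_le_const (measure_lt_top μ.toMeasure (Q i)) fun x hx => ?_
    rw [← dist_eq_norm]
    exact hζ _ _ (hQ.dist_lt i x hx _ (hc i))
  rw [hQ.integral_eq_sum μ (ζ.integrable μ), hQ.integral_eq_sum ν (ζ.integrable ν),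
    ← Finset.sum_sub_distrib]
  have hsum : ∑ i, ν.toMeasure.real (Q i) ≤ ν.toMeasure.real univ := by
    rw [← measureReal_biUnion_finset (fun i _ j _ hij => hQ.disjoint hij)
      (fun i _ => hQ.measurable i)]
    exact measureReal_mono (subset_univ _)
  -- A cell contains a point, at which `hζ` gives `0 ≤ ε`. Without cells the sign of `ε` is unknown,
  -- but then `Ω` is empty and both integrals vanish.
  have hε : 0 ≤ ε ∨ IsEmpty ι := by
    rcases isEmpty_or_nonempty ι with h | ⟨⟨i⟩⟩
    · exact Or.inr h
    · refine Or.inl (dist_nonneg.trans (hζ (c i) (c i) (hQ.dist_lt i _ (hc i) _ (hc i))))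
  rcases hε with hε | hι
  · calc |∑ i, (∫ x in Q i, ζ.1 x ∂μ.toMeasure - ∫ x in Q i, ζ.1 x ∂ν.toMeasure)|
        ≤ ∑ i, |∫ x in Q i, ζ.1 x ∂μ.toMeasure - ∫ x in Q i, ζ.1 x ∂ν.toMeasure| :=
          Finset.abs_sum_le_sum_abs _ _
      _ ≤ ∑ i, 2 * ε * ν.toMeasure.real (Q i) := by
          refine Finset.sum_le_sum fun i _ => ?_
          have h1 := key μ i
          have h2 := key ν i
          have h3 : μ.toMeasure.real (Q i) = ν.toMeasure.real (Q i) := by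
            rw [measureReal_def, measureReal_def, h i]
          rw [h3] at h1
          rw [abs_le] at h1 h2 ⊢
          constructor <;> linarith [h1.1, h1.2, h2.1, h2.2]
      _ ≤ 2 * ε * ν.toMeasure.real univ := by
          rw [← Finset.mul_sum]
          exact mul_le_mul_of_nonneg_left hsum (by positivity)
  · have hΩe : Ω = ∅ := by rw [← hQ.iUnion]; simp
    have hν : ν.toMeasure univ = 0 := by
      refine measure_mono_null (fun x _ => ?_) ν.compl_null
      rw [hΩe, compl_empty]; trivial
    simp [measureReal_def, hν]

/-- Test functions in `C_0` are uniformly continuous, so their oscillation on the cells tends to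
zero while the cell masses are those of the limit. -/
theorem tendsto_posMeasure {μs : ℕ → PosMeasure Ω} {μ : PosMeasure Ω}
    (h : ∀ n : ℕ, ∃ (ι : Type) (_ : Fintype ι) (Q : ι → Set (Space d)),
      IsFinePartition Ω (1 / ((n : ℝ) + 1)) Q ∧
        ∀ i, (μs n).toMeasure (Q i) = μ.toMeasure (Q i)) :
    Tendsto μs atTop (𝓝 μ) := by
  rw [nhds_induced, tendsto_comap_iff, tendsto_pi_nhds]
  intro ζ
  rw [Metric.tendsto_atTop]
  intro ε hε
  set M := μ.toMeasure.real univ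
  have hM : 0 ≤ M := measureReal_nonneg
  obtain ⟨δ, hδ, hζ⟩ := Metric.uniformContinuous_iff.1 (ZeroAtInftyContinuousMap.uniformContinuous ζ.1) (ε / (2 * (M + 1)))
    (by positivity)
  obtain ⟨N, hN⟩ := exists_nat_one_div_lt hδ
  refine ⟨N, fun n hn => ?_⟩
  obtain ⟨ι, _, Q, hQ, hQμ⟩ := h n
  have h1 : 1 / ((n : ℝ) + 1) ≤ 1 / ((N : ℝ) + 1) := Nat.one_div_le_one_div hn
  have h2 := hQ.abs_integral_sub_le (μs n) μ hQμ ζ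
    (fun x y hxy => (hζ (hxy.trans (h1.trans_lt hN))).le)
  rw [Real.dist_eq]
  refine h2.trans_lt ?_
  have h3 : 2 * (ε / (2 * (M + 1))) * M = ε * (M / (M + 1)) := by field_simp
  have h4 : M / (M + 1) < 1 := by rw [div_lt_one (by linarith)]; linarith
  calc 2 * (ε / (2 * (M + 1))) * M = ε * (M / (M + 1)) := h3
    _ < ε := by nlinarith

end Partition

/-! ### Prescribing the energy on the cells of a partition -/

section Bump

variable {d : ℕ} {Ω : Set (Space d)} {p : ℝ}

theorem gradient_comp_smul_sub {η : Space d → ℝ} (hη : ContDiff ℝ ∞ η) (r : ℝ) (x₀ x : Space d) :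
    gradient (fun x => η (r • (x - x₀))) x = r • gradient η (r • (x - x₀)) := by
  have hd : DifferentiableAt ℝ η (r • (x - x₀)) := hη.differentiable (by simp) _
  have h1 : HasFDerivAt (fun x => r • (x - x₀)) (r • ContinuousLinearMap.id ℝ (Space d)) x :=
    ((hasFDerivAt_id x).sub_const x₀).const_smul r
  have h2 := (hd.hasFDerivAt.comp x h1).fderiv
  change fderiv ℝ (fun x => η (r • (x - x₀))) x = _ at h2
  rw [gradient, gradient, h2, ← map_smul]
  congr 1
  ext v
  simp

theorem eLpNorm_comp_smul_sub {E : Type*} [NormedAddCommGroup E] {f : Space d → E}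
    (hf : Continuous f) {r : ℝ} (hr : 0 < r) (x₀ : Space d) {q : ℝ≥0∞} (hq : q ≠ ⊤) :
    eLpNorm (fun x => f (r • (x - x₀))) q volume =
      ENNReal.ofReal |(r ^ d)⁻¹| ^ (1 / q).toReal * eLpNorm f q volume := by
  have h1 : eLpNorm (fun x => f (r • (x - x₀))) q volume =
      eLpNorm (fun x => f (r • x)) q volume :=
    eLpNorm_comp_measurePreserving (g := fun x => f (r • x)) (by fun_prop)
      (measurePreserving_sub_right volume x₀)
  rw [h1]
  have h2 : eLpNorm (fun x => f (r • x)) q volume =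
      eLpNorm f q (Measure.map (fun x => r • x) volume) :=
    (eLpNorm_map_measure hf.aestronglyMeasurable (by fun_prop)).symm
  rw [h2, Measure.map_addHaar_smul volume hr.ne', eLpNorm_smul_measure_of_ne_top hq,
    smul_eq_mul, finrank_euclideanSpace_fin]

theorem exists_smooth_unit (hd : 1 ≤ d) : ∃ η : Space d → ℝ, ContDiff ℝ ∞ η ∧
    tsupport η ⊆ Metric.closedBall 0 2 ∧ ∀ q : ℝ≥0∞, q ≠ 0 →
      eLpNorm (gradient η) q volume ≠ 0 := by
  set b : ContDiffBump (0 : Space d) := ⟨1, 2, one_pos, one_lt_two⟩ with hb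
  refine ⟨b, b.contDiff, b.tsupport_eq.subset, fun q hq h0 => ?_⟩
  have hc : Continuous (gradient b) := continuous_gradient b.contDiff
  rw [eLpNorm_eq_zero_iff hc.aestronglyMeasurable hq] at h0
  have h1 : gradient b = 0 := Continuous.ae_eq_iff_eq volume hc continuous_const |>.1 h0
  have h2 : ∀ x, fderiv ℝ b x = 0 := fun x => by
    have := congrFun h1 x
    simpa [gradient] using this
  set v : Space d := EuclideanSpace.single ⟨0, hd⟩ 3
  have h3 := is_const_of_fderiv_eq_zero (b.contDiff.differentiable (n := 1) (by simp)) h2 0 v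
  have h4 : b (0 : Space d) = 1 := b.one_of_mem_closedBall (by simp [hb])
  have h5 : b v = 0 := b.zero_of_le_dist (by simp [hb, v]; norm_num)
  rw [h4, h5] at h3
  exact one_ne_zero h3

/-- The failure of the reverse Poincaré inequality. -/
theorem exists_smooth_eLpNorm_le (hd : 1 ≤ d) {U : Set (Space d)} (hU : IsOpen U)
    (hne : U.Nonempty) {q : ℝ≥0∞} (hq0 : q ≠ 0) (hq : q ≠ ⊤) {c : ℝ} (hc : 0 < c) :
    ∃ w : Space d → ℝ, ContDiff ℝ ∞ w ∧ HasCompactSupport w ∧ tsupport w ⊆ U ∧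
      eLpNorm (gradient w) q volume ≠ 0 ∧
      eLpNorm w q volume ≤ ENNReal.ofReal c * eLpNorm (gradient w) q volume := by
  obtain ⟨η, hη, hs, hg⟩ := exists_smooth_unit hd
  have hηc : HasCompactSupport η :=
    (isCompact_closedBall _ _).of_isClosed_subset (isClosed_tsupport _) hs
  obtain ⟨x₀, hx₀⟩ := hne
  obtain ⟨ρ, hρ, hball⟩ := Metric.isOpen_iff.1 hU x₀ hx₀
  have hgt : eLpNorm (gradient η) q volume ≠ ⊤ := (memLp_gradient hη hηc q volume).2.ne
  have hηt : eLpNorm η q volume ≠ ⊤ := (memLp_smooth hη hηc q volume).2.ne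
  set a := (eLpNorm (gradient η) q volume).toReal with ha
  set m := (eLpNorm η q volume).toReal with hm
  have ha0 : 0 < a := ENNReal.toReal_pos (hg q hq0) hgt
  have hm0 : 0 ≤ m := ENNReal.toReal_nonneg
  -- The first term puts the rescaled support, of radius `2 / r`, inside the ball of radius `ρ`. The
  -- second gives `m ≤ c r a`: rescaling multiplies both norms by the same factor, but the gradient
  -- gains an extra `r`.
  set r : ℝ := 3 / ρ + m / (c * a) with hr
  have hr0 : 0 < r := by positivity
  have hcont : Continuous fun x : Space d => r • (x - x₀) := by fun_prop
  have hsupp : tsupport (fun x => η (r • (x - x₀))) ⊆ Metric.closedBall x₀ (2 / r) := by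
    refine closure_minimal (fun x hx => ?_) Metric.isClosed_closedBall
    have h1 : r • (x - x₀) ∈ Metric.closedBall 0 2 := hs (subset_tsupport η hx)
    rw [mem_closedBall_zero_iff, norm_smul, Real.norm_of_nonneg hr0.le] at h1
    rw [Metric.mem_closedBall, dist_eq_norm, le_div_iff₀ hr0]
    linarith
  refine ⟨fun x => η (r • (x - x₀)), hη.comp (by fun_prop),
    (isCompact_closedBall _ _).of_isClosed_subset (isClosed_tsupport _) hsupp,
    hsupp.trans ((Metric.closedBall_subset_ball ?_).trans hball), ?_, ?_⟩
  · rw [div_lt_iff₀ hr0, hr]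
    have : ρ * (3 / ρ) = 3 := by field_simp
    have : 0 ≤ ρ * (m / (c * a)) := by positivity
    nlinarith
  all_goals
    have hgr : gradient (fun x => η (r • (x - x₀))) =
        r • fun x => gradient η (r • (x - x₀)) :=
      funext fun x => gradient_comp_smul_sub hη r x₀ x
    have hK : ENNReal.ofReal |(r ^ d)⁻¹| ≠ 0 := by
      rw [Ne, ENNReal.ofReal_eq_zero, not_le]; positivity
  · rw [hgr, eLpNorm_const_smul, eLpNorm_comp_smul_sub (continuous_gradient hη) hr0 _ hq]
    refine mul_ne_zero (by simpa using hr0.ne') (mul_ne_zero ?_ (hg q hq0))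
    exact (ENNReal.rpow_pos (pos_iff_ne_zero.2 hK) ENNReal.ofReal_ne_top).ne'
  · rw [hgr, eLpNorm_const_smul, eLpNorm_comp_smul_sub (continuous_gradient hη) hr0 _ hq,
      eLpNorm_comp_smul_sub hη.continuous hr0 _ hq, ← ENNReal.ofReal_toReal hgt,
      ← ENNReal.ofReal_toReal hηt, ← ha, ← hm, Real.enorm_eq_ofReal hr0.le]
    have h1 : m ≤ c * (r * a) := by
      have : c * a * (m / (c * a)) = m := by field_simp
      have : 0 ≤ c * a * (3 / ρ) := by positivity
      rw [hr]; nlinarith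
    have h2 : ENNReal.ofReal m ≤ ENNReal.ofReal c * (ENNReal.ofReal r * ENNReal.ofReal a) := by
      rw [← ENNReal.ofReal_mul hr0.le, ← ENNReal.ofReal_mul hc.le]
      exact ENNReal.ofReal_le_ofReal h1
    calc ENNReal.ofReal |(r ^ d)⁻¹| ^ (1 / q).toReal * ENNReal.ofReal m
        ≤ ENNReal.ofReal |(r ^ d)⁻¹| ^ (1 / q).toReal *
          (ENNReal.ofReal c * (ENNReal.ofReal r * ENNReal.ofReal a)) := by gcongr
      _ = _ := by ring

/-- A small smooth perturbation supported in `U ⊆ Q` raises the energy on `Q` to any prescribed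
value. -/
theorem exists_smooth_energy_eq [hp : Fact (1 < p)] (hd : 1 ≤ d) {U Q : Set (Space d)}
    (hU : IsOpen U) (hne : U.Nonempty) (hUQ : U ⊆ Q)
    {V : Space d → Space d}
    (hV : MemLp V (ENNReal.ofReal p) (volume.restrict Q)) {E : ℝ≥0∞} (hE : E ≠ ⊤)
    (hVE : ∫⁻ x in Q, ‖V x‖ₑ ^ p ≤ E) {δ : ℝ} (hδ : 0 < δ) :
    ∃ w : Space d → ℝ, ContDiff ℝ ∞ w ∧ HasCompactSupport w ∧ tsupport w ⊆ U ∧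
      eLpNorm w (ENNReal.ofReal p) volume ≤ ENNReal.ofReal δ ∧
      ∫⁻ x in Q, ‖V x + gradient w x‖ₑ ^ p = E := by
  have h0 : 0 < p := zero_lt_one.trans hp.out
  set q := ENNReal.ofReal p with hq
  have hq0 : q ≠ 0 := by simpa [hq] using h0
  set e := E.toReal ^ p⁻¹ with he
  have he0 : 0 ≤ e := by positivity
  have hep : ENNReal.ofReal (e ^ p) = E := by
    rw [he, ← Real.rpow_mul ENNReal.toReal_nonneg, inv_mul_cancel₀ h0.ne', Real.rpow_one,
      ENNReal.ofReal_toReal hE]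
  set v := ‖hV.toLp V‖ with hv
  have hv0 : 0 ≤ v := norm_nonneg _
  -- The amplitude will be at most `R = (e + v) / a`, so this ratio bounds the norm of the
  -- perturbation by `δ (e + v) / (e + v + 1) ≤ δ`.
  obtain ⟨w, hw, hwc, hws, hg0, hle⟩ := exists_smooth_eLpNorm_le hd hU hne hq0
    ENNReal.ofReal_ne_top (show 0 < δ / (e + v + 1) by positivity)
  have hgQ : MemLp (gradient w) q (volume.restrict Q) := memLp_gradient hw hwc _ _
  have hgnorm : eLpNorm (gradient w) q (volume.restrict Q) = eLpNorm (gradient w) q volume :=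
    eLpNorm_restrict_eq_of_support_subset
      ((subset_tsupport _).trans ((tsupport_gradient_subset w).trans (hws.trans hUQ)))
  have hgt : eLpNorm (gradient w) q volume ≠ ⊤ := (memLp_gradient hw hwc q volume).2.ne
  set a := ‖hgQ.toLp _‖ with ha
  have haE : ENNReal.ofReal a = eLpNorm (gradient w) q volume := by
    rw [ha, Lp.norm_toLp, hgnorm, ENNReal.ofReal_toReal hgt]
  have ha0 : 0 < a := by
    rw [← ENNReal.ofReal_pos, haE]; exact pos_iff_ne_zero.2 hg0
  set R := (e + v) / a with hR
  have hR0 : 0 ≤ R := by positivity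
  have hcont : Continuous fun s : ℝ => ‖hV.toLp V + s • hgQ.toLp _‖ := by fun_prop
  have hlow : ‖hV.toLp V + (0 : ℝ) • hgQ.toLp _‖ ≤ e := by
    rw [zero_smul, add_zero, he, Real.le_rpow_inv_iff_of_pos (norm_nonneg _)
      ENNReal.toReal_nonneg h0, ← ENNReal.ofReal_le_iff_le_toReal hE,
      norm_rpow_eq_toReal_lintegral]
    refine le_trans (le_of_eq ?_) hVE
    exact lintegral_congr_ae (hV.coeFn_toLp.mono fun x hx => by simp only [hx])
  have hhigh : e ≤ ‖hV.toLp V + R • hgQ.toLp _‖ := by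
    have h1 : ‖R • hgQ.toLp _‖ = e + v := by
      rw [norm_smul, Real.norm_of_nonneg hR0, ← ha, hR, div_mul_cancel₀ _ ha0.ne']
    have h2 := norm_sub_le (hV.toLp V + R • hgQ.toLp _) (hV.toLp V)
    rw [add_sub_cancel_left, h1] at h2
    linarith
  -- The norm of `V + s ∇w` is continuous in `s`, at most `e` at `0`, and at least `e` at `R` by the
  -- reverse triangle inequality; an intermediate amplitude gives exactly `e`.
  obtain ⟨s, ⟨hs0, hsR⟩, hs⟩ := intermediate_value_Icc hR0 hcont.continuousOn ⟨hlow, hhigh⟩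
  have hgs : gradient (s • w) = s • gradient w := by
    funext x
    rw [Pi.smul_apply, gradient, gradient, fderiv_const_smul
      (hw.differentiable (by simp) x), map_smulₛₗ]
    simp
  refine ⟨s • w, contDiff_const.smul hw, hwc.smul_left, ?_, ?_, ?_⟩
  · exact (closure_mono (Function.support_const_smul_subset s w)).trans hws
  · rw [eLpNorm_const_smul, Real.enorm_eq_ofReal hs0]
    calc ENNReal.ofReal s * eLpNorm w q volume
        ≤ ENNReal.ofReal R * (ENNReal.ofReal (δ / (e + v + 1)) * ENNReal.ofReal a) := by
          rw [haE]; gcongr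
      _ = ENNReal.ofReal (R * (δ / (e + v + 1) * a)) := by
          rw [← ENNReal.ofReal_mul (by positivity), ← ENNReal.ofReal_mul hR0]
      _ ≤ ENNReal.ofReal δ := by
          refine ENNReal.ofReal_le_ofReal ?_
          have : R * (δ / (e + v + 1) * a) = δ * ((e + v) / (e + v + 1)) := by
            rw [hR]; field_simp
          rw [this]
          refine mul_le_of_le_one_right hδ.le ?_
          rw [div_le_one (by positivity)]; linarith
  · rw [← hep]
    simp only at hs
    rw [← hs, norm_rpow_eq_toReal_lintegral]
    refine lintegral_congr_ae ?_
    filter_upwards [Lp.coeFn_add (hV.toLp V) (s • hgQ.toLp _), Lp.coeFn_smul s (hgQ.toLp _),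
      hV.coeFn_toLp, hgQ.coeFn_toLp] with x h1 h2 h3 h4
    rw [h1, Pi.add_apply, h2, Pi.smul_apply, h3, h4, hgs, Pi.smul_apply]

/-- The perturbations live in the disjoint interiors of the cells, so each cell sees only its own
gradient and the prescriptions do not interact. The `+ 1` in the share of `δ` avoids dividing by
zero when there are no cells. -/
theorem exists_energy_eq_on_cells [hp : Fact (1 < p)] (hd : 1 ≤ d) (hΩ : IsOpen Ω)
    (hΩb : Bornology.IsBounded Ω) (φ : LpSpace Ω p) (hφ : MemSobolev p Ω φ) {ι : Type*}
    [Fintype ι] {ρ : ℝ} {Q : ι → Set (Space d)} (hQ : IsFinePartition Ω ρ Q) (E : ι → ℝ≥0∞)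
    (hE : ∀ i, E i ≠ ⊤) (hφE : ∀ i, dirichletMeasure Ω p φ (Q i) ≤ E i) {δ : ℝ} (hδ : 0 < δ) :
    ∃ φ' : LpSpace Ω p, MemSobolev p Ω φ' ∧ ‖φ' - φ‖ ≤ δ ∧
      ∀ i, dirichletMeasure Ω p φ' (Q i) = E i := by
  have hQΩ : ∀ i, Q i ⊆ Ω := fun i => hQ.iUnion ▸ subset_iUnion Q i
  set V := weakGradient p Ω φ with hV
  have hVp := (weakGradient_spec hφ).1
  have hdens : ∀ (f : Space d → ℝ≥0∞) i,
      (volume.restrict Ω).withDensity f (Q i) = ∫⁻ x in Q i, f x := fun f i => by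
    rw [withDensity_apply _ (hQ.measurable i), Measure.restrict_restrict (hQ.measurable i),
      inter_eq_self_of_subset_left (hQΩ i)]
  have hw : ∀ i, ∃ w : Space d → ℝ, ContDiff ℝ ∞ w ∧ HasCompactSupport w ∧
      tsupport w ⊆ interior (Q i) ∧ eLpNorm w (ENNReal.ofReal p) volume ≤
        ENNReal.ofReal (δ / (Fintype.card ι + 1)) ∧
      ∫⁻ x in Q i, ‖V x + gradient w x‖ₑ ^ p = E i := fun i =>
    exists_smooth_energy_eq hd isOpen_interior (hQ.interior i) interior_subset
      (hVp.mono_measure (Measure.restrict_mono (hQΩ i) le_rfl)) (hE i)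
      (by rw [← hdens]; exact hφE i) (by positivity)
  choose w hw hwc hws hwδ hwE using hw
  have hsum : ContDiff ℝ ∞ fun x => ∑ i, w i x := ContDiff.sum fun i _ => hw i
  have hsumc : HasCompactSupport fun x => ∑ i, w i x := by
    refine HasCompactSupport.intro (isCompact_iUnion fun i => hwc i) (fun x hx => ?_)
    refine Finset.sum_eq_zero fun i _ => ?_
    exact image_eq_zero_of_notMem_tsupport fun h => hx (mem_iUnion.2 ⟨i, h⟩)
  obtain ⟨φ', -, h1, h2, h3⟩ := exists_add_smooth hΩ hΩb φ hφ hsum hsumc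
  refine ⟨φ', h1, ?_, fun i => ?_⟩
  · rw [h2]
    refine ENNReal.toReal_le_of_le_ofReal hδ.le ?_
    have e1 : (fun x => ∑ i, w i x) = ∑ i, w i := by ext; simp
    rw [e1]
    calc eLpNorm (∑ i, w i) (ENNReal.ofReal p) (volume.restrict Ω)
        ≤ ∑ i, eLpNorm (w i) (ENNReal.ofReal p) (volume.restrict Ω) :=
          eLpNorm_sum_le (fun i _ => (hw i).continuous.aestronglyMeasurable) Fact.out
      _ ≤ ∑ _i : ι, ENNReal.ofReal (δ / (Fintype.card ι + 1)) :=
          Finset.sum_le_sum fun i _ =>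
            (eLpNorm_mono_measure _ Measure.restrict_le_self).trans (hwδ i)
      _ ≤ ENNReal.ofReal δ := by
          rw [Finset.sum_const, Finset.card_univ, nsmul_eq_mul, ← ENNReal.ofReal_natCast,
            ← ENNReal.ofReal_mul (by positivity)]
          refine ENNReal.ofReal_le_ofReal ?_
          rw [mul_div_assoc', div_le_iff₀ (by positivity)]
          nlinarith
  · rw [h3, hdens, ← hwE i]
    refine setLIntegral_congr_fun (hQ.measurable i) fun x hx => ?_
    have hgr : gradient (fun x => ∑ i, w i x) x = gradient (w i) x := by
      have hz : ∀ j, j ≠ i → fderiv ℝ (w j) x = 0 := fun j hj => by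
        refine image_eq_zero_of_notMem_tsupport fun h => ?_
        exact disjoint_left.1 (hQ.disjoint hj)
          (interior_subset (hws j (tsupport_fderiv_subset ℝ h))) hx
      rw [gradient, gradient, fderiv_fun_sum fun j _ => (hw j).differentiable (by simp) x,
        Finset.sum_eq_single i (fun j _ hj => hz j hj) (by simp)]
    simp only [hgr, hV]

end Bump

/-! ### The Dirichlet energy is admissible -/

section Admissible

variable {d : ℕ} {Ω : Set (Space d)} {p : ℝ}

/-- The gradient vanishes a.e. on `A`, so after a perturbation supported in `U` all the energy in
`A` sits in `U`. The boundary of `U` lies in `A \ U`, which therefore carries none. -/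
theorem dirichletEnergy_nondegenerate [hp : Fact (1 < p)] (hd : 1 ≤ d) (hΩ : IsOpen Ω)
    (hΩb : Bornology.IsBounded Ω) (φ : LpSpace Ω p) (hφ : MemSobolev p Ω φ)
    {A : Set (Space d)} (hA : IsOpen A) (hAΩ : A ⊆ Ω) (h0 : dirichletEnergy Ω p φ A = 0)
    {U : Set (Space d)} (hU : IsOpen U) (hne : U.Nonempty) (hUA : closure U ⊆ A) {ε : ℝ}
    (hε : 0 < ε) :
    ∃ φ' : LpSpace Ω p, MemSobolev p Ω φ' ∧ (∀ᵐ x ∂(volume.restrict (Ω \ U)), φ' x = φ x) ∧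
      ‖φ' - φ‖ ≤ ε ∧ dirichletMeasure Ω p φ' (frontier U) = 0 ∧
      dirichletMeasure Ω p φ' A = ENNReal.ofReal (ε / 2) ∧
      dirichletMeasure Ω p φ' U = ENNReal.ofReal (ε / 2) := by
  have hUA' : U ⊆ A := subset_closure.trans hUA
  have hdens : ∀ (f : Space d → ℝ≥0∞) {B : Set (Space d)}, MeasurableSet B → B ⊆ Ω →
      (volume.restrict Ω).withDensity f B = ∫⁻ x in B, f x := fun f B hB hBΩ => by
    rw [withDensity_apply _ hB, Measure.restrict_restrict hB, inter_eq_self_of_subset_left hBΩ]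
  set V := weakGradient p Ω φ with hV
  have hVA : ∫⁻ x in A, ‖V x‖ₑ ^ p = 0 := by
    rw [← hdens _ hA.measurableSet hAΩ, ← h0,
      dirichletEnergy_eq_dirichletMeasure hΩb hφ hA hAΩ, dirichletMeasure]
  obtain ⟨w, hw, hwc, hws, hwδ, hwE⟩ := exists_smooth_energy_eq (p := p) hd hU hne
    subset_rfl ((weakGradient_spec hφ).1.mono_measure
      (Measure.restrict_mono (hUA'.trans hAΩ) le_rfl))
    (E := ENNReal.ofReal (ε / 2)) ENNReal.ofReal_ne_top
    (by
      refine le_trans ?_ zero_le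
      rw [← hVA]
      exact lintegral_mono_set hUA') hε
  obtain ⟨φ', hae, h1, h2, h3⟩ := exists_add_smooth hΩ hΩb φ hφ hw hwc
  have hUeq : dirichletMeasure Ω p φ' U = ENNReal.ofReal (ε / 2) := by
    rw [h3, hdens _ hU.measurableSet (hUA'.trans hAΩ), hwE]
  have hdiff : dirichletMeasure Ω p φ' (A \ U) = 0 := by
    rw [h3, hdens _ (hA.measurableSet.diff hU.measurableSet) (sdiff_subset.trans hAΩ)]
    have e : ∫⁻ x in A \ U, ‖V x + gradient w x‖ₑ ^ p = ∫⁻ x in A \ U, ‖V x‖ₑ ^ p :=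
      setLIntegral_congr_fun (hA.measurableSet.diff hU.measurableSet) fun x hx => by
        simp only [gradient_eq_zero_of_notMem fun h => hx.2 (hws h), add_zero]
    rw [e]
    exact le_antisymm ((lintegral_mono_set sdiff_subset).trans hVA.le) zero_le
  refine ⟨φ', h1, ?_, ?_, ?_, ?_, hUeq⟩
  · rw [ae_restrict_iff' (hΩ.measurableSet.diff hU.measurableSet)]
    rw [Filter.EventuallyEq, ae_restrict_iff' hΩ.measurableSet] at hae
    filter_upwards [hae] with x hx hxU
    rw [hx hxU.1, Pi.add_apply,
      image_eq_zero_of_notMem_tsupport fun h => hxU.2 (hws h), add_zero]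
  · rw [h2]
    exact ENNReal.toReal_le_of_le_ofReal hε.le
      ((eLpNorm_mono_measure _ Measure.restrict_le_self).trans hwδ)
  · refine measure_mono_null (fun x hx => ?_) hdiff
    rw [frontier, hU.interior_eq] at hx
    exact ⟨hUA hx.1, hx.2⟩
  · rw [← measure_sdiff_add_inter A hU.measurableSet, hdiff, zero_add,
      inter_eq_self_of_subset_right hUA', hUeq]

/-- Energy can only be raised, so any finite measure above that of `φ` can be matched on the cells
of finer and finer partitions. In (Ad4) the condition `f ≥ 1` supplies this domination. -/
theorem exists_energy_sequence [hp : Fact (1 < p)] (hd : 1 ≤ d) (hΩ : IsOpen Ω)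
    (hΩb : Bornology.IsBounded Ω) (φ : LpSpace Ω p) (hφ : MemSobolev p Ω φ) (ν : PosMeasure Ω)
    (hν : dirichletMeasure Ω p φ ≤ ν.toMeasure) :
    ∃ φs : ℕ → LpSpace Ω p, (∀ n, MemSobolev p Ω (φs n)) ∧ Tendsto φs atTop (𝓝 φ) ∧
      Tendsto (fun n => dirichletPosMeasure hΩ (φs n)) atTop (𝓝 ν) := by
  have := ν.isFinite
  have hr : ∀ n : ℕ, (0 : ℝ) < 1 / ((n : ℝ) + 1) := fun n => Nat.one_div_pos_of_nat
  have key : ∀ n : ℕ, ∃ φ' : LpSpace Ω p, MemSobolev p Ω φ' ∧ ‖φ' - φ‖ ≤ 1 / ((n : ℝ) + 1) ∧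
      ∃ (ι : Type) (_ : Fintype ι) (Q : ι → Set (Space d)),
        IsFinePartition Ω (1 / ((n : ℝ) + 1)) Q ∧
        ∀ i, dirichletMeasure Ω p φ' (Q i) = ν.toMeasure (Q i) := fun n => by
    obtain ⟨ι, hι, Q, hQ⟩ := exists_isFinePartition hΩ hΩb (hr n)
    obtain ⟨φ', h1, h2, h3⟩ := exists_energy_eq_on_cells hd hΩ hΩb φ hφ hQ
      (fun i => ν.toMeasure (Q i)) (fun i => measure_ne_top _ _) (fun i => hν _) (hr n)
    exact ⟨φ', h1, h2, ι, hι, Q, hQ, h3⟩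
  choose φs h1 h2 h3 using key
  refine ⟨φs, h1, ?_, tendsto_posMeasure h3⟩
  rw [tendsto_iff_norm_sub_tendsto_zero]
  exact squeeze_zero (fun _ => norm_nonneg _) h2 tendsto_one_div_add_atTop_nhds_zero_nat

theorem isAdmissible_dirichletEnergy [hp : Fact (1 < p)] (hd : 1 ≤ d) (hΩ : IsOpen Ω)
    (hΩb : Bornology.IsBounded Ω) : IsAdmissible Ω p (dirichletEnergy Ω p) where
  lsc _ hA hAΩ := lowerSemicontinuous_dirichletEnergy hΩb hA hAΩ
  measure φ hφ := ⟨_, represents_dirichletPosMeasure hΩ hΩb (dirichletEnergy_lt_top_iff.1 hφ)⟩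
  nondegenerate φ hφ A hA hAΩ h0 U hU hne _ hUA ε hε := by
    obtain ⟨φ', h1, h2, h3, h4, h5, h6⟩ := dirichletEnergy_nondegenerate hd hΩ hΩb φ
      (dirichletEnergy_lt_top_iff.1 hφ) hA hAΩ h0 hU hne hUA hε
    refine ⟨φ', dirichletPosMeasure hΩ φ', dirichletEnergy_lt_top_iff.2 h1,
      represents_dirichletPosMeasure hΩ hΩb h1, h2, h3, h4, ?_, h5.trans h6.symm, ?_⟩
    · refine (ENNReal.ofReal_pos.2 (half_pos hε)).trans_eq h5.symm
    · exact h6.trans_lt ((ENNReal.ofReal_lt_ofReal_iff hε).2 (half_lt_self hε))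
  purelyLsc φ hφ ν hν f hf hf1 := by
    have hφ' := dirichletEnergy_lt_top_iff.1 hφ
    obtain rfl := hν.unique hΩ (represents_dirichletPosMeasure hΩ hΩb hφ')
    obtain ⟨φs, h1, h2, h3⟩ := exists_energy_sequence hd hΩ hΩb φ hφ'
      ((dirichletPosMeasure hΩ φ).mulDensity f hf) (by
        conv_lhs => rw [← withDensity_one (μ := dirichletMeasure Ω p φ)]
        exact withDensity_mono (hf1.mono fun x hx => ENNReal.one_le_ofReal.2 hx))
    exact ⟨φs, _, fun n => ⟨dirichletEnergy_lt_top_iff.2 (h1 n),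
      represents_dirichletPosMeasure hΩ hΩb (h1 n)⟩, h2, h3⟩

end Admissible

/-! ### The relaxed functional on pairs of measures -/

section RelaxedMeasure

variable {X : Type*} [MeasurableSpace X]

theorem integrable_of_measurable_of_abs_le {μ : Measure X} [IsFiniteMeasure μ] {f : X → ℝ}
    (hf : Measurable f) {C : ℝ} (hC : ∀ x, |f x| ≤ C) : Integrable f μ :=
  Integrable.of_bound hf.aestronglyMeasurable C (ae_of_all _ hC)

theorem integrable_mul_rnDeriv (μ ν : Measure X) [IsFiniteMeasure μ] [IsFiniteMeasure ν]
    {f : X → ℝ} (hf : Measurable f) {C : ℝ} (hC : ∀ x, |f x| ≤ C) :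
    Integrable (fun x => f x * (μ.rnDeriv ν x).toReal) ν :=
  Measure.integrable_toReal_rnDeriv.bdd_mul (c := C) hf.aestronglyMeasurable (ae_of_all _ hC)

/-- Integration against the Radon–Nikodym decomposition. -/
theorem setIntegral_eq_rnDeriv_add_singularPart (μ ν : Measure X) [IsFiniteMeasure μ]
    [IsFiniteMeasure ν] {f : X → ℝ} (hf : Measurable f) {C : ℝ} (hC : ∀ x, |f x| ≤ C)
    {Q : Set X} (hQ : MeasurableSet Q) :
    ∫ x in Q, f x ∂μ = ∫ x in Q, f x * (μ.rnDeriv ν x).toReal ∂ν +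
      ∫ x in Q, f x ∂(μ.singularPart ν) := by
  have hint : Integrable f μ := integrable_of_measurable_of_abs_le hf hC
  conv_lhs => rw [μ.haveLebesgueDecomposition_add ν]
  rw [Measure.restrict_add, integral_add_measure, add_comm]
  · congr 1
    rw [setIntegral_withDensity_eq_setIntegral_toReal_smul (Measure.measurable_rnDeriv μ ν)
      (ae_restrict_of_ae (Measure.rnDeriv_lt_top μ ν)) _ hQ]
    simp only [smul_eq_mul, mul_comm]
  · exact (hint.mono_measure (Measure.singularPart_le μ ν)).integrableOn
  · exact (hint.mono_measure (Measure.withDensity_rnDeriv_le μ ν)).integrableOn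

theorem ofReal_integral_le_lintegral {μ : Measure X} {f : X → ℝ} (hf : Integrable f μ) :
    ENNReal.ofReal (∫ x, f x ∂μ) ≤ ∫⁻ x, ENNReal.ofReal (f x) ∂μ := by
  have h1 : ∫ x, f x ∂μ ≤ ∫ x, max (f x) 0 ∂μ :=
    integral_mono hf hf.pos_part fun x => le_max_left _ _
  refine (ENNReal.ofReal_le_ofReal h1).trans ?_
  rw [ofReal_integral_eq_lintegral_ofReal hf.pos_part (ae_of_all _ fun x => le_max_right _ _)]
  exact lintegral_mono fun x => by simp

/-- `∫_Q ψ^{cs}(u) dν + Θ^{cs} μ^⊥(Q)`, where `μ = u ν + μ^⊥`. -/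
def relaxedMeasure (ψ : ℝ → ℝ) (ν μ : Measure X) (Q : Set X) : ℝ≥0∞ :=
  ∫⁻ y in Q, ENNReal.ofReal (csEnvelope ψ (μ.rnDeriv ν y).toReal) ∂ν +
    ENNReal.ofReal (csSlope ψ) * μ.singularPart ν Q

/-- Along the decomposition of `μ`, the absolutely continuous part is bounded by `α + β u ≤
ψ^{cs}(u)` and the singular part by `β ≤ Θ`. Variable coefficients are allowed because the cutoffs
in the lower bound make the slope depend on the point. -/
theorem ofReal_integral_add_le_relaxedMeasure {ψ : ℝ → ℝ} (μ ν : Measure X)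
    [IsFiniteMeasure μ] [IsFiniteMeasure ν] {α β : X → ℝ} (hα : Measurable α)
    (hβ : Measurable β) {C : ℝ} (hαC : ∀ x, |α x| ≤ C) (hβC : ∀ x, |β x| ≤ C)
    (h : ∀ x t, 0 ≤ t → α x + β x * t ≤ csEnvelope ψ t) (hΘ : ∀ x, β x ≤ csSlope ψ)
    {Q : Set X} (hQ : MeasurableSet Q) :
    ENNReal.ofReal (∫ x in Q, α x ∂ν + ∫ x in Q, β x ∂μ) ≤ relaxedMeasure ψ ν μ Q := by
  have h1 : IntegrableOn α Q ν := (integrable_of_measurable_of_abs_le hα hαC).integrableOn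
  have h2 : IntegrableOn (fun x => β x * (μ.rnDeriv ν x).toReal) Q ν :=
    (integrable_mul_rnDeriv μ ν hβ hβC).integrableOn
  rw [setIntegral_eq_rnDeriv_add_singularPart μ ν hβ hβC hQ, ← add_assoc, ← integral_add h1 h2]
  refine ENNReal.ofReal_add_le.trans (add_le_add ?_ ?_)
  · refine (ofReal_integral_le_lintegral (h1.add h2)).trans (lintegral_mono fun x => ?_)
    exact ENNReal.ofReal_le_ofReal (h x _ ENNReal.toReal_nonneg)
  · have h3 : IntegrableOn β Q (μ.singularPart ν) :=
      (integrable_of_measurable_of_abs_le hβ hβC).integrableOn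
    refine (ofReal_integral_le_lintegral h3).trans ?_
    refine (lintegral_mono fun x => ENNReal.ofReal_le_ofReal (hΘ x)).trans_eq ?_
    rw [setLIntegral_const]

theorem ofReal_affine_le_relaxedMeasure {ψ : ℝ → ℝ} (hψ : IsRelaxable ψ) (μ ν : Measure X)
    [IsFiniteMeasure μ] [IsFiniteMeasure ν] {q : ℝ × ℝ} (hq : q ∈ affineMinorants ψ)
    {Q : Set X} (hQ : MeasurableSet Q) :
    ENNReal.ofReal (q.1 * ν.real Q + q.2 * μ.real Q) ≤ relaxedMeasure ψ ν μ Q := by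
  have := ofReal_integral_add_le_relaxedMeasure (ψ := ψ) μ ν (α := fun _ => q.1)
    (β := fun _ => q.2) measurable_const measurable_const (C := max |q.1| |q.2|)
    (fun _ => le_max_left _ _) (fun _ => le_max_right _ _)
    (fun _ t ht => affine_le_csEnvelope hq ht) (fun _ => hψ.slope_le hq) hQ
  simpa [mul_comm] using this

/-- The index of a maximal affine function among the first `N + 1` ones. -/
def argmaxAffine (q : ℕ → ℝ × ℝ) : ℕ → ℝ → ℕ
  | 0, _ => 0
  | N + 1, t => if (q (argmaxAffine q N t)).1 + (q (argmaxAffine q N t)).2 * t <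
      (q (N + 1)).1 + (q (N + 1)).2 * t then N + 1 else argmaxAffine q N t

theorem argmaxAffine_le (q : ℕ → ℝ × ℝ) (N : ℕ) (t : ℝ) : argmaxAffine q N t ≤ N := by
  induction N with
  | zero => exact le_rfl
  | succ N ih =>
    rw [argmaxAffine]
    split_ifs
    · exact le_rfl
    · exact ih.trans N.le_succ

theorem measurable_argmaxAffine (q : ℕ → ℝ × ℝ) (N : ℕ) : Measurable (argmaxAffine q N) := by
  induction N with
  | zero => exact measurable_const
  | succ N ih =>
    have h : ∀ f : ℕ → ℝ, Measurable fun t => f (argmaxAffine q N t) := fun f =>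
      (measurable_of_countable f).comp ih
    exact Measurable.ite (measurableSet_lt
      ((h fun n => (q n).1).add ((h fun n => (q n).2).mul measurable_id)) (by fun_prop))
      measurable_const ih

/-- The maximum of the first `N + 1` affine functions. -/
def maxAffine (q : ℕ → ℝ × ℝ) (N : ℕ) (t : ℝ) : ℝ :=
  (q (argmaxAffine q N t)).1 + (q (argmaxAffine q N t)).2 * t

theorem maxAffine_mono (q : ℕ → ℝ × ℝ) (t : ℝ) : Monotone fun N => maxAffine q N t := by
  refine monotone_nat_of_le_succ fun N => ?_
  simp only [maxAffine, argmaxAffine]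
  split_ifs with h
  · exact h.le
  · exact le_rfl

theorem le_maxAffine (q : ℕ → ℝ × ℝ) (N : ℕ) (t : ℝ) :
    (q N).1 + (q N).2 * t ≤ maxAffine q N t := by
  rcases N with _ | N
  · exact le_rfl
  · simp only [maxAffine, argmaxAffine]
    split_ifs with h
    · exact le_rfl
    · exact not_lt.1 h

theorem measurable_maxAffine (q : ℕ → ℝ × ℝ) (N : ℕ) : Measurable (maxAffine q N) := by
  have h : ∀ f : ℕ → ℝ, Measurable fun t => f (argmaxAffine q N t) := fun f =>
    (measurable_of_countable f).comp (measurable_argmaxAffine q N)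
  exact (h fun n => (q n).1).add ((h fun n => (q n).2).mul measurable_id)

theorem integral_comp_nat {μ : Measure X} [IsFiniteMeasure μ] {f : X → ℕ} (hf : Measurable f)
    {N : ℕ} (hN : ∀ x, f x ≤ N) (g : ℕ → ℝ) :
    ∫ x, g (f x) ∂μ = ∑ i : Fin (N + 1), g i * μ.real (f ⁻¹' {(i : ℕ)}) := by
  have hm : ∀ i : ℕ, MeasurableSet (f ⁻¹' {i}) := fun i => hf (measurableSet_singleton i)
  have h1 : ∀ x, g (f x) = ∑ i : Fin (N + 1), (f ⁻¹' {(i : ℕ)}).indicator (fun _ => g i) x := by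
    intro x
    rw [Finset.sum_eq_single (⟨f x, Nat.lt_succ_of_le (hN x)⟩ : Fin (N + 1))]
    · rw [indicator_of_mem (by simp)]
    · intro j _ hj
      refine indicator_of_notMem (fun h => hj (Fin.ext ?_)) _
      exact (mem_singleton_iff.1 h).symm
    · simp
  simp_rw [h1]
  rw [integral_finsetSum _ fun (i : Fin (N + 1)) _ =>
    (integrable_const (g i)).indicator (hm i)]
  refine Finset.sum_congr rfl fun i _ => ?_
  rw [integral_indicator_const _ (hm i), smul_eq_mul, mul_comm]

/-- The relaxed functional is approximated from below by finitely many affine minorants on a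
measurable partition. -/
theorem IsRelaxable.exists_partition_lt {ψ : ℝ → ℝ} (hψ : IsRelaxable ψ) (μ ν : Measure X)
    [IsFiniteMeasure μ] [IsFiniteMeasure ν] {y : ℝ≥0∞} (hy : y < relaxedMeasure ψ ν μ univ) :
    ∃ (N : ℕ) (q : Fin (N + 1) → ℝ × ℝ) (B : Fin (N + 1) → Set X),
      (∀ i, q i ∈ affineMinorants ψ) ∧ (∀ i, MeasurableSet (B i)) ∧
      Pairwise (Function.onFun Disjoint B) ∧
      y < ENNReal.ofReal (∑ i, ((q i).1 * ν.real (B i) + (q i).2 * μ.real (B i))) := by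
  obtain ⟨q, hq0, hqm, hq⟩ := hψ.exists_seq_affine
  set u : X → ℝ := fun x => (μ.rnDeriv ν x).toReal with hu
  have hum : Measurable u := (Measure.measurable_rnDeriv μ ν).ennreal_toReal
  have hu0 : ∀ x, 0 ≤ u x := fun x => ENNReal.toReal_nonneg
  have hsup : ∀ x, ENNReal.ofReal (csEnvelope ψ (u x)) =
      ⨆ N, ENNReal.ofReal (maxAffine q N (u x)) := fun x => by
    refine le_antisymm ?_ (iSup_le fun N => ENNReal.ofReal_le_ofReal ?_)
    · refine le_of_forall_lt fun z hz => ?_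
      have hz' : z.toReal < csEnvelope ψ (u x) :=
        (ENNReal.lt_ofReal_iff_toReal_lt (hz.trans ENNReal.ofReal_lt_top).ne).1 hz
      obtain ⟨_, ⟨N, rfl⟩, h1⟩ := (lt_isLUB_iff (hq _ (hu0 x))).1 hz'
      refine lt_of_lt_of_le ?_ (le_iSup _ N)
      rw [ENNReal.lt_ofReal_iff_toReal_lt (hz.trans ENNReal.ofReal_lt_top).ne]
      exact h1.trans_le (le_maxAffine q N _)
    · exact affine_le_csEnvelope (hqm _) (hu0 x)
  have hlim : ∫⁻ x, ENNReal.ofReal (csEnvelope ψ (u x)) ∂ν =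
      ⨆ N, ∫⁻ x, ENNReal.ofReal (maxAffine q N (u x)) ∂ν := by
    simp_rw [hsup]
    exact lintegral_iSup
      (fun N => ((measurable_maxAffine q N).comp hum).ennreal_ofReal)
      (fun M N hMN x => ENNReal.ofReal_le_ofReal (maxAffine_mono q _ hMN))
  rw [relaxedMeasure, setLIntegral_univ, hlim, ENNReal.iSup_add] at hy
  obtain ⟨N, hN⟩ := lt_iSup_iff.1 hy
  have hsing := Measure.mutuallySingular_singularPart μ ν
  -- `Z` is `ν`-null and carries the singular part. Labelling it `0` selects the slope `Θ` there
  -- without changing integrals against `ν`; elsewhere the label is the index of a maximal line.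
  set Z := hsing.nullSetᶜ with hZ
  have hZm : MeasurableSet Z := hsing.measurableSet_nullSet.compl
  have hνZ : ∀ᵐ x ∂ν, x ∉ Z := measure_eq_zero_iff_ae_notMem.1 hsing.measure_compl_nullSet
  have hsZ : ∀ᵐ x ∂(μ.singularPart ν), x ∈ Z :=
    measure_eq_zero_iff_ae_notMem.1 hsing.measure_nullSet
  classical
  set f : X → ℕ := fun x => if x ∈ Z then 0 else argmaxAffine q N (u x) with hf
  have hfm : Measurable f :=
    Measurable.ite hZm measurable_const ((measurable_argmaxAffine q N).comp hum)
  have hfN : ∀ x, f x ≤ N := fun x => by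
    simp only [hf]; split_ifs
    · exact N.zero_le
    · exact argmaxAffine_le q N _
  have hgm : ∀ g : ℕ → ℝ, Measurable fun x => g (f x) := fun g =>
    (measurable_of_countable g).comp hfm
  have hgb : ∀ g : ℕ → ℝ, ∀ x, |g (f x)| ≤ ∑ i ∈ Finset.range (N + 1), |g i| := fun g x =>
    Finset.single_le_sum (f := fun i => |g i|) (fun _ _ => abs_nonneg _)
      (Finset.mem_range.2 (Nat.lt_succ_of_le (hfN x)))
  refine ⟨N, fun i => q i, fun i => f ⁻¹' {(i : ℕ)}, fun i => hqm _,
    fun i => hfm (measurableSet_singleton _), ?_, ?_⟩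
  · intro i j hij
    refine disjoint_left.2 fun x hi hj => hij (Fin.ext ?_)
    exact (mem_singleton_iff.1 hi).symm.trans hj
  · rw [Finset.sum_add_distrib, ← integral_comp_nat hfm hfN (fun n => (q n).1),
      ← integral_comp_nat hfm hfN (fun n => (q n).2)]
    have hdec := setIntegral_eq_rnDeriv_add_singularPart μ ν (hgm fun n => (q n).2)
      (hgb fun n => (q n).2) MeasurableSet.univ
    simp only [setIntegral_univ] at hdec
    have i1 : Integrable (fun x => (q (f x)).1) ν :=
      integrable_of_measurable_of_abs_le (hgm fun n => (q n).1) (hgb fun n => (q n).1)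
    have i2 := integrable_mul_rnDeriv μ ν (hgm fun n => (q n).2) (hgb fun n => (q n).2)
    rw [hdec, ← add_assoc, ← integral_add i1 i2]
    have e1 : ∀ᵐ x ∂ν, (q (f x)).1 + (q (f x)).2 * (μ.rnDeriv ν x).toReal =
        maxAffine q N (u x) := hνZ.mono fun x hx => by
      simp only [hf, if_neg hx, maxAffine, hu]
    have e2 : ∀ᵐ x ∂(μ.singularPart ν), (q (f x)).2 = csSlope ψ := hsZ.mono fun x hx => by
      simp only [hf, if_pos hx, hq0]
    have hpos : ∀ x, 0 ≤ maxAffine q N (u x) := fun x => by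
      refine le_trans ?_ (maxAffine_mono q (u x) N.zero_le)
      refine le_trans ?_ (le_maxAffine q 0 (u x))
      simpa [hq0] using mul_nonneg hψ.csSlope_nonneg (hu0 x)
    have i3 : Integrable (fun x => maxAffine q N (u x)) ν := (i1.add i2).congr e1
    rw [integral_congr_ae e1, integral_congr_ae e2, integral_const, smul_eq_mul,
      ENNReal.ofReal_add (integral_nonneg hpos)
        (mul_nonneg measureReal_nonneg hψ.csSlope_nonneg),
      ofReal_integral_eq_lintegral_ofReal i3 (ae_of_all _ hpos),
      ENNReal.ofReal_mul measureReal_nonneg, ofReal_measureReal, mul_comm]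
    exact hN

end RelaxedMeasure

/-! ### Lower semicontinuity of the relaxed energy -/

section Lsc

variable {d : ℕ} {Ω : Set (Space d)} {p : ℝ}

/-- Compactly supported continuous functions as test functions. -/
def TestFun.ofCompactSupport (f : Space d → ℝ) (hf : Continuous f) (hc : HasCompactSupport f)
    (h0 : ∀ x, x ∉ Ω → f x = 0) : TestFun Ω :=
  ⟨⟨⟨f, hf⟩, hc.is_zero_at_infty⟩, h0⟩

/-- Inner regularity for `μ + ν` gives disjoint compact sets `K i ⊆ B i`. For small `δ` their
`δ`-thickenings `U i` remain disjoint, inside `Ω`, and of `μ`-mass close to that of `K i`. The set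
`A i` is the `δ / 2`-thickening, leaving room for a cutoff equal to `1` on `A i` and to `0` off `U
i`. -/
theorem exists_separating_testFun {ι : Type*} [Finite ι] (hΩ : IsOpen Ω)
    (hΩb : Bornology.IsBounded Ω) (μ ν : Measure (Space d)) [IsFiniteMeasure μ]
    [IsFiniteMeasure ν] {B : ι → Set (Space d)} (hB : ∀ i, MeasurableSet (B i))
    (hBΩ : ∀ i, B i ⊆ Ω) (hdisj : Pairwise (Function.onFun Disjoint B)) {η : ℝ} (hη : 0 < η) :
    ∃ (A U : ι → Set (Space d)) (ξ : ι → TestFun Ω), (∀ i, IsOpen (A i)) ∧ (∀ i, A i ⊆ Ω) ∧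
      (∀ i, A i ⊆ U i) ∧ Pairwise (Function.onFun Disjoint U) ∧
      (∀ i x, 0 ≤ (ξ i).1 x) ∧ (∀ i x, (ξ i).1 x ≤ 1) ∧ (∀ i, ∀ x ∈ A i, (ξ i).1 x = 1) ∧
      (∀ i, ∀ x ∉ U i, (ξ i).1 x = 0) ∧ (∀ i, ν.real (B i) ≤ ν.real (A i) + η) ∧
      ∀ i, |∫ x, (ξ i).1 x ∂μ - μ.real (B i)| ≤ η := by
  have hK : ∀ i, ∃ K ⊆ B i, IsCompact K ∧ (ν + μ) (B i \ K) < ENNReal.ofReal η := fun i =>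
    (hB i).exists_isCompact_sdiff_lt (measure_ne_top _ _) (ENNReal.ofReal_pos.2 hη).ne'
  choose K hKB hKc hKη using hK
  have hpos : ∀ᶠ δ : ℝ in 𝓝[>] 0, 0 < δ := self_mem_nhdsWithin
  have ev : ∀ {P : ℝ → Prop}, (∃ δ, 0 < δ ∧ P δ) → (∀ a b, a ≤ b → P b → P a) →
      ∀ᶠ δ : ℝ in 𝓝[>] 0, P δ := by
    rintro P ⟨δ, hδ, hP⟩ hmono
    filter_upwards [nhdsWithin_le_nhds (gt_mem_nhds hδ)] with r hr
    exact hmono _ _ (le_of_lt hr) hP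
  have h1 : ∀ᶠ δ : ℝ in 𝓝[>] 0, ∀ i j, i ≠ j →
      Disjoint (Metric.thickening δ (K i)) (Metric.thickening δ (K j)) := by
    refine eventually_all.2 fun i => eventually_all.2 fun j => ?_
    by_cases hij : i = j
    · exact Eventually.of_forall fun _ h => absurd hij h
    · refine ev ?_ fun a b hab h hne => (h hne).mono (Metric.thickening_mono hab _)
        (Metric.thickening_mono hab _)
      obtain ⟨δ, hδ, h⟩ := ((hdisj hij).mono (hKB i) (hKB j)).exists_thickenings (hKc i)
        (hKc j).isClosed
      exact ⟨δ, hδ, fun _ => h⟩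
  have h2 : ∀ᶠ δ : ℝ in 𝓝[>] 0, ∀ i, Metric.thickening δ (K i) ⊆ Ω :=
    eventually_all.2 fun i => ev
      ((hKc i).exists_thickening_subset_open hΩ ((hKB i).trans (hBΩ i)))
      fun a b hab h => (Metric.thickening_mono hab _).trans h
  have h3 : ∀ᶠ δ : ℝ in 𝓝[>] 0, ∀ i,
      μ (Metric.thickening δ (K i)) < μ (K i) + ENNReal.ofReal η := by
    refine eventually_all.2 fun i => ?_
    exact (tendsto_measure_thickening_of_isClosed ⟨1, one_pos, measure_ne_top _ _⟩
      (hKc i).isClosed).eventually (gt_mem_nhds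
        (ENNReal.lt_add_right (measure_ne_top _ _) (ENNReal.ofReal_pos.2 hη).ne'))
  obtain ⟨δ, ⟨⟨hδ1, hδ2⟩, hδ3⟩, hδ⟩ := (((h1.and h2).and h3).and hpos).exists
  have hδ2' : 0 < δ / 2 := half_pos hδ
  set A : ι → Set (Space d) := fun i => Metric.thickening (δ / 2) (K i) with hA
  set U : ι → Set (Space d) := fun i => Metric.thickening δ (K i) with hU
  have hAU : ∀ i, Metric.thickening (δ / 2) (A i) ⊆ U i := fun i => by
    have := Metric.thickening_thickening_subset (δ / 2) (δ / 2) (K i)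
    rwa [add_halves] at this
  have hKA : ∀ i, K i ⊆ A i := fun i => Metric.self_subset_thickening hδ2' _
  set f : ι → Space d → ℝ := fun i x => (thickenedIndicator hδ2' (A i) x : ℝ) with hf
  have hfc : ∀ i, Continuous (f i) := fun i =>
    NNReal.continuous_coe.comp (thickenedIndicator hδ2' (A i)).continuous
  have hf0 : ∀ i, ∀ x ∉ U i, f i x = 0 := fun i x hx => by
    simp only [hf, thickenedIndicator_zero hδ2' (A i) fun h => hx (hAU i h), NNReal.coe_zero]
  have hf1 : ∀ i, ∀ x ∈ A i, f i x = 1 := fun i x hx => by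
    simp only [hf, thickenedIndicator_one hδ2' (A i) hx, NNReal.coe_one]
  have hfn : ∀ i x, 0 ≤ f i x := fun i x => NNReal.coe_nonneg _
  have hfl : ∀ i x, f i x ≤ 1 := fun i x => by
    exact_mod_cast thickenedIndicator_le_one hδ2' (A i) x
  have hfs : ∀ i, HasCompactSupport (f i) := fun i => by
    refine HasCompactSupport.of_support_subset_isCompact (K := closure Ω)
      hΩb.isCompact_closure fun x hx => subset_closure (hδ2 i ?_)
    by_contra h
    exact hx (hf0 i x h)
  have hfΩ : ∀ i, ∀ x, x ∉ Ω → f i x = 0 := fun i x hx => hf0 i x fun h => hx (hδ2 i h)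
  have hsum : ∀ (κ : Measure (Space d)) [IsFiniteMeasure κ], κ ≤ ν + μ → ∀ i,
      κ.real (B i) ≤ κ.real (K i) + η := fun κ _ hle i => by
    have e := measureReal_sdiff_add_inter (μ := κ) (s := B i) (hKc i).measurableSet
    rw [inter_eq_self_of_subset_right (hKB i)] at e
    have : κ.real (B i \ K i) ≤ η :=
      ENNReal.toReal_le_of_le_ofReal hη.le ((hle _).trans (hKη i).le)
    linarith
  refine ⟨A, U, fun i => TestFun.ofCompactSupport (f i) (hfc i) (hfs i) (hfΩ i),
    fun i => Metric.isOpen_thickening,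
    fun i => (Metric.thickening_mono (half_le_self hδ.le) _).trans (hδ2 i),
    fun i => Metric.thickening_mono (half_le_self hδ.le) _, fun i j hij => hδ1 i j hij,
    hfn, hfl, hf1, hf0, fun i => ?_, fun i => ?_⟩
  · have h4 := hsum ν (Measure.le_add_right le_rfl) i
    have h5 : ν.real (K i) ≤ ν.real (A i) := measureReal_mono (hKA i)
    linarith
  · have h4 := hsum μ (Measure.le_add_left le_rfl) i
    have hint : Integrable (f i) μ := integrable_of_measurable_of_abs_le (hfc i).measurable
      (C := 1) fun x => by rw [abs_of_nonneg (hfn i x)]; exact hfl i x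
    have h5 : μ.real (K i) ≤ ∫ x, f i x ∂μ := by
      rw [← integral_indicator_one (hKc i).measurableSet]
      refine integral_mono ((integrable_const 1).indicator (hKc i).measurableSet) hint fun x => ?_
      by_cases hx : x ∈ K i
      · simp [indicator_of_mem hx, hf1 i x (hKA i hx)]
      · simpa [indicator_of_notMem hx] using hfn i x
    have hUm : MeasurableSet (U i) := Metric.isOpen_thickening.measurableSet
    have h6 : ∫ x, f i x ∂μ ≤ μ.real (U i) := by
      rw [← integral_indicator_one hUm]
      refine integral_mono hint ((integrable_const 1).indicator hUm) fun x => ?_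
      by_cases hx : x ∈ U i
      · simpa [indicator_of_mem hx] using hfl i x
      · simp [indicator_of_notMem hx, hf0 i x hx]
    have h7 : μ.real (U i) ≤ μ.real (K i) + η := by
      refine ENNReal.toReal_le_of_le_ofReal (by positivity) ?_
      rw [ENNReal.ofReal_add measureReal_nonneg hη.le, ofReal_measureReal]
      exact (hδ3 i).le
    have h8 : μ.real (K i) ≤ μ.real (B i) := measureReal_mono (hKB i)
    change |∫ x, f i x ∂μ - μ.real (B i)| ≤ η
    rw [abs_le]
    constructor <;> linarith

theorem relaxedEnergy_eq (ψ : ℝ → ℝ) {x : LpSpace Ω p × PosMeasure Ω}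
    (hx : MemSobolev p Ω x.1) : relaxedEnergy Ω p ψ x =
      relaxedMeasure ψ (dirichletMeasure Ω p x.1) x.2.toMeasure univ := by
  rw [relaxedEnergy, if_pos hx, relaxedMeasure, setLIntegral_univ]
  congr 2
  have h : ∀ κ : Measure (Space d), κ Ωᶜ = 0 → κ Ω = κ univ := fun κ hκ => by
    rw [← measure_inter_conull (s := univ) hκ, univ_inter]
  exact h _ ((Measure.singularPart_le _ _).absolutelyContinuous x.2.compl_null)

theorem continuous_integral_testFun (ζ : TestFun Ω) :
    Continuous fun μ : PosMeasure Ω => ∫ x, ζ.1 x ∂μ.toMeasure :=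
  (continuous_apply ζ).comp (continuous_induced_dom (t := Pi.topologicalSpace)
    (f := fun (μ : PosMeasure Ω) (ζ : TestFun Ω) => ∫ x, ζ.1 x ∂μ.toMeasure))

/-- A lower bound for the relaxed energy which is lower semicontinuous. -/
theorem IsRelaxable.ofReal_sum_le_relaxedEnergy [hp : Fact (1 < p)] {ψ : ℝ → ℝ}
    (hψ : IsRelaxable ψ) {ι : Type*} [Fintype ι] {q : ι → ℝ × ℝ}
    (hq : ∀ i, q i ∈ affineMinorants ψ) {A U : ι → Set (Space d)} {ξ : ι → TestFun Ω}
    (hA : ∀ i, IsOpen (A i)) (hAU : ∀ i, A i ⊆ U i)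
    (hU : Pairwise (Function.onFun Disjoint U)) (hξ0 : ∀ i x, 0 ≤ (ξ i).1 x)
    (hξ1 : ∀ i x, (ξ i).1 x ≤ 1) (hξA : ∀ i, ∀ x ∈ A i, (ξ i).1 x = 1)
    (hξU : ∀ i, ∀ x ∉ U i, (ξ i).1 x = 0) {x : LpSpace Ω p × PosMeasure Ω}
    (hx : MemSobolev p Ω x.1) :
    ENNReal.ofReal (∑ i, ((q i).1 * (dirichletMeasure Ω p x.1).real (A i) +
      (q i).2 * ∫ y, (ξ i).1 y ∂x.2.toMeasure)) ≤ relaxedEnergy Ω p ψ x := by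
  have := x.2.isFinite
  rw [relaxedEnergy_eq ψ hx]
  set ν := dirichletMeasure Ω p x.1
  set α : Space d → ℝ := fun y => ∑ i, (A i).indicator (fun _ => (q i).1) y with hα
  set β : Space d → ℝ := fun y => ∑ i, (q i).2 * (ξ i).1 y with hβ
  have hαm : Measurable α := Finset.measurable_fun_sum _ fun i _ =>
    measurable_const.indicator (hA i).measurableSet
  have hβm : Measurable β := Finset.measurable_fun_sum _ fun i _ =>
    ((ξ i).1.continuous.measurable).const_mul _
  set C := ∑ i, (|(q i).1| + |(q i).2|) with hC
  have hαC : ∀ y, |α y| ≤ C := fun y =>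
    (Finset.abs_sum_le_sum_abs _ _).trans (Finset.sum_le_sum fun i _ => by
      by_cases hy : y ∈ A i
      · simp [indicator_of_mem hy]
      · simp only [indicator_of_notMem hy, abs_zero]; positivity)
  have hβC : ∀ y, |β y| ≤ C := fun y =>
    (Finset.abs_sum_le_sum_abs _ _).trans (Finset.sum_le_sum fun i _ => by
      rw [abs_mul, abs_of_nonneg (hξ0 i y)]
      have := mul_le_of_le_one_right (abs_nonneg (q i).2) (hξ1 i y)
      have := abs_nonneg (q i).1
      linarith)
  have hsum : ∀ y, (α y = 0 ∧ β y = 0) ∨ ∃ i, y ∈ U i ∧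
      α y = (A i).indicator (fun _ => (q i).1) y ∧ β y = (q i).2 * (ξ i).1 y := fun y => by
    by_cases h : ∃ i, y ∈ U i
    · obtain ⟨i, hi⟩ := h
      have hne : ∀ j, j ≠ i → y ∉ U j := fun j hj h => disjoint_left.1 (hU hj) h hi
      refine Or.inr ⟨i, hi, Finset.sum_eq_single i (fun j _ hj => ?_) (by simp),
        Finset.sum_eq_single i (fun j _ hj => ?_) (by simp)⟩
      · exact indicator_of_notMem (fun h => hne j hj (hAU j h)) _
      · rw [hξU j y (hne j hj), mul_zero]
    · push Not at h
      refine Or.inl ⟨Finset.sum_eq_zero fun i _ => ?_, Finset.sum_eq_zero fun i _ => ?_⟩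
      · exact indicator_of_notMem (fun h' => h i (hAU i h')) _
      · rw [hξU i y (h i), mul_zero]
  have hslope : ∀ i y, (q i).2 * (ξ i).1 y ≤ csSlope ψ := fun i y => by
    have h1 := hψ.slope_le (hq i)
    have h2 := hψ.csSlope_nonneg
    have h3 := hξ0 i y
    have h4 := hξ1 i y
    have h5 := mul_le_mul_of_nonneg_right h1 h3
    have h6 := mul_le_of_le_one_right h2 h4
    linarith
  have hle : ∀ y t, 0 ≤ t → α y + β y * t ≤ csEnvelope ψ t := fun y t ht => by
    rcases hsum y with ⟨h1, h2⟩ | ⟨i, -, h1, h2⟩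
    · rw [h1, h2, zero_mul, add_zero]; exact (hψ.csEnvelope_pos ht).le
    · rw [h1, h2]
      by_cases hy : y ∈ A i
      · rw [indicator_of_mem hy, hξA i y hy, mul_one]
        exact affine_le_csEnvelope (hq i) ht
      -- In the transition layer the intercept is absent, and the reduced slope is at most `Θ`, so
      -- the line `Θ t` below the envelope dominates.
      · rw [indicator_of_notMem hy, zero_add]
        exact (mul_le_mul_of_nonneg_right (hslope i y) ht).trans (hψ.csSlope_mul_le ht)
  have hβΘ : ∀ y, β y ≤ csSlope ψ := fun y => by
    rcases hsum y with ⟨-, h2⟩ | ⟨i, -, -, h2⟩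
    · rw [h2]; exact hψ.csSlope_nonneg
    · rw [h2]; exact hslope i y
  have key := ofReal_integral_add_le_relaxedMeasure x.2.toMeasure ν hαm hβm hαC hβC hle hβΘ
    MeasurableSet.univ
  simp only [setIntegral_univ] at key
  convert key using 2
  rw [Finset.sum_add_distrib, hα, hβ, integral_finsetSum _ fun i _ =>
    (integrable_const (q i).1).indicator (hA i).measurableSet,
    integral_finsetSum _ fun i _ => ((ξ i).integrable x.2).const_mul _]
  congr 1
  · refine Finset.sum_congr rfl fun i _ => ?_
    rw [integral_indicator_const _ (hA i).measurableSet, smul_eq_mul, mul_comm]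
  · exact Finset.sum_congr rfl fun i _ => (integral_const_mul _ _).symm

/-- Coercivity from the constant minorant: near a `φ` outside `W^{1,p}(Ω)` the Dirichlet energy is
arbitrarily large, and this carries over to the relaxed energy. -/
theorem IsRelaxable.const_mul_energy_le [hp : Fact (1 < p)] (hΩ : IsOpen Ω)
    (hΩb : Bornology.IsBounded Ω) {ψ : ℝ → ℝ}
    (hψ : IsRelaxable ψ) {c : ℝ} (hc0 : 0 ≤ c) (hc : (c, (0 : ℝ)) ∈ affineMinorants ψ)
    (x : LpSpace Ω p × PosMeasure Ω) :
    ENNReal.ofReal c * dirichletEnergy Ω p x.1 Ω ≤ relaxedEnergy Ω p ψ x := by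
  by_cases hx : MemSobolev p Ω x.1
  · have := x.2.isFinite
    have h1 := ofReal_affine_le_relaxedMeasure hψ x.2.toMeasure (dirichletMeasure Ω p x.1) hc
      MeasurableSet.univ
    rw [relaxedEnergy_eq ψ hx, dirichletEnergy_eq_dirichletMeasure hΩb hx hΩ subset_rfl]
    refine le_trans ?_ h1
    simp only [zero_mul, add_zero]
    rw [ENNReal.ofReal_mul hc0, ofReal_measureReal]
    gcongr
    exact subset_univ _
  · rw [relaxedEnergy, if_neg hx]; exact le_top

/-- A finite affine lower bound that is nearly sharp at `x` remains a lower bound nearby, and its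
ingredients are lower semicontinuous energies on open sets with non-negative weights and weak*
continuous integrals. The argument works with neighbourhoods, so it gives topological and not only
sequential lower semicontinuity. -/
theorem IsRelaxable.lowerSemicontinuous_relaxedEnergy [hp : Fact (1 < p)] (hΩ : IsOpen Ω)
    (hΩb : Bornology.IsBounded Ω) {ψ : ℝ → ℝ} (hψ : IsRelaxable ψ) :
    LowerSemicontinuous (relaxedEnergy Ω p ψ) := by
  have hlscF : ∀ A : Set (Space d), IsOpen A → A ⊆ Ω →
      LowerSemicontinuous fun z : LpSpace Ω p × PosMeasure Ω => dirichletEnergy Ω p z.1 A :=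
    fun A hA hAΩ => (lowerSemicontinuous_dirichletEnergy hΩb hA hAΩ).comp continuous_fst
  intro x y hy
  by_cases hx : MemSobolev p Ω x.1
  · have := x.2.isFinite
    set ν := dirichletMeasure Ω p x.1 with hν
    set μ := x.2.toMeasure with hμ
    rw [relaxedEnergy_eq ψ hx] at hy
    obtain ⟨N, q, B', hq, hB', hdisj', hlt'⟩ := hψ.exists_partition_lt μ ν hy
    set B := fun i => B' i ∩ Ω with hB
    have hlt : y < ENNReal.ofReal (∑ i, ((q i).1 * ν.real (B i) + (q i).2 * μ.real (B i))) := by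
      have e1 : ∀ i, ν.real (B i) = ν.real (B' i) := fun i => by
        exact congrArg ENNReal.toReal
          (measure_inter_conull (dirichletPosMeasure hΩ x.1).compl_null)
      have e2 : ∀ i, μ.real (B i) = μ.real (B' i) := fun i => by
        exact congrArg ENNReal.toReal (measure_inter_conull x.2.compl_null)
      simpa only [e1, e2] using hlt'
    set D := ∑ i, (2 * (q i).1 + 2 * |(q i).2|) with hD
    have hD0 : 0 ≤ D := Finset.sum_nonneg fun i _ => by
      have := (hq i).1; positivity
    have hyt : y ≠ ⊤ := (hlt.trans ENNReal.ofReal_lt_top).ne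
    set S := ∑ i, ((q i).1 * ν.real (B i) + (q i).2 * μ.real (B i)) with hS
    have hyS : y.toReal < S := (ENNReal.lt_ofReal_iff_toReal_lt hyt).1 hlt
    -- Each mass is off by at most `2 η`, one `η` from replacing `B i` and one from moving to a
    -- nearby point. The total error is then at most `η D`, less than the available gap.
    set η := (S - y.toReal) / (2 * (D + 1)) with hη
    have hη0 : 0 < η := div_pos (by linarith) (by positivity)
    obtain ⟨A, U, ξ, hA, hAΩ, hAU, hU, hξ0, hξ1, hξA, hξU, hνA, hμξ⟩ :=
      exists_separating_testFun hΩ hΩb μ ν (B := B)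
        (fun i => (hB' i).inter hΩ.measurableSet) (fun i => inter_subset_right)
        (fun i j hij => (hdisj' hij).mono inter_subset_left inter_subset_left) hη0
    have ev1 : ∀ᶠ z in 𝓝 x, ∀ i, ENNReal.ofReal (ν.real (A i) - η) ≤
        dirichletEnergy Ω p z.1 (A i) := by
      refine eventually_all.2 fun i => ?_
      rcases le_or_gt (ν.real (A i) - η) 0 with h | h
      · exact Eventually.of_forall fun z => by simp [ENNReal.ofReal_of_nonpos h]
      · have h1 : ENNReal.ofReal (ν.real (A i) - η) < dirichletEnergy Ω p x.1 (A i) := by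
          rw [dirichletEnergy_eq_dirichletMeasure hΩb hx (hA i) (hAΩ i), ← hν,
            ← ofReal_measureReal (μ := ν) (s := A i)]
          exact (ENNReal.ofReal_lt_ofReal_iff (by linarith)).2 (by linarith)
        exact (hlscF (A i) (hA i) (hAΩ i) x _ h1).mono fun z hz => hz.le
    have ev2 : ∀ᶠ z in 𝓝 x, ∀ i, |∫ t, (ξ i).1 t ∂z.2.toMeasure - ∫ t, (ξ i).1 t ∂μ| < η := by
      refine eventually_all.2 fun i => ?_
      have hc : Continuous fun z : LpSpace Ω p × PosMeasure Ω =>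
          ∫ t, (ξ i).1 t ∂z.2.toMeasure := (continuous_integral_testFun (ξ i)).comp continuous_snd
      exact (Metric.tendsto_nhds.1 hc.continuousAt η hη0)
    filter_upwards [ev1, ev2] with z hz1 hz2
    by_cases hz : MemSobolev p Ω z.1
    · refine lt_of_lt_of_le ?_ (hψ.ofReal_sum_le_relaxedEnergy hq hA hAU hU hξ0 hξ1 hξA hξU hz)
      rw [ENNReal.lt_ofReal_iff_toReal_lt hyt]
      have hterm : ∀ i, (q i).1 * ν.real (B i) + (q i).2 * μ.real (B i) -
          η * (2 * (q i).1 + 2 * |(q i).2|) ≤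
          (q i).1 * (dirichletMeasure Ω p z.1).real (A i) +
            (q i).2 * ∫ t, (ξ i).1 t ∂z.2.toMeasure := fun i => by
        have h1 := hz1 i
        rw [dirichletEnergy_eq_dirichletMeasure hΩb hz (hA i) (hAΩ i),
          ENNReal.ofReal_le_iff_le_toReal (measure_ne_top _ _), ← measureReal_def] at h1
        have h2 := hνA i
        have h3 : ν.real (B i) - 2 * η ≤ (dirichletMeasure Ω p z.1).real (A i) := by linarith
        have h4 := mul_le_mul_of_nonneg_left h3 (hq i).1
        have h5 : |∫ t, (ξ i).1 t ∂z.2.toMeasure - μ.real (B i)| ≤ 2 * η := by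
          have h6 := hμξ i
          have h7 := (hz2 i).le
          rw [abs_le] at h6 h7 ⊢
          constructor <;> linarith [h6.1, h6.2, h7.1, h7.2]
        have h8 : |(q i).2 * (∫ t, (ξ i).1 t ∂z.2.toMeasure - μ.real (B i))| ≤
            |(q i).2| * (2 * η) := by
          rw [abs_mul]; exact mul_le_mul_of_nonneg_left h5 (abs_nonneg _)
        have h9 := (abs_le.1 h8).1
        linarith
      have h10 := Finset.sum_le_sum fun i (_ : i ∈ Finset.univ) => hterm i
      rw [Finset.sum_sub_distrib, ← hS, ← Finset.mul_sum, ← hD] at h10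
      have h11 : η * D < S - y.toReal := by
        have : η * (2 * (D + 1)) = S - y.toReal := by rw [hη]; field_simp
        nlinarith
      linarith
    · rw [relaxedEnergy, if_neg hz]; exact hyt.lt_top
  · have hyt : y < ⊤ := hy.trans_le le_top
    obtain ⟨c, hc0, hc⟩ := hψ.exists_const_mem
    have hc0' : ENNReal.ofReal c ≠ 0 := (ENNReal.ofReal_pos.2 hc0).ne'
    have h1 : y / ENNReal.ofReal c < dirichletEnergy Ω p x.1 Ω := by
      rw [dirichletEnergy, if_neg hx]
      exact ENNReal.div_lt_top hyt.ne hc0'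
    filter_upwards [hlscF Ω hΩ subset_rfl x _ h1] with z hz
    refine lt_of_lt_of_le ?_ (hψ.const_mul_energy_le hΩ hΩb hc0.le hc z)
    rwa [gt_iff_lt, ENNReal.div_lt_iff (Or.inl hc0') (Or.inl ENNReal.ofReal_ne_top), mul_comm] at hz

theorem IsRelaxable.relaxedEnergy_le [hp : Fact (1 < p)] {ψ : ℝ → ℝ} (hψ : IsRelaxable ψ) :
    relaxedEnergy Ω p ψ ≤ relativeEnergy Ω p ψ := by
  intro x
  have := x.2.isFinite
  have := isFiniteMeasure_dirichletMeasure x.1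
  rw [relativeEnergy]
  split_ifs with h
  · rw [relaxedEnergy, if_pos h.1, Measure.singularPart_eq_zero_of_ac h.2]
    simp only [Measure.coe_zero, Pi.zero_apply, mul_zero, add_zero]
    exact lintegral_mono fun y =>
      ENNReal.ofReal_le_ofReal (hψ.csEnvelope_le_self ENNReal.toReal_nonneg)
  · exact le_top

end Lsc

/-! ### Recovery sequences -/

section Recovery

variable {d : ℕ} {Ω : Set (Space d)} {p : ℝ}

theorem volume_hyperplane (i : Fin d) (r : ℝ) : volume {x : Space d | x i = r} = 0 := by
  have h := (PiLp.volume_preserving_ofLp (Fin d)).measure_preimage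
    (s := {f : Fin d → ℝ | f i = r})
    (measurableSet_eq_fun (measurable_pi_apply i) measurable_const).nullMeasurableSet
  have h0 : (volume : Measure (Fin d → ℝ)) {f : Fin d → ℝ | f i = r} = 0 :=
    Measure.pi_hyperplane (α := fun _ => ℝ) (fun _ => volume) i r
  exact h.trans h0

/-- A finite measure with a density takes all intermediate values on subsets of a bounded set. -/
theorem exists_subset_measureReal_eq (hd : 1 ≤ d) {ν : Measure (Space d)} [IsFiniteMeasure ν]
    (hν : ν ≪ volume) {Q : Set (Space d)} (hQ : MeasurableSet Q) (hQb : Bornology.IsBounded Q)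
    {a : ℝ} (ha : 0 ≤ a) (haQ : a ≤ ν.real Q) :
    ∃ Q' ⊆ Q, MeasurableSet Q' ∧ ν.real Q' = a := by
  set i : Fin d := ⟨0, hd⟩
  obtain ⟨R, hR⟩ := hQb.exists_norm_le
  have hcoord : ∀ x ∈ Q, |x i| ≤ |R| := fun x hx =>
    (PiLp.norm_apply_le x i).trans ((hR x hx).trans (le_abs_self R))
  have hm : ∀ r : ℝ, MeasurableSet {x : Space d | x i ≤ r} := fun r =>
    measurableSet_le (by fun_prop) measurable_const
  -- `g r` is the mass of the part of `Q` below height `r` in one coordinate. It is continuous by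
  -- dominated convergence because hyperplanes are null, so it takes the value `a`.
  set g : ℝ → ℝ := fun r => ∫ x in Q, {x : Space d | x i ≤ r}.indicator (fun _ => (1 : ℝ)) x ∂ν
    with hg
  have hgeq : ∀ r, g r = ν.real (Q ∩ {x : Space d | x i ≤ r}) := fun r => by
    rw [hg]
    simp only
    rw [integral_indicator_const _ (hm r), measureReal_restrict_apply (hm r), smul_eq_mul,
      mul_one, inter_comm]
  have hcont : Continuous g := by
    refine continuous_iff_continuousAt.2 fun r => ?_
    refine continuousAt_of_dominated (bound := fun _ => 1) ?_ ?_ (integrable_const _) ?_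
    · exact Eventually.of_forall fun s =>
        (measurable_const.indicator (hm s)).aestronglyMeasurable
    · refine Eventually.of_forall fun s => ae_of_all _ fun x => ?_
      by_cases hx : x ∈ {x : Space d | x i ≤ s}
      · simp [indicator_of_mem hx]
      · simp [indicator_of_notMem hx]
    · have h0 : ∀ᵐ x ∂ν, x ∉ {x : Space d | x i = r} :=
        measure_eq_zero_iff_ae_notMem.1 (hν (volume_hyperplane i r))
      filter_upwards [ae_restrict_of_ae h0] with x hx
      rcases lt_or_gt_of_ne hx with h | h
      · refine (continuousAt_const (y := (1 : ℝ))).congr ?_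
        filter_upwards [lt_mem_nhds h] with s hs
        exact (indicator_of_mem (show x ∈ {x : Space d | x i ≤ s} from le_of_lt hs)
          fun _ => (1 : ℝ)).symm
      · refine (continuousAt_const (y := (0 : ℝ))).congr ?_
        filter_upwards [gt_mem_nhds h] with s hs
        exact (indicator_of_notMem (show x ∉ {x : Space d | x i ≤ s} from not_le.2 hs)
          fun _ => (1 : ℝ)).symm
  have hlow : g (-|R| - 1) ≤ a := by
    have : Q ∩ {x : Space d | x i ≤ -|R| - 1} = ∅ := by
      refine eq_empty_of_forall_notMem fun x hx => ?_
      have h1 := neg_le_of_abs_le (hcoord x hx.1)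
      have h2 : x i ≤ -|R| - 1 := hx.2
      linarith
    rw [hgeq, this]; simpa using ha
  have hhigh : a ≤ g |R| := by
    have : Q ∩ {x : Space d | x i ≤ |R|} = Q :=
      inter_eq_self_of_subset_left fun x hx => (le_abs_self _).trans (hcoord x hx)
    rwa [hgeq, this]
  obtain ⟨r, -, hr⟩ := intermediate_value_Icc (by linarith [abs_nonneg R]) hcont.continuousOn
    ⟨hlow, hhigh⟩
  exact ⟨_, inter_subset_left, hQ.inter (hm r), by rw [← hgeq, hr]⟩

/-- A mixture is realised by a density on any bounded set of the right mass. -/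
theorem exists_density_of_mem_mixtures (hd : 1 ≤ d) {ν : Measure (Space d)} [IsFiniteMeasure ν]
    (hν : ν ≪ volume) {ψ : ℝ → ℝ} (hψ : ∀ t, 0 ≤ t → 0 ≤ ψ t) {v : ℝ × ℝ × ℝ}
    (hv : v ∈ mixtures ψ) {Q : Set (Space d)} (hQ : MeasurableSet Q)
    (hQb : Bornology.IsBounded Q) (hQv : ν.real Q = v.1) :
    ∃ u : Space d → ℝ, Measurable u ∧ (∀ x, 0 ≤ u x) ∧
      ∫⁻ x in Q, ENNReal.ofReal (u x) ∂ν = ENNReal.ofReal v.2.1 ∧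
      ∫⁻ x in Q, ENNReal.ofReal (ψ (u x)) ∂ν = ENNReal.ofReal v.2.2 := by
  classical
  induction hv using AddSubmonoid.closure_induction generalizing Q with
  | mem v hv =>
    obtain ⟨l, t, hl, ht, rfl⟩ := hv
    have hQ' : ν Q = ENNReal.ofReal l := by
      rw [← ofReal_measureReal (μ := ν) (s := Q), hQv]
    refine ⟨fun _ => t, measurable_const, fun _ => ht, ?_, ?_⟩
    · rw [setLIntegral_const, hQ', ← ENNReal.ofReal_mul ht, mul_comm]
    · rw [setLIntegral_const, hQ', ← ENNReal.ofReal_mul (hψ t ht), mul_comm]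
  | zero =>
    have hQ' : ν Q = 0 := by
      rw [← ofReal_measureReal (μ := ν) (s := Q), hQv]; simp
    exact ⟨fun _ => 0, measurable_const, fun _ => le_rfl,
      by simp [Measure.restrict_eq_zero.2 hQ'], by simp [Measure.restrict_eq_zero.2 hQ']⟩
  | add v w hv hw ihv ihw =>
    have nv := mixtures_nonneg hψ hv
    have nw := mixtures_nonneg hψ hw
    have hsum : ν.real Q = v.1 + w.1 := hQv
    -- A sum of mixtures is realised by cutting `Q` into pieces whose masses are those of the
    -- summands and gluing the two densities.
    obtain ⟨Q₁, hQ₁, hQ₁m, hQ₁v⟩ := exists_subset_measureReal_eq hd hν hQ hQb nv.1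
      (by rw [hsum]; linarith [nw.1])
    have hQ₂v : ν.real (Q \ Q₁) = w.1 := by
      rw [measureReal_sdiff hQ₁ hQ₁m, hsum, hQ₁v, add_sub_cancel_left]
    obtain ⟨u₁, m₁, n₁, a₁, b₁⟩ := ihv hQ₁m (hQb.subset hQ₁) hQ₁v
    obtain ⟨u₂, m₂, n₂, a₂, b₂⟩ := ihw (hQ.diff hQ₁m) (hQb.subset sdiff_subset) hQ₂v
    have hsplit : ∀ f : ℝ → ℝ≥0∞, ∫⁻ x in Q, f (Q₁.piecewise u₁ u₂ x) ∂ν =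
        ∫⁻ x in Q₁, f (u₁ x) ∂ν + ∫⁻ x in Q \ Q₁, f (u₂ x) ∂ν := fun f => by
      have e1 : ∫⁻ x in Q₁, f (u₁ x) ∂ν = ∫⁻ x in Q₁, f (Q₁.piecewise u₁ u₂ x) ∂ν :=
        setLIntegral_congr_fun hQ₁m fun x hx => by simp only [piecewise_eq_of_mem _ _ _ hx]
      have e2 : ∫⁻ x in Q \ Q₁, f (u₂ x) ∂ν = ∫⁻ x in Q \ Q₁, f (Q₁.piecewise u₁ u₂ x) ∂ν :=
        setLIntegral_congr_fun (hQ.diff hQ₁m) fun x hx => by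
          simp only [piecewise_eq_of_notMem _ _ _ hx.2]
      rw [e1, e2, ← lintegral_union (hQ.diff hQ₁m) disjoint_sdiff_right, union_sdiff_self,
        union_eq_self_of_subset_left hQ₁]
    refine ⟨Q₁.piecewise u₁ u₂, m₁.piecewise hQ₁m m₂, fun x => ?_, ?_, ?_⟩
    · by_cases hx : x ∈ Q₁
      · rw [piecewise_eq_of_mem _ _ _ hx]; exact n₁ x
      · rw [piecewise_eq_of_notMem _ _ _ hx]; exact n₂ x
    · rw [hsplit ENNReal.ofReal, a₁, a₂, ← ENNReal.ofReal_add nv.2.1 nw.2.1]; rfl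
    · rw [hsplit fun t => ENNReal.ofReal (ψ t), b₁, b₂, ← ENNReal.ofReal_add nv.2.2 nw.2.2]; rfl

theorem IsFinePartition.lintegral_eq_sum {ι : Type*} [Fintype ι] {δ : ℝ}
    {Q : ι → Set (Space d)} (hQ : IsFinePartition Ω δ Q) (μ : PosMeasure Ω)
    (f : Space d → ℝ≥0∞) :
    ∫⁻ x, f x ∂μ.toMeasure = ∑ i, ∫⁻ x in Q i, f x ∂μ.toMeasure := by
  conv_lhs => rw [← hQ.restrict_eq μ]
  rw [lintegral_sum_measure, tsum_fintype]

theorem IsFinePartition.relaxedMeasure_eq_sum [hp : Fact (1 < p)] (hΩ : IsOpen Ω) {ι : Type*}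
    [Fintype ι] {δ : ℝ} {Q : ι → Set (Space d)} (hQ : IsFinePartition Ω δ Q) (ψ : ℝ → ℝ)
    (φ : LpSpace Ω p) (μ : PosMeasure Ω) :
    relaxedMeasure ψ (dirichletMeasure Ω p φ) μ.toMeasure univ =
      ∑ i, relaxedMeasure ψ (dirichletMeasure Ω p φ) μ.toMeasure (Q i) := by
  have := μ.isFinite
  simp only [relaxedMeasure, setLIntegral_univ, Finset.sum_add_distrib, ← Finset.mul_sum]
  congr 1
  · exact hQ.lintegral_eq_sum (dirichletPosMeasure hΩ φ) _
  · have h := hQ.lintegral_eq_sum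
      ⟨μ.toMeasure.singularPart (dirichletMeasure Ω p φ),
        isFiniteMeasure_of_le _ (Measure.singularPart_le _ _),
        (Measure.singularPart_le _ _).absolutelyContinuous μ.compl_null⟩ (fun _ => 1)
    simp only [lintegral_one, Measure.restrict_apply_univ] at h
    rw [h]

theorem relativeEnergy_withDensity [hp : Fact (1 < p)] (hΩ : IsOpen Ω) {ψ : ℝ → ℝ}
    {φ : LpSpace Ω p} (hφ : MemSobolev p Ω φ) {u : Space d → ℝ} (hu : Measurable u)
    (hu0 : ∀ x, 0 ≤ u x) (hint : Integrable u (dirichletPosMeasure hΩ φ).toMeasure) :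
    relativeEnergy Ω p ψ (φ, (dirichletPosMeasure hΩ φ).mulDensity u hint) =
      ∫⁻ x, ENNReal.ofReal (ψ (u x)) ∂(dirichletMeasure Ω p φ) := by
  rw [relativeEnergy, if_pos ⟨hφ, withDensity_absolutelyContinuous _ _⟩]
  refine lintegral_congr_ae ?_
  have h := Measure.rnDeriv_withDensity (dirichletMeasure Ω p φ) hu.ennreal_ofReal
  filter_upwards [h] with x hx
  have e : ((dirichletPosMeasure hΩ φ).mulDensity u hint).toMeasure.rnDeriv
      (dirichletMeasure Ω p φ) x = ENNReal.ofReal (u x) := hx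
  simp only [e, ENNReal.toReal_ofReal (hu0 x)]

/-- On each cell a nearly optimal mixture fixes three numbers: its total mass, exceeding the current
energy, to which the energy is raised; its mean, equal to the mass of `μ` including the singular
part; and its cost, within `η` of the relaxed energy of the cell. -/
theorem IsRelaxable.exists_approximation [hp : Fact (1 < p)] (hd : 1 ≤ d) (hΩ : IsOpen Ω)
    (hΩb : Bornology.IsBounded Ω) {ψ : ℝ → ℝ} (hψ : IsRelaxable ψ)
    {x : LpSpace Ω p × PosMeasure Ω} (hx : MemSobolev p Ω x.1)
    (hfin : relaxedEnergy Ω p ψ x ≠ ⊤) {δ : ℝ} (hδ : 0 < δ) :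
    ∃ z : LpSpace Ω p × PosMeasure Ω, ‖z.1 - x.1‖ ≤ δ ∧
      (∃ (ι : Type) (_ : Fintype ι) (Q : ι → Set (Space d)), IsFinePartition Ω δ Q ∧
        ∀ i, z.2.toMeasure (Q i) = x.2.toMeasure (Q i)) ∧
      relativeEnergy Ω p ψ z ≤ relaxedEnergy Ω p ψ x + ENNReal.ofReal δ := by
  have := x.2.isFinite
  obtain ⟨ι, _, Q, hQ⟩ := exists_isFinePartition hΩ hΩb hδ
  have hQb : ∀ i, Bornology.IsBounded (Q i) := fun i =>
    hΩb.subset (hQ.iUnion ▸ subset_iUnion Q i)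
  have hψ0 : ∀ t, 0 ≤ t → 0 ≤ ψ t := fun t ht =>
    (hψ.csEnvelope_pos ht).le.trans (hψ.csEnvelope_le_self ht)
  rw [relaxedEnergy_eq ψ hx, hQ.relaxedMeasure_eq_sum hΩ] at hfin ⊢
  set ν := dirichletMeasure Ω p x.1
  set μ := x.2.toMeasure
  have hfin' : ∀ i, relaxedMeasure ψ ν μ (Q i) ≠ ⊤ := fun i =>
    (ENNReal.sum_ne_top.1 hfin) i (Finset.mem_univ i)
  set η := δ / (Fintype.card ι + 1) with hη
  have hη0 : 0 < η := by positivity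
  have hmix : ∀ i, ∃ L e : ℝ, ν.real (Q i) < L ∧
      e ≤ (relaxedMeasure ψ ν μ (Q i)).toReal + η ∧ (L, μ.real (Q i), e) ∈ mixtures ψ := fun i =>
    hψ.exists_mixture measureReal_nonneg measureReal_nonneg hη0 fun q hq =>
      (ENNReal.ofReal_le_iff_le_toReal (hfin' i)).1
        (ofReal_affine_le_relaxedMeasure hψ μ ν hq (hQ.measurable i))
  choose L e hL he hmem using hmix
  have hL0 : ∀ i, 0 ≤ L i := fun i => (mixtures_nonneg hψ0 (hmem i)).1
  obtain ⟨φ', hφ', hnorm, hφ'L⟩ := exists_energy_eq_on_cells hd hΩ hΩb x.1 hx hQ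
    (fun i => ENNReal.ofReal (L i)) (fun i => ENNReal.ofReal_ne_top)
    (fun i => by
      rw [← ofReal_measureReal (μ := dirichletMeasure Ω p x.1)]
      exact ENNReal.ofReal_le_ofReal (hL i).le) hδ
  set ν' := dirichletMeasure Ω p φ' with hν'
  have hac : ν' ≪ volume := (dirichletMeasure_absolutelyContinuous φ').trans
    Measure.restrict_le_self.absolutelyContinuous
  have hdens := fun i => exists_density_of_mem_mixtures hd hac hψ0 (hmem i) (hQ.measurable i)
    (hQb i) (by rw [measureReal_def, hφ'L i, ENNReal.toReal_ofReal (hL0 i)])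
  choose u hum hu0 hu1 hu2 using hdens
  set w : Space d → ℝ := fun y => ∑ i, (Q i).indicator (u i) y with hw
  have hwm : Measurable w :=
    Finset.measurable_fun_sum _ fun i _ => (hum i).indicator (hQ.measurable i)
  have hw0 : ∀ y, 0 ≤ w y := fun y =>
    Finset.sum_nonneg fun i _ => indicator_nonneg (fun y _ => hu0 i y) y
  have hwQ : ∀ i, ∀ y ∈ Q i, w y = u i y := fun i y hy => by
    rw [hw]
    simp only
    rw [Finset.sum_eq_single i (fun j _ hj => indicator_of_notMem
      (fun h => disjoint_left.1 (hQ.disjoint hj) h hy) _) (by simp), indicator_of_mem hy]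
  have hwset : ∀ (f : ℝ → ℝ≥0∞) i, ∫⁻ y in Q i, f (w y) ∂ν' = ∫⁻ y in Q i, f (u i y) ∂ν' :=
    fun f i => setLIntegral_congr_fun (hQ.measurable i) fun y hy => by simp only [hwQ i y hy]
  have hint : Integrable w (dirichletPosMeasure hΩ φ').toMeasure := by
    refine ⟨hwm.aestronglyMeasurable, ?_⟩
    rw [hasFiniteIntegral_iff_ofReal (ae_of_all _ hw0), hQ.lintegral_eq_sum]
    refine ENNReal.sum_lt_top.2 fun i _ => ?_
    exact ((hwset ENNReal.ofReal i).trans (hu1 i)).trans_lt ENNReal.ofReal_lt_top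
  refine ⟨(φ', (dirichletPosMeasure hΩ φ').mulDensity w hint), hnorm,
    ⟨ι, inferInstance, Q, hQ, fun i => ?_⟩, ?_⟩
  · have h1 : ((dirichletPosMeasure hΩ φ').mulDensity w hint).toMeasure (Q i) =
        ∫⁻ y in Q i, ENNReal.ofReal (w y) ∂ν' := withDensity_apply _ (hQ.measurable i)
    change ((dirichletPosMeasure hΩ φ').mulDensity w hint).toMeasure (Q i) = μ (Q i)
    rw [h1, hwset ENNReal.ofReal i, hu1 i, ofReal_measureReal]
  · rw [relativeEnergy_withDensity hΩ hφ' hwm hw0 hint]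
    have h1 := hQ.lintegral_eq_sum (dirichletPosMeasure hΩ φ') fun y => ENNReal.ofReal (ψ (w y))
    refine (h1.trans (Finset.sum_congr rfl fun i _ =>
      (hwset (fun t => ENNReal.ofReal (ψ t)) i).trans (hu2 i))).le.trans ?_
    have h2 : ∀ i, ENNReal.ofReal (e i) ≤ relaxedMeasure ψ ν μ (Q i) + ENNReal.ofReal η :=
      fun i => by
        refine (ENNReal.ofReal_le_ofReal (he i)).trans ?_
        rw [ENNReal.ofReal_add ENNReal.toReal_nonneg hη0.le, ENNReal.ofReal_toReal (hfin' i)]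
    refine (Finset.sum_le_sum fun i _ => h2 i).trans ?_
    rw [Finset.sum_add_distrib]
    gcongr
    rw [Finset.sum_const, Finset.card_univ, nsmul_eq_mul, ← ENNReal.ofReal_natCast,
      ← ENNReal.ofReal_mul (by positivity)]
    refine ENNReal.ofReal_le_ofReal ?_
    rw [hη, mul_div_assoc', div_le_iff₀ (by positivity)]
    nlinarith

theorem IsRelaxable.exists_recovery [hp : Fact (1 < p)] (hd : 1 ≤ d) (hΩ : IsOpen Ω)
    (hΩb : Bornology.IsBounded Ω) {ψ : ℝ → ℝ} (hψ : IsRelaxable ψ)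
    (x : LpSpace Ω p × PosMeasure Ω) :
    ∃ xs : ℕ → LpSpace Ω p × PosMeasure Ω, Tendsto xs atTop (𝓝 x) ∧
      limsup (fun n => relativeEnergy Ω p ψ (xs n)) atTop ≤ relaxedEnergy Ω p ψ x := by
  by_cases hfin : relaxedEnergy Ω p ψ x = ⊤
  · exact ⟨fun _ => x, tendsto_const_nhds, hfin ▸ le_top⟩
  have hx : MemSobolev p Ω x.1 := by
    by_contra h
    exact hfin (by rw [relaxedEnergy, if_neg h])
  have key := fun n : ℕ => hψ.exists_approximation hd hΩ hΩb hx hfin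
    (δ := 1 / ((n : ℝ) + 1)) Nat.one_div_pos_of_nat
  choose xs h1 h2 h3 using key
  refine ⟨xs, ?_, ?_⟩
  · have t1 : Tendsto (fun n => (xs n).1) atTop (𝓝 x.1) := by
      rw [tendsto_iff_norm_sub_tendsto_zero]
      exact squeeze_zero (fun _ => norm_nonneg _) h1 tendsto_one_div_add_atTop_nhds_zero_nat
    exact t1.prodMk_nhds (tendsto_posMeasure h2)
  · have t2 : Tendsto (fun n : ℕ => relaxedEnergy Ω p ψ x + ENNReal.ofReal (1 / ((n : ℝ) + 1)))
        atTop (𝓝 (relaxedEnergy Ω p ψ x)) := by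
      have := ENNReal.tendsto_ofReal (tendsto_one_div_add_atTop_nhds_zero_nat (𝕜 := ℝ))
      simpa using this.const_add (relaxedEnergy Ω p ψ x)
    exact (limsup_le_limsup (Eventually.of_forall h3)).trans_eq t2.limsup_eq

end Recovery

/-! ### From recovery sequences to the envelope and the Γ-limit -/

section Relaxation

variable {Y : Type*} [TopologicalSpace Y]

theorem le_liminf_of_lowerSemicontinuous {K G : Y → ℝ≥0∞} (hK : LowerSemicontinuous K)
    (hKG : K ≤ G) {x : Y} {xs : ℕ → Y} (h : Tendsto xs atTop (𝓝 x)) :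
    K x ≤ liminf (fun n => G (xs n)) atTop := by
  refine le_of_forall_lt fun y hy => ?_
  obtain ⟨z, hyz, hz⟩ := exists_between hy
  refine hyz.trans_le (le_liminf_of_le (by isBoundedDefault) ?_)
  exact (h.eventually (hK x z hz)).mono fun n hn => (le_of_lt hn).trans (hKG _)

theorem gammaConverges_const {G H : Y → ℝ≥0∞} (hH : LowerSemicontinuous H) (hHG : H ≤ G)
    (hrec : ∀ x, ∃ xs : ℕ → Y, Tendsto xs atTop (𝓝 x) ∧
      limsup (fun n => G (xs n)) atTop ≤ H x) : GammaConverges (fun _ => G) H :=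
  ⟨fun _ _ h => le_liminf_of_lowerSemicontinuous hH hHG h, hrec⟩

/-- Along a recovery sequence any lower semicontinuous `K ≤ G` satisfies `K x ≤ liminf G ≤ limsup G
≤ H x`. Sequences suffice here without first countability, since lower semicontinuity of `H` is
assumed topologically. -/
theorem isLscEnvelope_of_recovery {G H : Y → ℝ≥0∞} (hH : LowerSemicontinuous H) (hHG : H ≤ G)
    (hrec : ∀ x, ∃ xs : ℕ → Y, Tendsto xs atTop (𝓝 x) ∧
      limsup (fun n => G (xs n)) atTop ≤ H x) : IsLscEnvelope G H := by
  refine ⟨⟨hH, hHG⟩, fun K hK x => ?_⟩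
  obtain ⟨xs, h1, h2⟩ := hrec x
  exact (le_liminf_of_lowerSemicontinuous hK.1 hK.2 h1).trans ((liminf_le_limsup (by isBoundedDefault) (by isBoundedDefault)).trans h2)

end Relaxation

end

end DirichletRelaxation

theorem mainTheorem7 (d : ℕ) (hd : 1 ≤ d)
    (Ω : Set (DirichletRelaxation.Space d)) (hΩ : IsOpen Ω) (hΩb : Bornology.IsBounded Ω)
    (p : ℝ) [Fact (1 < p)] :
    DirichletRelaxation.IsAdmissible Ω p (DirichletRelaxation.dirichletEnergy Ω p) ∧
    ∀ ψ : ℝ → ℝ, Measurable (fun t : NNReal => ψ t) →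
      (∃ c : ℝ, 0 < c ∧ ∀ t : ℝ, 0 ≤ t → c ≤ ψ t) →
      LowerSemicontinuousWithinAt ψ (Set.Ici 0) 0 →
        Filter.Tendsto (fun t : ℝ => DirichletRelaxation.csEnvelope ψ t / t) Filter.atTop
          (nhds (DirichletRelaxation.csSlope ψ)) ∧
        DirichletRelaxation.IsLscEnvelope
          (DirichletRelaxation.relativeEnergy Ω p ψ)
          (DirichletRelaxation.relaxedEnergy Ω p ψ) ∧
        DirichletRelaxation.GammaConverges
          (fun _ : ℕ => DirichletRelaxation.relativeEnergy Ω p ψ)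
          (DirichletRelaxation.relaxedEnergy Ω p ψ) := by
  refine ⟨DirichletRelaxation.isAdmissible_dirichletEnergy hd hΩ hΩb, fun ψ _ hb hl => ?_⟩
  have hψ : DirichletRelaxation.IsRelaxable ψ := ⟨hb, hl⟩
  have hlsc := hψ.lowerSemicontinuous_relaxedEnergy (p := p) hΩ hΩb
  exact ⟨hψ.tendsto_csEnvelope_div,
    DirichletRelaxation.isLscEnvelope_of_recovery hlsc hψ.relaxedEnergy_le
      (hψ.exists_recovery hd hΩ hΩb),
    DirichletRelaxation.gammaConverges_const hlsc hψ.relaxedEnergy_le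
      (hψ.exists_recovery hd hΩ hΩb)⟩
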